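/- Let $p$ be an odd prime and let $L$ be a non-degenerate even lattice of signature $(b^+,b^-)$, with quadratic form $Q$ (integral on $L$), bilinear form $(x,y)=Q(x+y)-Q(x)-Q(y)$ and dual lattice $L'$. Suppose that $L'/L\cong\mathbb Z/p\mathbb Z$ and that, under this isomorphism, the discriminant form is $Q(\gamma)=\lambda\gamma^2/p \bmod \mathbb Z$ with $\lambda\in\mathbb Z$ (necessarily $p\nmid\lambda$). Then $b^+-b^-$ is even. Let $k$ be an integer with $k\equiv\frac{b^+-b^-}{2}\pmod 2$, and put $\epsilon=\left(\frac{\lambda}{p}\right)$, $\delta=\left(\frac{-1}{p}\right)\epsilon$. Write $\tau=x+iy\in\mathbb H$, $e(z)=e^{2\pi iz}$, $q=e(\tau)$. *Scalar forms.* $H_k(\Gamma_0(p),(\frac{\cdot}{p}))$ is the space of smooth $f:\mathbb H\to\mathbb C$ such that (i) $f(\frac{a\tau+b}{c\tau+d})=\left(\frac dp\right)(c\tau+d)^kf(\tau)$ for all $\begin{pmatrix}a&b\\c&d\end{pmatrix}\in\Gamma_0(p)$; (ii) $\Delta_kf=0$, where $\Delta_k=-y^2(\partial_x^2+\partial_y^2)+iky(\partial_x+i\partial_y)$;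 (iii) $f(\tau)=P(\tau)+O(e^{-\varepsilon y})$ as $y\to\infty$ for some $\varepsilon>0$ and some polynomial $P$ in $q^{-1}$, and analogously at all cusps. Such an $f$ has a unique Fourier expansion $f=\sum_{n\in\mathbb Z}c_f(n,y)q^n$ with $c_f(n,y)=c_f^+(n)+c_f^-(n)\,\Gamma(1-k,4\pi|n|y)$, where $c_f^+(n)=0$ for $n\ll0$, $c_f^-(n)=0$ for $n\ge0$, and $\Gamma(a,y)=\int_y^\infty e^{-t}t^{a-1}\,dt$. For $\eta\in\{\pm1\}$ let $H_k^{\eta}(\Gamma_0(p),(\frac{\cdot}{p}))$ be the subspace of those $f$ with $c_f^{\pm}(n)=0$ whenever $\left(\frac np\right)=-\eta$. *Vector valued forms.* $\mathrm{Mp}_2(\mathbb Z)$ is the group of pairs $(M,\phi)$ with $M=\begin{pmatrix}a&b\\c&d\end{pmatrix}\in\mathrm{SL}_2(\mathbb Z)$ and $\phi:\mathbb H\to\mathbb C$ holomorphic with $\phi(\tau)^2=c\tau+d$. Let $\rho_L$ be the Weil representation of $\mathrm{Mp}_2(\mathbb Z)$ on $\mathbb C[L'/L]=\bigoplus_{\gamma}\mathbb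 C\,\mathfrak e_\gamma$, determined by $\rho_L(T)\mathfrak e_\gamma=e(Q(\gamma))\mathfrak e_\gamma$ and $\rho_L(S)\mathfrak e_\gamma=\frac{e((b^--b^+)/8)}{\sqrt{|L'/L|}}\sum_{\gamma'\in L'/L}e(-(\gamma,\gamma'))\mathfrak e_{\gamma'}$, where $T=(\begin{pmatrix}1&1\\0&1\end{pmatrix},1)$ and $S=(\begin{pmatrix}0&-1\\1&0\end{pmatrix},\sqrt\tau)$, and let $\bar\rho_L$ be its dual representation. $H_{k,\rho_L}$ (resp. $H_{k,\bar\rho_L}$) is the space of smooth $F=\sum_\gamma F_\gamma\mathfrak e_\gamma:\mathbb H\to\mathbb C[L'/L]$ such that (i) $F(M\tau)=\phi(\tau)^{2k}\rho(M,\phi)F(\tau)$ for all $(M,\phi)\in\mathrm{Mp}_2(\mathbb Z)$, with $\rho=\rho_L$ (resp. $\rho=\bar\rho_L$); (ii) $\Delta_kF=0$; (iii) $F(\tau)=P(\tau)+O(e^{-\varepsilon y})$ as $y\to\infty$ for some $\varepsilon>0$ and some finite sum $P(\tau)=\sum_\gamma\sum_{n\le0}c(\gamma,n)e(n\tau)\mathfrak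 e_\gamma$ over $n\in\mathbb Z+Q(\gamma)$ (resp. $n\in\mathbb Z-Q(\gamma)$). Put $s(\gamma)=2$ if $\gamma=0$ and $s(\gamma)=1$ otherwise. Then the map $f\mapsto F=\sum_\gamma F_\gamma\mathfrak e_\gamma$ with $$F_\gamma(\tau)=s(\gamma)\sum_{\substack{n\in\mathbb Z\\ n\equiv pQ(\gamma)\bmod p}}c_f\!\left(n,\tfrac yp\right)q^{n/p}$$ is a $\mathbb C$-linear isomorphism of $H_k^{\epsilon}(\Gamma_0(p),(\frac{\cdot}{p}))$ onto $H_{k,\rho_L}$. Likewise, the map given by the same formula with $Q$ replaced by $-Q$, that is, with the sum over $n\equiv-pQ(\gamma)\bmod p$, is a $\mathbb C$-linear isomorphism of $H_k^{\delta}(\Gamma_0(p),(\frac{\cdot}{p}))$ onto $H_{k,\bar\rho_L}$. -/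

import Mathlib

open UpperHalfPlane ModularGroup
open scoped Manifold ContDiff MatrixGroups

noncomputable section

namespace MaassLift

/-! ### Even lattices and their discriminant forms -/

/-- A non-degenerate even lattice in the rational quadratic space `(V, Q)`: the `ℤ`-span of a
`ℚ`-basis of `V` on which `Q` takes integral values. -/
structure EvenLattice (V : Type*) [AddCommGroup V] [Module ℚ V] where
  Q : QuadraticForm ℚ V
  nondegenerate : LinearMap.BilinForm.Nondegenerate (QuadraticMap.polarBilin Q)
  carrier : Submodule ℤ V
  isLattice : ∃ (n : ℕ) (b : Module.Basis (Fin n) ℚ V),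
    carrier = Submodule.span ℤ (Set.range b)
  even : ∀ x ∈ carrier, ∃ m : ℤ, Q x = m

namespace EvenLattice

variable {V : Type*} [AddCommGroup V] [Module ℚ V] (L : EvenLattice V)

/-- The bilinear form `(x, y) = Q (x + y) - Q x - Q y`. -/
abbrev bilin : LinearMap.BilinForm ℚ V := QuadraticMap.polarBilin L.Q

/-- The dual lattice `L'`. -/
def dual : Submodule ℤ V := L.bilin.dualSubmodule L.carrier

/-- The discriminant group `L' / L`. -/
abbrev Disc : Type _ := L.dual ⧸ L.carrier.submoduleOf L.dual

/-- The number `b⁺` in the signature `(b⁺, b⁻)` of `L`. -/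
def bPlus : ℕ := sigPos L.Q

/-- The number `b⁻` in the signature `(b⁺, b⁻)` of `L`. -/
def bMinus : ℕ := sigNeg L.Q

theorem Q_congr (x y : L.dual) (h : x - y ∈ L.carrier.submoduleOf L.dual) :
    (((L.Q x : ℚ) : ℝ) : UnitAddCircle) = (((L.Q y : ℚ) : ℝ) : UnitAddCircle) := by
  have h' : (x : V) - y ∈ L.carrier := h
  obtain ⟨m, hm⟩ := L.even _ h'
  obtain ⟨r, hr⟩ := Submodule.mem_one.mp (y.2 _ h')
  have key : L.Q x = L.Q y + ((r + m : ℤ) : ℚ) := by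
    have h1 : QuadraticMap.polar L.Q (y : V) ((x : V) - y) = (r : ℚ) := by
      simpa using hr.symm
    simp only [QuadraticMap.polar, add_sub_cancel, hm] at h1
    push_cast
    linarith
  rw [key, Rat.cast_add, AddCircle.coe_add, add_eq_left, AddCircle.coe_eq_zero_iff]
  exact ⟨r + m, by simp⟩

/-- The discriminant quadratic form `L' / L → ℚ / ℤ`, with values taken in `ℝ / ℤ`. -/
def discQ : L.Disc → UnitAddCircle :=
  Quotient.lift (fun x : L.dual => (((L.Q x : ℚ) : ℝ) : UnitAddCircle))
    (fun x y h => L.Q_congr x y ((Submodule.quotientRel_def _).mp h))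

theorem finite_disc : Finite L.Disc := by
  classical
  obtain ⟨n, b, hb⟩ := L.isLattice
  have hfg : (L.dual).FG := by
    rw [dual, hb, LinearMap.BilinForm.dualSubmodule_span_of_basis _ L.nondegenerate]
    exact Submodule.fg_span (Set.finite_range _)
  have : Module.Finite ℤ L.dual := Module.Finite.iff_fg.mpr hfg
  have : Module.Finite ℤ L.Disc := inferInstance
  refine Module.finite_of_fg_torsion _ ?_
  intro x
  obtain ⟨x, rfl⟩ := Submodule.Quotient.mk_surjective _ x
  obtain ⟨d, hd⟩ := IsLocalization.exist_integer_multiples_of_finite (nonZeroDivisors ℤ)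
    (fun i => b.repr (x : V) i)
  refine ⟨d, ?_⟩
  rw [Submonoid.smul_def, ← Submodule.Quotient.mk_smul, Submodule.Quotient.mk_eq_zero]
  change (d : ℤ) • (x : V) ∈ L.carrier
  rw [hb, ← b.sum_repr (x : V), Finset.smul_sum]
  refine Submodule.sum_mem _ fun i _ => ?_
  obtain ⟨m, hm⟩ := hd i
  have : (d : ℤ) • (b.repr (x : V) i • b i) = m • b i := by
    rw [← smul_assoc, ← hm]
    exact Int.cast_smul_eq_zsmul ℚ m (b i)
  rw [this]
  exact Submodule.smul_mem _ _ (Submodule.subset_span ⟨i, rfl⟩)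

instance : Fintype L.Disc := @Fintype.ofFinite _ L.finite_disc

end EvenLattice

/-! ### The integral metaplectic group -/

/-- The automorphy factor `c τ + d`. -/
def cocyc (M : SL(2, ℤ)) (τ : ℍ) : ℂ := (M 1 0 : ℂ) * τ + (M 1 1 : ℂ)

theorem cocyc_eq (M : SL(2, ℤ)) (τ : ℍ) : cocyc M τ = denom M τ := (denom_apply M τ).symm

theorem cocyc_mul (M N : SL(2, ℤ)) (τ : ℍ) :
    cocyc (M * N) τ = cocyc M (N • τ) * cocyc N τ := by
  simp only [cocyc_eq]
  have := denom_cocycle_σ (M : GL (Fin 2) ℝ) (N : GL (Fin 2) ℝ) τ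
  rw [← map_mul, ← map_mul] at this
  rw [this]
  simp [σ]

theorem cocyc_ne_zero (M : SL(2, ℤ)) (τ : ℍ) : cocyc M τ ≠ 0 := by
  rw [cocyc_eq]; exact denom_ne_zero _ _

/-- The group `Mp₂(ℤ)` of pairs `(M, φ)` with `M ∈ SL₂(ℤ)` and `φ` holomorphic on `ℍ`,
`φ(τ)² = c τ + d`. -/
@[ext] structure Mp2Z where
  mat : SL(2, ℤ)
  phi : ℍ → ℂ
  holo : MDifferentiable 𝓘(ℂ) 𝓘(ℂ) phi
  sq : ∀ τ, phi τ ^ 2 = cocyc mat τ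

namespace Mp2Z

theorem phi_ne_zero (g : Mp2Z) (τ : ℍ) : g.phi τ ≠ 0 := by
  intro h
  have := g.sq τ
  rw [h] at this
  exact cocyc_ne_zero g.mat τ (by rw [← this]; simp)

theorem holo_smul (g : Mp2Z) (N : SL(2, ℤ)) :
    MDifferentiable 𝓘(ℂ) 𝓘(ℂ) (fun τ : ℍ => g.phi (N • τ)) :=
  g.holo.comp (mdifferentiable_smul (by simp))

/-- `(M, φ(τ)) (M', φ'(τ)) = (M M', φ(M' τ) φ'(τ))`. -/
instance : Mul Mp2Z where
  mul g h :=
    { mat := g.mat * h.mat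
      phi := fun τ => g.phi (h.mat • τ) * h.phi τ
      holo := (g.holo_smul h.mat).mul h.holo
      sq := fun τ => by rw [mul_pow, g.sq, h.sq, cocyc_mul] }

instance : One Mp2Z where
  one :=
    { mat := 1
      phi := fun _ => 1
      holo := mdifferentiable_const
      sq := fun τ => by simp [cocyc] }

instance : Inv Mp2Z where
  inv g :=
    { mat := g.mat⁻¹
      phi := fun τ => (g.phi (g.mat⁻¹ • τ))⁻¹
      holo := by
        have h := g.holo_smul g.mat⁻¹
        rw [mdifferentiable_iff] at h ⊢
        exact h.inv fun z _ => g.phi_ne_zero _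
      sq := fun τ => by
        rw [inv_pow, g.sq]
        have := cocyc_mul g.mat g.mat⁻¹ τ
        rw [mul_inv_cancel] at this
        have h1 : cocyc 1 τ = 1 := by simp [cocyc]
        rw [h1] at this
        exact inv_eq_of_mul_eq_one_right this.symm }

instance : Group Mp2Z :=
  Group.ofLeftAxioms
    (fun a b c => by
      ext τ
      · change ((a.mat * b.mat * c.mat : SL(2, ℤ))) _ _ = (a.mat * (b.mat * c.mat) : SL(2, ℤ)) _ _
        rw [mul_assoc]
      · change a.phi (b.mat • c.mat • τ) * b.phi (c.mat • τ) * c.phi τ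
          = a.phi ((b.mat * c.mat) • τ) * (b.phi (c.mat • τ) * c.phi τ)
        rw [mul_smul, mul_assoc])
    (fun a => by
      ext τ
      · change ((1 * a.mat : SL(2, ℤ))) _ _ = _
        rw [one_mul]
      · exact one_mul _)
    (fun a => by
      ext τ
      · change ((a.mat⁻¹ * a.mat : SL(2, ℤ))) _ _ = (1 : SL(2, ℤ)) _ _
        rw [inv_mul_cancel]
      · change (a.phi (a.mat⁻¹ • a.mat • τ))⁻¹ * a.phi τ = 1
        rw [inv_smul_smul, inv_mul_cancel₀ (a.phi_ne_zero τ)])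

/-- The generator `T = ((1 1; 0 1), 1)`. -/
def T : Mp2Z where
  mat := ModularGroup.T
  phi := fun _ => 1
  holo := mdifferentiable_const
  sq := fun τ => by simp [cocyc, ModularGroup.T]

/-- The generator `S = ((0 -1; 1 0), √τ)`, with the principal branch of the square root. -/
def S : Mp2Z where
  mat := ModularGroup.S
  phi := fun τ => (τ : ℂ) ^ (1 / 2 : ℂ)
  holo := by
    rw [mdifferentiable_iff]
    have h : DifferentiableOn ℂ (fun z : ℂ => z ^ (1 / 2 : ℂ)) {z | 0 < z.im} := fun z hz =>
      (DifferentiableAt.cpow_const differentiableAt_id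
        (Or.inr (ne_of_gt hz))).differentiableWithinAt
    exact h.congr fun z hz => by simp [ofComplex_apply_of_im_pos hz]
  sq := fun τ => by
    rw [← Complex.cpow_nat_mul]
    simp [cocyc, ModularGroup.S]

end Mp2Z

/-! ### The Weil representation -/

section Weil

variable {A : Type*} [AddCommGroup A] [Fintype A]

/-- `e(z) = exp(2 π i z)`. -/
def e (z : ℂ) : ℂ := Complex.exp (2 * Real.pi * Complex.I * z)

/-- `e` on `ℝ / ℤ`. -/
def eCircle (x : UnitAddCircle) : ℂ := (AddCircle.toCircle x : ℂ)

open Classical in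
/-- The matrix of `ρ(T) : 𝔢_γ ↦ e(Q(γ)) 𝔢_γ`. -/
def weilT (Q : A → UnitAddCircle) : Matrix A A ℂ := Matrix.diagonal fun γ => eCircle (Q γ)

/-- The matrix of `ρ(S) : 𝔢_γ ↦ e((b⁻ - b⁺) / 8) / √|A| * ∑ δ, e(-(γ, δ)) 𝔢_δ`, where
`sig = b⁺ - b⁻` and `(γ, δ) = Q(γ + δ) - Q(γ) - Q(δ)`. -/
def weilS (Q : A → UnitAddCircle) (sig : ℤ) : Matrix A A ℂ :=
  Matrix.of fun δ γ =>
    e (-(sig : ℂ) / 8) / (Real.sqrt (Fintype.card A) : ℂ) * eCircle (-(Q (γ + δ) - Q γ - Q δ))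

/-- The Weil representation `ρ` of `Mp₂(ℤ)` on `ℂ[A]`, given by its graph: `IsWeil Q sig g R` says
that `ρ(g)` has the matrix `R` in the basis `(𝔢_γ)`. The representation is determined by `ρ(T)`,
`ρ(S)` and multiplicativity; the elements `S` and `T` generate `Mp₂(ℤ)`, also as a monoid, because
`S` has order `8` and `(S T)³ = S²`. -/
inductive IsWeil (Q : A → UnitAddCircle) (sig : ℤ) : Mp2Z → Matrix A A ℂ → Prop
  | T : IsWeil Q sig Mp2Z.T (weilT Q)
  | S : IsWeil Q sig Mp2Z.S (weilS Q sig)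
  | mul {g h : Mp2Z} {R R' : Matrix A A ℂ} :
      IsWeil Q sig g R → IsWeil Q sig h R' → IsWeil Q sig (g * h) (R * R')

/-- The dual representation `ρ̄`, with the matrix `ρ(g⁻¹)ᵀ` at `g`, again given by its graph. -/
def IsWeilDual (Q : A → UnitAddCircle) (sig : ℤ) (g : Mp2Z) (R : Matrix A A ℂ) : Prop :=
  ∃ R' : Matrix A A ℂ, IsWeil Q sig g⁻¹ R' ∧ R = R'.transpose

end Weil

/-! ### Harmonic weak Maass forms -/

/-- The function `f` on `ℍ`, viewed as a function of a complex variable, is `C^∞` in the real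
sense on the upper half plane. -/
def IsSmooth (f : ℍ → ℂ) : Prop := ContDiffOn ℝ ∞ (f ∘ ofComplex) {z : ℂ | 0 < z.im}

/-- `∂F/∂x` for a function `F` of `z = x + i y`. -/
def partialX (F : ℂ → ℂ) (z : ℂ) : ℂ := fderiv ℝ F z 1

/-- `∂F/∂y` for a function `F` of `z = x + i y`. -/
def partialY (F : ℂ → ℂ) (z : ℂ) : ℂ := fderiv ℝ F z Complex.I

/-- The weight `k` Laplace operator
`Δ_k = -y² (∂²/∂x² + ∂²/∂y²) + i k y (∂/∂x + i ∂/∂y)`. -/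
def laplace (k : ℤ) (f : ℍ → ℂ) (τ : ℍ) : ℂ :=
  -(τ.im : ℂ) ^ 2 * (partialX (partialX (f ∘ ofComplex)) τ + partialY (partialY (f ∘ ofComplex)) τ)
    + Complex.I * k * τ.im *
      (partialX (f ∘ ofComplex) τ + Complex.I * partialY (f ∘ ofComplex) τ)

/-- There is a Fourier polynomial `P(τ) = ∑ c(n) e(n τ)`, with finitely many exponents `n ≤ 0`, all
of them in `E`, such that `f(τ) = P(τ) + O(exp(-ε y))` as `y → ∞`, for some `ε > 0`. -/
def HasPrincipalPart (E : Set ℝ) (f : ℍ → ℂ) : Prop :=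
  ∃ c : ℝ →₀ ℂ, (∀ n ∈ c.support, n ∈ E ∧ n ≤ 0) ∧ ∃ ε : ℝ, 0 < ε ∧
    (fun τ : ℍ => f τ - c.sum fun n a => a * e (n * τ)) =O[atImInfty]
      fun τ : ℍ => Real.exp (-ε * τ.im)

/-- The slash operator `(f |_k M)(τ) = (c τ + d)^{-k} f(M τ)`. -/
def slashSL (k : ℤ) (M : SL(2, ℤ)) (f : ℍ → ℂ) (τ : ℍ) : ℂ := cocyc M τ ^ (-k) * f (M • τ)

section closure

theorem isOpen_im_pos : IsOpen {z : ℂ | 0 < z.im} := isOpen_lt continuous_const Complex.continuous_im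

theorem IsSmooth.add {f g : ℍ → ℂ} (hf : IsSmooth f) (hg : IsSmooth g) : IsSmooth (f + g) :=
  ContDiffOn.add hf hg

theorem IsSmooth.smul {f : ℍ → ℂ} (a : ℂ) (hf : IsSmooth f) : IsSmooth (a • f) :=
  ContDiffOn.const_smul a hf

theorem fderiv_apply_add {F G : ℂ → ℂ} (hF : ContDiffOn ℝ ∞ F {z : ℂ | 0 < z.im})
    (hG : ContDiffOn ℝ ∞ G {z : ℂ | 0 < z.im}) (v : ℂ) :
    Set.EqOn (fun z => fderiv ℝ (F + G) z v) ((fun z => fderiv ℝ F z v) + fun z => fderiv ℝ G z v)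
      {z : ℂ | 0 < z.im} := by
  intro z hz
  have h1 := ((hF.contDiffAt (isOpen_im_pos.mem_nhds hz)).differentiableAt (by simp))
  have h2 := ((hG.contDiffAt (isOpen_im_pos.mem_nhds hz)).differentiableAt (by simp))
  simp [fderiv_add h1 h2]

theorem contDiffOn_fderiv_apply {F : ℂ → ℂ} (hF : ContDiffOn ℝ ∞ F {z : ℂ | 0 < z.im}) (v : ℂ) :
    ContDiffOn ℝ ∞ (fun z => fderiv ℝ F z v) {z : ℂ | 0 < z.im} :=
  (hF.fderiv_of_isOpen isOpen_im_pos (by simp)).clm_apply contDiffOn_const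

theorem fderiv_fderiv_apply_add {F G : ℂ → ℂ} (hF : ContDiffOn ℝ ∞ F {z : ℂ | 0 < z.im})
    (hG : ContDiffOn ℝ ∞ G {z : ℂ | 0 < z.im}) (v : ℂ) {z : ℂ} (hz : 0 < z.im) :
    fderiv ℝ (fun z => fderiv ℝ (F + G) z v) z v =
      fderiv ℝ (fun z => fderiv ℝ F z v) z v + fderiv ℝ (fun z => fderiv ℝ G z v) z v := by
  rw [((fderiv_apply_add hF hG v).eventuallyEq_of_mem (isOpen_im_pos.mem_nhds hz)).fderiv_eq]
  exact fderiv_apply_add (contDiffOn_fderiv_apply hF v) (contDiffOn_fderiv_apply hG v) v hz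

theorem laplace_add (k : ℤ) {f g : ℍ → ℂ} (hf : IsSmooth f) (hg : IsSmooth g) (τ : ℍ) :
    laplace k (f + g) τ = laplace k f τ + laplace k g τ := by
  have hτ : 0 < (τ : ℂ).im := τ.im_pos
  have hc : (f + g) ∘ ofComplex = (f ∘ ofComplex) + (g ∘ ofComplex) := rfl
  have h1 := fderiv_apply_add hf hg 1 hτ
  have h2 := fderiv_apply_add hf hg Complex.I hτ
  have h3 := fderiv_fderiv_apply_add hf hg 1 hτ
  have h4 := fderiv_fderiv_apply_add hf hg Complex.I hτ
  simp only [Pi.add_apply] at h1 h2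
  simp only [laplace, partialX, partialY, hc]
  unfold partialX partialY
  rw [h1, h2, h3, h4]
  ring

theorem laplace_smul (k : ℤ) (a : ℂ) (f : ℍ → ℂ) (τ : ℍ) :
    laplace k (a • f) τ = a * laplace k f τ := by
  have hc : (a • f) ∘ ofComplex = a • (f ∘ ofComplex) := rfl
  have h (F : ℂ → ℂ) (v : ℂ) : (fun z => fderiv ℝ (a • F) z v) = a • fun z => fderiv ℝ F z v := by
    funext z
    simp [fderiv_const_smul_field]
  have hX (F : ℂ → ℂ) : partialX (a • F) = a • partialX F := h F 1
  have hY (F : ℂ → ℂ) : partialY (a • F) = a • partialY F := h F Complex.I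
  simp only [laplace, hc, hX, hY, Pi.smul_apply, smul_eq_mul]
  ring

theorem hasPrincipalPart_zero (E : Set ℝ) : HasPrincipalPart E 0 :=
  ⟨0, by simp, 1, one_pos, by simpa using! Asymptotics.isBigO_zero _ _⟩

theorem HasPrincipalPart.add {E : Set ℝ} {f g : ℍ → ℂ} (hf : HasPrincipalPart E f)
    (hg : HasPrincipalPart E g) : HasPrincipalPart E (f + g) := by
  classical
  obtain ⟨c, hc, ε, hε, h⟩ := hf
  obtain ⟨c', hc', ε', hε', h'⟩ := hg
  refine ⟨c + c', fun n hn => ?_, min ε ε', lt_min hε hε', ?_⟩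
  · rcases Finset.mem_union.mp (Finsupp.support_add hn) with h1 | h1
    exacts [hc n h1, hc' n h1]
  · have mono {δ : ℝ} (hδ : min ε ε' ≤ δ) : (fun τ : ℍ => Real.exp (-δ * τ.im)) =O[atImInfty]
        fun τ : ℍ => Real.exp (-(min ε ε') * τ.im) := by
      refine Asymptotics.IsBigO.of_bound 1 (Filter.Eventually.of_forall fun τ => ?_)
      rw [one_mul, Real.norm_eq_abs, Real.norm_eq_abs, Real.abs_exp, Real.abs_exp, Real.exp_le_exp]
      nlinarith [τ.im_pos]
    refine ((h.trans (mono (min_le_left _ _))).add (h'.trans (mono (min_le_right _ _)))).congr_left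
      fun τ => ?_
    rw [Finsupp.sum_add_index' (by simp) (by intros; ring)]
    simp only [Pi.add_apply]
    ring

theorem HasPrincipalPart.smul {E : Set ℝ} {f : ℍ → ℂ} (a : ℂ) (hf : HasPrincipalPart E f) :
    HasPrincipalPart E (a • f) := by
  obtain ⟨c, hc, ε, hε, h⟩ := hf
  refine ⟨a • c, fun n hn => hc n (Finsupp.support_smul hn), ε, hε, ?_⟩
  refine (h.const_mul_left a).congr_left fun τ => ?_
  rw [Finsupp.sum_smul_index' (by simp), Finsupp.sum, Finsupp.sum, mul_sub, Finset.mul_sum]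
  simp only [Pi.smul_apply, smul_eq_mul, mul_assoc]

theorem slashSL_add (k : ℤ) (M : SL(2, ℤ)) (f g : ℍ → ℂ) :
    slashSL k M (f + g) = slashSL k M f + slashSL k M g := by
  funext τ; simp [slashSL, mul_add]

theorem slashSL_smul (k : ℤ) (M : SL(2, ℤ)) (a : ℂ) (f : ℍ → ℂ) :
    slashSL k M (a • f) = a • slashSL k M f := by
  funext τ; simp [slashSL]; ring

theorem slashSL_zero (k : ℤ) (M : SL(2, ℤ)) : slashSL k M 0 = 0 := by
  funext τ; simp [slashSL]

theorem isSmooth_zero : IsSmooth 0 := contDiffOn_const (c := (0 : ℂ))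

theorem laplace_zero (k : ℤ) (τ : ℍ) : laplace k 0 τ = 0 := by
  have := laplace_smul k 0 0 τ
  simpa using this

end closure

/-- The space `H_k(Γ₀(N), χ)` of harmonic weak Maass forms of weight `k` for `Γ₀(N)` with
Nebentypus `χ`. At the cusp `∞` the principal part has integral exponents; at the cusp `M ∞`,
`M ∈ SL₂(ℤ)`, it is the principal part of `f |_k M`, a Fourier polynomial in `e(-τ / N)`. -/
def maassForms (N : ℕ) (χ : DirichletCharacter ℂ N) (k : ℤ) : Submodule ℂ (ℍ → ℂ) where
  carrier := {f | IsSmooth f ∧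
    (∀ M ∈ CongruenceSubgroup.Gamma0 N, ∀ τ : ℍ,
      f (M • τ) = χ ((M 1 1 : ℤ) : ZMod N) * cocyc M τ ^ k * f τ) ∧
    (∀ τ, laplace k f τ = 0) ∧
    HasPrincipalPart (Set.range fun n : ℤ => (n : ℝ)) f ∧
    ∀ M : SL(2, ℤ), HasPrincipalPart (Set.range fun n : ℤ => (n : ℝ) / N) (slashSL k M f)}
  zero_mem' := ⟨isSmooth_zero, by simp, laplace_zero k, hasPrincipalPart_zero _, fun M => by
    rw [slashSL_zero]; exact hasPrincipalPart_zero _⟩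
  add_mem' := by
    rintro f g ⟨h1, h2, h3, h4, h5⟩ ⟨h1', h2', h3', h4', h5'⟩
    refine ⟨h1.add h1', fun M hM τ => ?_, fun τ => ?_, h4.add h4', fun M => ?_⟩
    · simp only [Pi.add_apply, h2 M hM τ, h2' M hM τ]; ring
    · rw [laplace_add k h1 h1', h3, h3', add_zero]
    · rw [slashSL_add]; exact (h5 M).add (h5' M)
  smul_mem' := by
    rintro a f ⟨h1, h2, h3, h4, h5⟩
    refine ⟨h1.smul a, fun M hM τ => ?_, fun τ => ?_, h4.smul a, fun M => ?_⟩
    · simp only [Pi.smul_apply, smul_eq_mul, h2 M hM τ]; ring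
    · rw [laplace_smul, h3, mul_zero]
    · rw [slashSL_smul]; exact (h5 M).smul a

/-- The space of `ℂ[A]`-valued harmonic weak Maass forms of weight `k` for a representation of
`Mp₂(ℤ)` with the graph `ρ` (`ρ g R`: the element `g` acts by the matrix `R`), with Fourier
exponents of the component at `γ` in `ℤ + Q(γ)`. A function `f = ∑ f_γ 𝔢_γ` is given by its
components `f τ γ = f_γ(τ)`. -/
def vectorMaassForms {A : Type*} [Fintype A] (ρ : Mp2Z → Matrix A A ℂ → Prop)
    (Q : A → UnitAddCircle) (k : ℤ) : Submodule ℂ (ℍ → A → ℂ) where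
  carrier := {f | (∀ γ, IsSmooth fun τ => f τ γ) ∧
    (∀ g R, ρ g R → ∀ τ : ℍ, f (g.mat • τ) = g.phi τ ^ (2 * k) • R.mulVec (f τ)) ∧
    (∀ γ τ, laplace k (fun τ => f τ γ) τ = 0) ∧
    ∀ γ, HasPrincipalPart {n : ℝ | (n : UnitAddCircle) = Q γ} fun τ => f τ γ}
  zero_mem' := ⟨fun _ => isSmooth_zero, by simp, fun _ => laplace_zero k,
    fun _ => hasPrincipalPart_zero _⟩
  add_mem' := by
    rintro f g ⟨h1, h2, h3, h4⟩ ⟨h1', h2', h3', h4'⟩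
    refine ⟨fun γ => (h1 γ).add (h1' γ), fun g R hR τ => ?_, fun γ τ => ?_,
      fun γ => (h4 γ).add (h4' γ)⟩
    · simp only [Pi.add_apply, h2 g R hR τ, h2' g R hR τ, Matrix.mulVec_add, smul_add]
    · exact (laplace_add k (h1 γ) (h1' γ) τ).trans (by rw [h3, h3', add_zero])
  smul_mem' := by
    rintro a f ⟨h1, h2, h3, h4⟩
    refine ⟨fun γ => (h1 γ).smul a, fun g R hR τ => ?_, fun γ τ => ?_, fun γ => (h4 γ).smul a⟩
    · simp only [Pi.smul_apply, h2 g R hR τ, Matrix.mulVec_smul, smul_comm a]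
    · exact (laplace_smul k a _ τ).trans (by rw [h3, mul_zero])

/-- `H_{k, ρ_L}`. -/
def vectorMaass {V : Type*} [AddCommGroup V] [Module ℚ V] (L : EvenLattice V) (k : ℤ) :
    Submodule ℂ (ℍ → L.Disc → ℂ) :=
  vectorMaassForms (IsWeil L.discQ ((L.bPlus : ℤ) - L.bMinus)) L.discQ k

/-- `H_{k, ρ̄_L}`; here the Fourier exponents of the component at `γ` lie in `ℤ - Q(γ)`. -/
def vectorMaassDual {V : Type*} [AddCommGroup V] [Module ℚ V] (L : EvenLattice V) (k : ℤ) :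
    Submodule ℂ (ℍ → L.Disc → ℂ) :=
  vectorMaassForms (IsWeilDual L.discQ ((L.bPlus : ℤ) - L.bMinus)) (fun γ => -L.discQ γ) k

/-! ### Fourier expansions and the map `f ↦ F` -/

/-- The incomplete Gamma function `Γ(a, y) = ∫_y^∞ exp(-t) t^(a - 1) dt`. -/
def incGamma (a y : ℝ) : ℝ := ∫ t in Set.Ioi y, Real.exp (-t) * t ^ (a - 1)

/-- `c_f(n, y) = c_f⁺(n) + c_f⁻(n) Γ(1 - k, 4 π |n| y)`, for coefficients `cp = c_f⁺` and
`cm = c_f⁻`. -/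
def coeff (k : ℤ) (cp cm : ℤ → ℂ) (n : ℤ) (y : ℝ) : ℂ :=
  cp n + cm n * (incGamma (1 - k) (4 * Real.pi * |(n : ℝ)| * y) : ℂ)

/-- `f = f⁺ + f⁻` with `f⁺ = ∑_{n ≫ -∞} cp(n) qⁿ` and
`f⁻ = ∑_{n < 0} cm(n) Γ(1 - k, 4 π |n| y) qⁿ`. -/
def IsFourierExpansion (k : ℤ) (f : ℍ → ℂ) (cp cm : ℤ → ℂ) : Prop :=
  (∃ n₀ : ℤ, ∀ n < n₀, cp n = 0) ∧ (∀ n, 0 ≤ n → cm n = 0) ∧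
  ∃ fp fm : ℍ → ℂ,
    (∀ τ : ℍ, HasSum (fun n : ℤ => cp n * e (n * τ)) (fp τ)) ∧
    (∀ τ : ℍ, HasSum (fun n : ℤ =>
      cm n * (incGamma (1 - k) (4 * Real.pi * |(n : ℝ)| * τ.im) : ℂ) * e (n * τ)) (fm τ)) ∧
    ∀ τ, f τ = fp τ + fm τ

/-- The character `(· / p)`, with complex values. -/
def legendreChar (p : ℕ) [Fact p.Prime] : DirichletCharacter ℂ p :=
  (quadraticChar (ZMod p)).ringHomComp (Int.castRingHom ℂ)

/-- `H_k^ε(Γ₀(p), (· / p))`: the coefficients `c_f^±(n)` vanish if `(n / p) = -ε`. -/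
def maassPlus (p : ℕ) [Fact p.Prime] (k ε : ℤ) : Submodule ℂ (ℍ → ℂ) where
  carrier := {f | f ∈ maassForms p (legendreChar p) k ∧
    ∃ cp cm : ℤ → ℂ, IsFourierExpansion k f cp cm ∧
      ∀ n : ℤ, legendreSym p n = -ε → cp n = 0 ∧ cm n = 0}
  zero_mem' := ⟨zero_mem _, 0, 0, ⟨⟨0, by simp⟩, by simp, 0, 0, fun τ => by simp,
    fun τ => by simp, by simp⟩, by simp⟩
  add_mem' := by
    rintro f g ⟨hf, cp, cm, ⟨⟨n₀, h1⟩, h2, fp, fm, h3, h4, h5⟩, h6⟩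
      ⟨hg, cp', cm', ⟨⟨n₀', h1'⟩, h2', fp', fm', h3', h4', h5'⟩, h6'⟩
    refine ⟨add_mem hf hg, cp + cp', cm + cm', ⟨⟨min n₀ n₀', fun n hn => ?_⟩, fun n hn => ?_,
      fp + fp', fm + fm', fun τ => ?_, fun τ => ?_, fun τ => ?_⟩, fun n hn => ?_⟩
    · simp [h1 n (lt_of_lt_of_le hn (min_le_left _ _)), h1' n (lt_of_lt_of_le hn (min_le_right _ _))]
    · simp [h2 n hn, h2' n hn]
    · simpa [add_mul] using (h3 τ).add (h3' τ)
    · simpa [add_mul] using (h4 τ).add (h4' τ)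
    · simp only [Pi.add_apply, h5, h5']; ring
    · simp [h6 n hn, h6' n hn]
  smul_mem' := by
    rintro a f ⟨hf, cp, cm, ⟨⟨n₀, h1⟩, h2, fp, fm, h3, h4, h5⟩, h6⟩
    refine ⟨Submodule.smul_mem _ a hf, a • cp, a • cm, ⟨⟨n₀, fun n hn => ?_⟩, fun n hn => ?_,
      a • fp, a • fm, fun τ => ?_, fun τ => ?_, fun τ => ?_⟩, fun n hn => ?_⟩
    · simp [h1 n hn]
    · simp [h2 n hn]
    · simpa [mul_assoc] using (h3 τ).mul_left a
    · simpa [mul_assoc] using (h4 τ).mul_left a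
    · simp only [Pi.smul_apply, smul_eq_mul, h5]; ring
    · simp [h6 n hn]

open Classical in
/-- `F` is the image of `f` under `f ↦ F = ∑ F_γ 𝔢_γ`,
`F_γ(τ) = s(γ) ∑_{n ≡ p Q(γ) mod p} c_f(n, y / p) q^{n / p}`,
where `s(0) = 2` and `s(γ) = 1` for `γ ≠ 0`. The congruence says `n / p = Q(γ)` in `ℝ / ℤ`. -/
def IsLift {A : Type*} [AddCommGroup A] (p : ℕ) (Q : A → UnitAddCircle) (k : ℤ) (f : ℍ → ℂ)
    (F : ℍ → A → ℂ) : Prop :=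
  ∀ cp cm : ℤ → ℂ, IsFourierExpansion k f cp cm → ∀ (τ : ℍ) (γ : A),
    HasSum (fun n : {n : ℤ // (((n : ℝ) / p : ℝ) : UnitAddCircle) = Q γ} =>
      (if γ = 0 then 2 else 1) * (coeff k cp cm n (τ.im / p) * e (((n : ℤ) : ℂ) / p * τ))) (F τ γ)

end MaassLift

end

/-!
The component at `x` of the lift of `f` is, up to the factor `s(x) / p`, the projection
`∑ j, e(-j λ x² / p) f((τ + j) / p)` of `p f(τ / p)` to the exponents `n / p` with
`n ≡ λ x² mod p`, so its behaviour under `T` is clear. For `j ≠ 0` the matrix taking `(Sτ + j) / p`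
to `(τ + j') / p` with `j j' ≡ -1 mod p` lies in `Γ₀(p)`; hence the behaviour under `S` comes down
to quadratic Gauss sums over `j` and one relation between `f(Sτ / p)` and the translates of `f`,
which is where the plus condition enters. Milgram's formula, obtained from the asymptotics of theta
sums on a diagonal sublattice, identifies the Gauss sum with the normalisation of `ρ_L(S)`.

The inverse is `F ↦ ½ ∑ x, F_x(p τ)`: the sum over all `x` is an eigenvector of the matrices through
which `Γ⁰(p)` acts, and conjugation by `τ ↦ p τ` turns `Γ⁰(p)` into `Γ₀(p)`. The Fourier expansion
of a harmonic form exists because its modes solve a second order linear differential equation in `y`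
with solutions `q^n` and `Γ(1 - k, 4 π |n| y) q^n` for `n < 0`; the growth condition removes the
remaining solutions.
-/

noncomputable section

namespace MaassLift

/-! ### Quadratic Gauss sums modulo `p` -/

section GaussSums

theorem sum_comp_sq {F M : Type*} [Field F] [Fintype F] [DecidableEq F] [AddCommGroup M]
    (hF : ringChar F ≠ 2) (D : F → M) :
    ∑ x, D (x ^ 2) = ∑ r, (quadraticChar F r + 1) • D r := by
  rw [← Finset.sum_fiberwise_of_maps_to (g := fun x : F => x ^ 2) (t := Finset.univ)
    fun _ _ => Finset.mem_univ _]
  refine Finset.sum_congr rfl fun r _ => ?_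
  rw [← quadraticChar_card_sqrts hF r, natCast_zsmul, ← Finset.sum_const]
  refine Finset.sum_congr (by ext; simp) fun x hx => ?_
  have hx_sq : x ^ 2 = r := by simpa using hx
  rw [hx_sq]

variable {p : ℕ} [Fact p.Prime]

local notation "ψ" => ZMod.stdAddChar
local notation "χ" => legendreChar p

theorem ringChar_zmod_ne_two (hp : p ≠ 2) : ringChar (ZMod p) ≠ 2 := by
  rwa [ZMod.ringChar_zmod_n]

theorem two_ne_zero_zmod (hp : p ≠ 2) : (2 : ZMod p) ≠ 0 :=
  Ring.two_ne_zero (ringChar_zmod_ne_two hp)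

theorem natCast_prime_ne_zero : (p : ℂ) ≠ 0 :=
  Nat.cast_ne_zero.mpr (Fact.out : p.Prime).ne_zero

theorem legendreChar_apply (x : ZMod p) : χ x = ((quadraticChar (ZMod p) x : ℤ) : ℂ) := rfl

theorem legendreChar_intCast (n : ℤ) : χ (n : ZMod p) = (legendreSym p n : ℂ) := rfl

theorem legendreChar_isQuadratic : (χ).IsQuadratic :=
  (quadraticChar_isQuadratic (ZMod p)).comp _

theorem legendreChar_ne_one (hp : p ≠ 2) : χ ≠ 1 :=
  (MulChar.ringHomComp_ne_one_iff Int.cast_injective).mpr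
    (quadraticChar_ne_one (ringChar_zmod_ne_two hp))

theorem legendreChar_zero : χ 0 = 0 := by simp [legendreChar_apply]

theorem legendreChar_mul_self {x : ZMod p} (hx : x ≠ 0) : χ x * χ x = 1 := by
  rw [legendreChar_apply, ← Int.cast_mul, ← sq, quadraticChar_sq_one hx, Int.cast_one]

theorem legendreChar_ne_zero {x : ZMod p} (hx : x ≠ 0) : χ x ≠ 0 :=
  left_ne_zero_of_mul_eq_one (legendreChar_mul_self hx)

theorem legendreChar_inv (x : ZMod p) : χ x⁻¹ = χ x := by
  rw [← MulChar.inv_apply', legendreChar_isQuadratic.inv]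

theorem sum_stdAddChar_mul (a : ZMod p) :
    ∑ d : ZMod p, ψ (a * d) = if a = 0 then (p : ℂ) else 0 := by
  simpa [mul_comm a] using AddChar.sum_mulShift a (ZMod.isPrimitive_stdAddChar p)

theorem sum_comp_sq_eq_sum_legendreChar (hp : p ≠ 2) (D : ZMod p → ℂ) :
    ∑ x, D (x ^ 2) = ∑ r, (1 + χ r) * D r := by
  simp [sum_comp_sq (ringChar_zmod_ne_two hp), legendreChar_apply, add_comm]

/-- The quadratic Gauss sum `∑ x, e(l x² / p)`. -/
def quadGauss (l : ZMod p) : ℂ := ∑ x : ZMod p, ψ (l * x ^ 2)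

theorem quadGauss_eq_gaussSum (hp : p ≠ 2) {l : ZMod p} (hl : l ≠ 0) :
    quadGauss l = χ l * gaussSum χ ψ := by
  have hshift := gaussSum_mulShift χ (ψ : AddChar (ZMod p) ℂ) (Units.mk0 l hl)
  simp only [Units.val_mk0] at hshift
  rw [quadGauss, sum_comp_sq_eq_sum_legendreChar hp fun r => ψ (l * r), ← hshift, ← mul_assoc,
    legendreChar_mul_self hl, one_mul]
  simp [add_mul, Finset.sum_add_distrib, sum_stdAddChar_mul, hl, gaussSum]

theorem quadGauss_mul (hp : p ≠ 2) {l t : ZMod p} (hl : l ≠ 0) (ht : t ≠ 0) :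
    quadGauss (t * l) = χ t * quadGauss l := by
  rw [quadGauss_eq_gaussSum hp hl, quadGauss_eq_gaussSum hp (mul_ne_zero ht hl), map_mul, mul_assoc]

theorem quadGauss_mul_self (hp : p ≠ 2) {l : ZMod p} (hl : l ≠ 0) :
    quadGauss l * quadGauss l = χ (-1) * p := by
  have hsq : gaussSum χ ψ ^ 2 = χ (-1) * Fintype.card (ZMod p) :=
    gaussSum_sq (legendreChar_ne_one hp) legendreChar_isQuadratic (ZMod.isPrimitive_stdAddChar p)
  rw [quadGauss_eq_gaussSum hp hl, mul_mul_mul_comm, legendreChar_mul_self hl, one_mul, ← sq, hsq,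
    ZMod.card]

theorem quadGauss_ne_zero (hp : p ≠ 2) {l : ZMod p} (hl : l ≠ 0) : quadGauss l ≠ 0 :=
  left_ne_zero_of_mul <| (quadGauss_mul_self hp hl).trans_ne <|
    mul_ne_zero (legendreChar_ne_zero (neg_ne_zero.mpr one_ne_zero)) natCast_prime_ne_zero

theorem sum_stdAddChar_quadratic (hp : p ≠ 2) {l t : ZMod p} (hl : l ≠ 0) (ht : t ≠ 0)
    (c : ZMod p) :
    ∑ d : ZMod p, ψ (t * l * d ^ 2 - 2 * l * c * d)
      = χ t * quadGauss l * ψ (-(l * c ^ 2 * t⁻¹)) := by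
  rw [← quadGauss_mul hp hl ht, quadGauss, Finset.sum_mul,
    ← Equiv.sum_comp (Equiv.addRight (c * t⁻¹))]
  refine Finset.sum_congr rfl fun d _ => ?_
  rw [← AddChar.map_add_eq_mul]
  congr 1
  simp only [Equiv.coe_addRight]
  field_simp
  ring

theorem sum_mul_sq_of_eq_zero (hp : p ≠ 2) {l : ZMod p} (hl : l ≠ 0) (D : ZMod p → ℂ)
    (hD : ∀ r, χ r = -χ l → D r = 0) :
    ∑ x : ZMod p, D (l * x ^ 2) = 2 * ∑ r : ZMod p, D r - D 0 := by
  have hterm (r : ZMod p) : (1 + χ r) * D (l * r) = 2 * D (l * r) - if r = 0 then D 0 else 0 := by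
    rcases eq_or_ne r 0 with rfl | hr
    · rw [if_pos rfl, legendreChar_zero, mul_zero]
      ring
    rw [if_neg hr, sub_zero]
    rcases mul_self_eq_one_iff.mp (legendreChar_mul_self hr) with hχ | hχ
    · rw [hχ, one_add_one_eq_two]
    · rw [hD (l * r) (by rw [map_mul, hχ, mul_neg_one]), mul_zero, mul_zero]
  calc ∑ x : ZMod p, D (l * x ^ 2)
      = ∑ r, (1 + χ r) * D (l * r) := sum_comp_sq_eq_sum_legendreChar hp fun r => D (l * r)
    _ = 2 * ∑ r, D (l * r) - D 0 := by simp [hterm, Finset.sum_sub_distrib, Finset.mul_sum]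
    _ = 2 * ∑ r, D r - D 0 := by rw [← Equiv.sum_comp (Equiv.mulLeft₀ l hl) D]; rfl

end GaussSums

/-! ### The row vectors `𝔢₀ ρ(M)` -/

section Rows

variable {p : ℕ} [Fact p.Prime]

local notation "ψ" => ZMod.stdAddChar
local notation "χ" => legendreChar p

open Classical in
/-- The row of index `0` of the Weil representation modulo `p`, at a matrix with bottom row
`(c, d)`. -/
def weilRow (l c d x : ZMod p) : ℂ :=
  if c = 0 then (if x = 0 then χ d else 0)
  else (quadGauss l)⁻¹ * χ c * ψ (d * c⁻¹ * l * x ^ 2)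

theorem weilRow_of_ne_zero {c : ZMod p} (hc : c ≠ 0) (l d x : ZMod p) :
    weilRow l c d x = (quadGauss l)⁻¹ * χ c * ψ (d * c⁻¹ * l * x ^ 2) :=
  if_neg hc

theorem weilRow_mul_T (l c d x : ZMod p) :
    weilRow l c d x * ψ (l * x ^ 2) = weilRow l c (c + d) x := by
  unfold weilRow
  split_ifs with hc hx
  · simp [hc, hx]
  · simp
  · rw [mul_assoc, ← AddChar.map_add_eq_mul]
    congr 2
    field_simp
    ring

theorem weilRow_mul_S_of_right_eq_zero (hp : p ≠ 2) {l c : ZMod p} (hl : l ≠ 0) (hc : c ≠ 0)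
    (x : ZMod p) :
    ∑ y : ZMod p, weilRow l c 0 y * ((quadGauss l)⁻¹ * ψ (-(2 * l * x * y)))
      = weilRow l 0 (-c) x := by
  have hneg_one := legendreChar_mul_self (p := p) (neg_ne_zero.mpr one_ne_zero)
  have horth : (-(2 * l * x) = 0) ↔ x = 0 := by simp [two_ne_zero_zmod hp, hl]
  have hterm (y : ZMod p) : weilRow l c 0 y * ((quadGauss l)⁻¹ * ψ (-(2 * l * x * y)))
      = (quadGauss l)⁻¹ * (quadGauss l)⁻¹ * χ c * ψ (-(2 * l * x) * y) := by
    simp only [weilRow_of_ne_zero hc, zero_mul, AddChar.map_zero_eq_one, neg_mul]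
    ring
  rw [Finset.sum_congr rfl fun y _ => hterm y, ← Finset.mul_sum, sum_stdAddChar_mul, ← mul_inv,
    quadGauss_mul_self hp hl, weilRow, if_pos rfl]
  simp only [horth]
  split_ifs with hx
  · have hp0 : (p : ℂ) ≠ 0 := natCast_prime_ne_zero
    have hχ : χ (-1) ≠ 0 := legendreChar_ne_zero (neg_ne_zero.mpr one_ne_zero)
    rw [neg_eq_neg_one_mul c, map_mul]
    field_simp
    rw [sq, hneg_one, one_mul]
  · rw [mul_zero]

theorem weilRow_mul_S_of_ne_zero (hp : p ≠ 2) {l c d : ZMod p} (hl : l ≠ 0) (hc : c ≠ 0)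
    (hd : d ≠ 0) (x : ZMod p) :
    ∑ y : ZMod p, weilRow l c d y * ((quadGauss l)⁻¹ * ψ (-(2 * l * x * y)))
      = weilRow l d (-c) x := by
  have hg := quadGauss_ne_zero hp hl
  have hterm (y : ZMod p) : weilRow l c d y * ((quadGauss l)⁻¹ * ψ (-(2 * l * x * y)))
      = (quadGauss l)⁻¹ * (quadGauss l)⁻¹ * χ c
        * ψ ((d * c⁻¹) * l * y ^ 2 - 2 * l * x * y) := by
    rw [weilRow_of_ne_zero hc, sub_eq_add_neg, AddChar.map_add_eq_mul]
    ring
  have hphase : -(l * x ^ 2 * (d * c⁻¹)⁻¹) = -c * d⁻¹ * l * x ^ 2 := by field_simp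
  rw [Finset.sum_congr rfl fun y _ => hterm y, ← Finset.mul_sum,
    sum_stdAddChar_quadratic hp hl (mul_ne_zero hd (inv_ne_zero hc)), map_mul, legendreChar_inv,
    weilRow_of_ne_zero hd, hphase]
  field_simp
  rw [sq, legendreChar_mul_self hc, one_mul]

theorem weilRow_mul_S (hp : p ≠ 2) {l : ZMod p} (hl : l ≠ 0) {c d : ZMod p} (hcd : c ≠ 0 ∨ d ≠ 0)
    (x : ZMod p) :
    ∑ y : ZMod p, weilRow l c d y * ((quadGauss l)⁻¹ * ψ (-(2 * l * x * y)))
      = weilRow l d (-c) x := by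
  rcases eq_or_ne c 0 with rfl | hc
  · have hd : d ≠ 0 := by simpa using hcd
    simp [weilRow, hd, mul_comm]
  rcases eq_or_ne d 0 with rfl | hd
  · exact weilRow_mul_S_of_right_eq_zero hp hl hc x
  · exact weilRow_mul_S_of_ne_zero hp hl hc hd x

end Rows

/-! ### The Gauss sums `∑ t mod N, e(t² / 2N)` -/

section ThetaGauss

open Filter Topology Complex

theorem summable_exp_neg_int_sq : Summable fun n : ℤ => Real.exp (-(n : ℝ) ^ 2) := by
  have hsummable := (summable_jacobiTheta₂_term_iff 0 (Complex.I / Real.pi)).mpr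
    (by simpa [Complex.div_im] using Real.pi_pos)
  refine hsummable.norm.congr fun n => ?_
  have hpi : (Real.pi : ℂ) ≠ 0 := ofReal_ne_zero.mpr Real.pi_ne_zero
  have hexponent : (2 * Real.pi * Complex.I * n * 0
      + Real.pi * Complex.I * n ^ 2 * (Complex.I / Real.pi) : ℂ) = ((-(n : ℝ) ^ 2 : ℝ) : ℂ) := by
    push_cast
    field_simp
    ring_nf
    simp
  rw [jacobiTheta₂_term, Complex.norm_exp, hexponent, ofReal_re]

theorem tendsto_tsum_of_norm_le_exp {ι : Type*} {l : Filter ι} {α : ι → ℝ}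
    (hα : Tendsto α l atTop) (f : ι → ℤ → ℂ)
    (hf : ∀ᶠ s in l, ∀ n, ‖f s n‖ ≤ Real.exp (-α s * (n : ℝ) ^ 2)) (hf_zero : ∀ s, f s 0 = 1) :
    Tendsto (fun s => ∑' n, f s n) l (𝓝 1) := by
  have hlim : Tendsto (fun s => ∑' n, f s n) l (𝓝 (∑' n : ℤ, if n = 0 then 1 else 0)) := by
    refine tendsto_tsum_of_dominated_convergence summable_exp_neg_int_sq (fun n => ?_) ?_
    · split_ifs with hn
      · simp only [hn, hf_zero, tendsto_const_nhds]
      · have hn_sq : 0 < (n : ℝ) ^ 2 := by positivity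
        refine squeeze_zero_norm' (hf.mono fun s hs => hs n) (Real.tendsto_exp_atBot.comp ?_)
        simp only [neg_mul]
        exact tendsto_neg_atTop_atBot.comp (hα.atTop_mul_const hn_sq)
    · filter_upwards [hf, hα.eventually_ge_atTop 1] with s hs hone n
      refine (hs n).trans (Real.exp_le_exp.mpr ?_)
      nlinarith [sq_nonneg (n : ℝ)]
  simpa using hlim

theorem summable_exp_neg_mul_int_sq {z : ℂ} (hz : 0 < z.re) :
    Summable fun n : ℤ => cexp (-Real.pi * z * (n : ℂ) ^ 2) := by
  refine ((summable_jacobiTheta₂_term_iff 0 (Complex.I * z)).mpr (by simpa)).congr fun n => ?_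
  rw [jacobiTheta₂_term]
  congr 1
  linear_combination (Real.pi * n ^ 2 * z : ℂ) * Complex.I_sq

theorem tsum_exp_eq_sum_residues (N : ℕ) [NeZero N] (hN : Even N) {ε : ℝ} (hε : 0 < ε) :
    ∑' n : ℤ, cexp (-Real.pi * (ε - Complex.I / N) * (n : ℂ) ^ 2)
      = ∑ t ∈ Finset.range N, cexp (Real.pi * Complex.I * t ^ 2 / N)
        * ∑' m : ℤ, cexp (-Real.pi * ε * (t + N * m) ^ 2) := by
  have hN_ne : (N : ℂ) ≠ 0 := Nat.cast_ne_zero.mpr (NeZero.ne N)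
  have hsummable : Summable fun n : ℤ => cexp (-Real.pi * (ε - Complex.I / N) * (n : ℂ) ^ 2) :=
    summable_exp_neg_mul_int_sq (by simpa [Complex.div_re] using hε)
  rw [← (Int.divModEquiv N).symm.tsum_eq, ← (Equiv.prodComm (Fin N) ℤ).tsum_eq, Summable.tsum_prod,
    tsum_fintype, ← Fin.sum_univ_eq_sum_range (fun t => cexp (Real.pi * Complex.I * t ^ 2 / N)
        * ∑' m : ℤ, cexp (-Real.pi * ε * (t + N * m) ^ 2))]
  · refine Finset.sum_congr rfl fun t _ => ?_
    rw [← tsum_mul_left]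
    refine tsum_congr fun m => ?_
    have hdivMod : (Int.divModEquiv N).symm (Equiv.prodComm (Fin N) ℤ (t, m)) = m * N + (t : ℕ) :=
      rfl
    obtain ⟨a, ha⟩ := hN
    have hN_eq : (N : ℂ) = a + a := mod_cast ha
    rw [hdivMod, ← Complex.exp_add, Complex.exp_eq_exp_iff_exists_int]
    refine ⟨m * t + m ^ 2 * a, ?_⟩
    push_cast
    field_simp
    rw [hN_eq]
    ring
  · exact ((Equiv.prodComm (Fin N) ℤ).summable_iff).mpr
      (((Int.divModEquiv N).symm.summable_iff).mpr hsummable)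

theorem tsum_exp_residue_eq_poisson (N : ℕ) [NeZero N] (t : ℕ) {s : ℝ} (hs : 0 < s) :
    (s : ℂ)⁻¹ * ∑' m : ℤ, cexp (-Real.pi * ((s ^ 2)⁻¹ : ℝ) * (t + N * m) ^ 2)
      = (N : ℂ)⁻¹ * ∑' n : ℤ, cexp (-Real.pi * ((s / N : ℝ) : ℂ) ^ 2 * (n : ℂ) ^ 2
        + 2 * Real.pi * (-Complex.I * t / N) * n) := by
  have hN : (0 : ℝ) < N := Nat.cast_pos.mpr (NeZero.pos N)
  have hN_ne : (N : ℂ) ≠ 0 := Nat.cast_ne_zero.mpr (NeZero.ne N)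
  have hs_ne : (s : ℂ) ≠ 0 := ofReal_ne_zero.mpr hs.ne'
  have hre : 0 < (((s / N : ℝ) : ℂ) ^ 2).re := by
    rw [← ofReal_pow, ofReal_re]
    positivity
  have hroot : (((s / N : ℝ) : ℂ) ^ 2) ^ (1 / 2 : ℂ) = (s / N : ℝ) := by
    rw [one_div, sq_cpow_two_inv (by rw [ofReal_re]; positivity)]
  rw [Complex.tsum_exp_neg_quadratic hre, hroot, ← mul_assoc]
  congr 1
  · push_cast
    field_simp
  · refine tsum_congr fun m => ?_
    congr 1
    push_cast
    field_simp
    linear_combination -(2 * N * m * t + (1 - Complex.I ^ 2) * (t : ℂ) ^ 2) * Complex.I_sq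

theorem tendsto_residue_theta (N : ℕ) [NeZero N] (t : ℕ) :
    Tendsto (fun s : ℝ =>
        (s : ℂ)⁻¹ * ∑' m : ℤ, cexp (-Real.pi * ((s ^ 2)⁻¹ : ℝ) * (t + N * m) ^ 2))
      atTop (𝓝 (N : ℂ)⁻¹) := by
  have hN : (0 : ℝ) < N := Nat.cast_pos.mpr (NeZero.pos N)
  have hdecay : Tendsto (fun s : ℝ => Real.pi * (s / N) ^ 2) atTop atTop :=
    ((tendsto_pow_atTop two_ne_zero).comp (tendsto_id.atTop_div_const hN)).const_mul_atTop
      Real.pi_pos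
  have hdual : Tendsto (fun s : ℝ => ∑' n : ℤ, cexp (-Real.pi * ((s / N : ℝ) : ℂ) ^ 2 * (n : ℂ) ^ 2
      + 2 * Real.pi * (-Complex.I * t / N) * n)) atTop (𝓝 1) := by
    refine tendsto_tsum_of_norm_le_exp hdecay _ (.of_forall fun s n => ?_) fun s => by simp
    have hexponent : (-Real.pi * ((s / N : ℝ) : ℂ) ^ 2 * (n : ℂ) ^ 2
        + 2 * Real.pi * (-Complex.I * t / N) * n) = ((-(Real.pi * (s / N) ^ 2) * n ^ 2 : ℝ) : ℂ)
          + ((-(2 * Real.pi * t / N * n) : ℝ) : ℂ) * Complex.I := by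
      push_cast
      ring
    rw [Complex.norm_exp, hexponent, add_re, ofReal_re, re_ofReal_mul, Complex.I_re, mul_zero,
      add_zero]
  have hlim := hdual.const_mul (N : ℂ)⁻¹
  rw [mul_one] at hlim
  refine hlim.congr' ?_
  filter_upwards [eventually_gt_atTop 0] with s hs
  exact (tsum_exp_residue_eq_poisson N t hs).symm

theorem re_pos_of_inv_re_pos {w : ℂ} (hw : 0 < (w⁻¹).re) : 0 < w.re := by
  rw [Complex.inv_re] at hw
  exact pos_of_mul_pos_left hw (inv_nonneg.mpr (normSq_nonneg w))

theorem tendsto_cpow_half_mul_theta {ι : Type*} {l : Filter ι} {w : ι → ℂ}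
    (hw : Tendsto (fun x => ((w x)⁻¹).re) l atTop) :
    Tendsto (fun x => w x ^ (1 / 2 : ℂ) * ∑' n : ℤ, cexp (-Real.pi * w x * (n : ℂ) ^ 2)) l
      (𝓝 1) := by
  have hlim : Tendsto (fun x => ∑' n : ℤ, cexp (-Real.pi / w x * (n : ℂ) ^ 2)) l (𝓝 1) := by
    refine tendsto_tsum_of_norm_le_exp (hw.const_mul_atTop Real.pi_pos) _
      (.of_forall fun x n => ?_) fun x => by simp
    have hexponent : -Real.pi / w x * (n : ℂ) ^ 2
        = ((-Real.pi * (n : ℝ) ^ 2 : ℝ) : ℂ) * (w x)⁻¹ := by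
      push_cast
      ring
    rw [Complex.norm_exp, hexponent, re_ofReal_mul]
    exact le_of_eq (by ring_nf)
  refine hlim.congr' ?_
  filter_upwards [hw.eventually_gt_atTop 0] with x hx
  have hre : 0 < (w x).re := re_pos_of_inv_re_pos hx
  have hroot : w x ^ (1 / 2 : ℂ) ≠ 0 := by
    rw [Ne, Complex.cpow_eq_zero_iff]
    rintro ⟨hzero, -⟩
    simp [hzero] at hre
  rw [Complex.tsum_exp_neg_mul_int_sq hre, ← mul_assoc, mul_one_div_cancel hroot, one_mul]

theorem ofReal_mul_cpow_half {s : ℝ} (hs : 0 < s) {w : ℂ} (hw : w ≠ 0) :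
    (((s ^ 2 : ℝ) : ℂ) * w) ^ (1 / 2 : ℂ) = s * w ^ (1 / 2 : ℂ) := by
  have hlog : ((Real.log (s ^ 2) : ℝ) : ℂ) * (1 / 2) = ((Real.log s : ℝ) : ℂ) := by
    rw [Real.log_pow]
    push_cast
    ring
  have hprod : ((s ^ 2 : ℝ) : ℂ) * w ≠ 0 :=
    mul_ne_zero (ofReal_ne_zero.mpr (pow_pos hs 2).ne') hw
  rw [Complex.cpow_def_of_ne_zero hprod, Complex.cpow_def_of_ne_zero hw,
    Complex.log_ofReal_mul (pow_pos hs 2) hw, add_mul, Complex.exp_add, hlog, ← ofReal_exp,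
    Real.exp_log hs]

theorem ofReal_add_I_mul_ne_zero {x : ℝ} (hx : x ≠ 0) (y : ℝ) : (x + Complex.I * y : ℂ) ≠ 0 :=
  fun h => hx (by simpa using congrArg Complex.re h)

theorem inv_sq_inv_sub_I_div {N : ℕ} [NeZero N] {s : ℝ} (hs : s ≠ 0) :
    ((((s ^ 2)⁻¹ : ℝ) : ℂ) - Complex.I / N)⁻¹
      = Complex.I * N + N ^ 2 / ((s ^ 2 : ℝ) + Complex.I * N) := by
  have hN_ne : (N : ℂ) ≠ 0 := Nat.cast_ne_zero.mpr (NeZero.ne N)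
  have hs_ne : (s : ℂ) ≠ 0 := ofReal_ne_zero.mpr hs
  have hden : ((s : ℂ) ^ 2 + Complex.I * N : ℂ) ≠ 0 := by
    simpa using ofReal_add_I_mul_ne_zero (pow_ne_zero 2 hs) N
  refine inv_eq_of_mul_eq_one_right ?_
  push_cast
  field_simp
  linear_combination ((N : ℂ) ^ 2 - s ^ 4 - N * s ^ 2 * Complex.I) * Complex.I_sq

theorem tsum_exp_neg_mul_int_sq_eq_of_inv {N : ℕ} (hN : Even N) {z w : ℂ} (hz : 0 < z.re)
    (hzw : z⁻¹ = Complex.I * N + w) :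
    ∑' n : ℤ, cexp (-Real.pi * z * (n : ℂ) ^ 2)
      = 1 / z ^ (1 / 2 : ℂ) * ∑' n : ℤ, cexp (-Real.pi * w * (n : ℂ) ^ 2) := by
  rw [Complex.tsum_exp_neg_mul_int_sq hz]
  congr 1
  refine tsum_congr fun n => ?_
  obtain ⟨a, ha⟩ := hN
  have hN_eq : (N : ℂ) = a + a := mod_cast ha
  rw [div_eq_mul_inv, hzw, Complex.exp_eq_exp_iff_exists_int]
  refine ⟨-(a * n ^ 2), ?_⟩
  rw [hN_eq]
  push_cast
  ring

theorem tendsto_sq_inv_ofReal : Tendsto (fun s : ℝ => (((s ^ 2)⁻¹ : ℝ) : ℂ)) atTop (𝓝 0) := by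
  rw [← ofReal_zero]
  exact (continuous_ofReal.tendsto 0).comp
    (tendsto_inv_atTop_zero.comp (tendsto_pow_atTop two_ne_zero))

theorem tendsto_mul_cpow_half (N : ℕ) [NeZero N] :
    Tendsto (fun s : ℝ => (s : ℂ) * (N ^ 2 / ((s ^ 2 : ℝ) + Complex.I * N) : ℂ) ^ (1 / 2 : ℂ))
      atTop (𝓝 N) := by
  have hN_ne : (N : ℂ) ≠ 0 := Nat.cast_ne_zero.mpr (NeZero.ne N)
  have hbase : Tendsto (fun s : ℝ => (N ^ 2 / (1 + Complex.I * N * ((s ^ 2)⁻¹ : ℝ)) : ℂ)) atTop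
      (𝓝 ((N : ℂ) ^ 2)) := by
    have hden : Tendsto (fun s : ℝ => (1 + Complex.I * N * ((s ^ 2)⁻¹ : ℝ) : ℂ)) atTop (𝓝 1) := by
      simpa using (tendsto_sq_inv_ofReal.const_mul (Complex.I * N)).const_add 1
    simpa using! (tendsto_const_nhds (x := (N : ℂ) ^ 2)).div hden one_ne_zero
  have hroot : ((N : ℂ) ^ 2) ^ (1 / 2 : ℂ) = N := by
    rw [one_div, sq_cpow_two_inv (by simpa using NeZero.pos N)]
  have hslit : (N : ℂ) ^ 2 ∈ slitPlane := by
    rw [← Nat.cast_pow]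
    exact natCast_mem_slitPlane.mpr (pow_ne_zero 2 (NeZero.ne N))
  have hlim := hbase.cpow (tendsto_const_nhds (x := (1 / 2 : ℂ))) hslit
  rw [hroot] at hlim
  refine hlim.congr' ?_
  filter_upwards [eventually_gt_atTop 0] with s hs
  have hden : ((s ^ 2 : ℝ) + Complex.I * N : ℂ) ≠ 0 := by
    simpa using ofReal_add_I_mul_ne_zero (pow_ne_zero 2 hs.ne') N
  have hs_ne : (s : ℂ) ≠ 0 := ofReal_ne_zero.mpr hs.ne'
  rw [← ofReal_mul_cpow_half hs (div_ne_zero (pow_ne_zero 2 hN_ne) hden)]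
  congr 1
  push_cast at hden ⊢
  field_simp

theorem tendsto_theta (N : ℕ) [NeZero N] (hN : Even N) :
    Tendsto (fun s : ℝ => (s : ℂ)⁻¹
      * ∑' n : ℤ, cexp (-Real.pi * (((s ^ 2)⁻¹ : ℝ) - Complex.I / N) * (n : ℂ) ^ 2))
      atTop (𝓝 ((1 / (-Complex.I / N) ^ (1 / 2 : ℂ)) * (N : ℂ)⁻¹)) := by
  have hN_pos : (0 : ℝ) < N := Nat.cast_pos.mpr (NeZero.pos N)
  have hN_ne : (N : ℂ) ≠ 0 := Nat.cast_ne_zero.mpr (NeZero.ne N)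
  let z : ℝ → ℂ := fun s => (((s ^ 2)⁻¹ : ℝ) : ℂ) - Complex.I / N
  let w : ℝ → ℂ := fun s => N ^ 2 / ((s ^ 2 : ℝ) + Complex.I * N)
  have hz_root : Tendsto (fun s => z s ^ (1 / 2 : ℂ)) atTop
      (𝓝 ((-Complex.I / N) ^ (1 / 2 : ℂ))) := by
    have hz : Tendsto z atTop (𝓝 (-Complex.I / N)) := by
      simpa [z, neg_div] using! tendsto_sq_inv_ofReal.sub_const (Complex.I / N)
    exact hz.cpow tendsto_const_nhds (Or.inr (by simp [Complex.div_im, NeZero.ne N]))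
  have hw_inv_re (s : ℝ) : ((w s)⁻¹).re = s ^ 2 / N ^ 2 := by
    simp only [w]
    rw [inv_div, ← Nat.cast_pow, div_natCast_re, add_re, ofReal_re]
    simp
  have hw_theta := tendsto_cpow_half_mul_theta (w := w) <| by
    simp only [hw_inv_re]
    exact (tendsto_pow_atTop two_ne_zero).atTop_div_const (pow_pos hN_pos 2)
  have hroot_ne : (-Complex.I / N : ℂ) ^ (1 / 2 : ℂ) ≠ 0 := by
    simp [Complex.cpow_eq_zero_iff, hN_ne]
  have hlim := ((tendsto_const_nhds (x := (1 : ℂ))).div hz_root hroot_ne).mul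
    (((tendsto_mul_cpow_half N).inv₀ hN_ne).mul hw_theta)
  rw [mul_one] at hlim
  refine hlim.congr' ?_
  filter_upwards [eventually_gt_atTop 0] with s hs
  have hz_re : 0 < (z s).re := by
    simp only [z, sub_re, ofReal_re, div_natCast_re, Complex.I_re, zero_div, sub_zero]
    positivity
  have hw_root : w s ^ (1 / 2 : ℂ) ≠ 0 := by
    have hden : ((s ^ 2 : ℝ) + Complex.I * (N : ℝ) : ℂ) ≠ 0 :=
      ofReal_add_I_mul_ne_zero (pow_ne_zero 2 hs.ne') N
    exact mt (Complex.cpow_eq_zero_iff _ _).mp fun h =>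
      div_ne_zero (pow_ne_zero 2 hN_ne) hden h.1
  rw [tsum_exp_neg_mul_int_sq_eq_of_inv hN hz_re (inv_sq_inv_sub_I_div hs.ne'), Pi.div_apply,
    mul_inv, mul_assoc, inv_mul_cancel_left₀ hw_root]
  ring

-- Landsberg–Schaar: both sides are the limit of `s⁻¹ ∑' n, e((i s⁻² + 1 / N) n² / 2)`. Splitting
-- into residue classes gives the Gauss sum, the inversion formula of the theta function the root.
theorem sum_exp_sq_div (N : ℕ) [NeZero N] (hN : Even N) :
    ∑ t ∈ Finset.range N, cexp (Real.pi * Complex.I * t ^ 2 / N)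
      = (Real.sqrt N : ℂ) * e (1 / 8) := by
  have hN_pos : (0 : ℝ) < N := Nat.cast_pos.mpr (NeZero.pos N)
  have hN_ne : (N : ℂ) ≠ 0 := Nat.cast_ne_zero.mpr (NeZero.ne N)
  have hsplit := tendsto_finsetSum (Finset.range N) fun t _ =>
    (tendsto_residue_theta N t).const_mul (cexp (Real.pi * Complex.I * t ^ 2 / N))
  have hlimits := tendsto_nhds_unique (hsplit.congr' ?_) (tendsto_theta N hN)
  · rw [← Finset.sum_mul] at hlimits
    have hpolar : (-Complex.I / N : ℂ) = (((N : ℝ)⁻¹ : ℝ) : ℂ) * (-Complex.I) := by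
      push_cast
      ring
    rw [mul_right_cancel₀ (inv_ne_zero hN_ne) hlimits,
      Complex.cpow_def_of_ne_zero (by simp [hN_ne]), hpolar,
      Complex.log_ofReal_mul (inv_pos.mpr hN_pos) (by simp), Complex.log_neg_I, Real.log_inv,
      one_div, ← Complex.exp_neg, e, Real.sqrt_eq_rpow, Real.rpow_def_of_pos hN_pos, ofReal_exp,
      ← Complex.exp_add]
    congr 1
    push_cast
    ring
  · filter_upwards [eventually_gt_atTop 0] with s hs
    rw [tsum_exp_eq_sum_residues N hN (by positivity), Finset.mul_sum]
    exact Finset.sum_congr rfl fun t _ => mul_left_comm _ _ _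

end ThetaGauss

/-! ### Characters of `ℝ / ℤ` -/

theorem e_add (z w : ℂ) : e (z + w) = e z * e w := by
  rw [e, e, e, ← Complex.exp_add, mul_add]

theorem e_zero : e 0 = 1 := by simp [e]

theorem e_neg (z : ℂ) : e (-z) = (e z)⁻¹ := by
  rw [e, e, ← Complex.exp_neg, mul_neg]

theorem e_sum {ι : Type*} (s : Finset ι) (z : ι → ℂ) : e (∑ i ∈ s, z i) = ∏ i ∈ s, e (z i) := by
  simp only [e, Finset.mul_sum, Complex.exp_sum]

theorem e_intCast (n : ℤ) : e n = 1 := by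
  rw [e, Complex.exp_eq_one_iff]
  exact ⟨n, mul_comm _ _⟩

theorem star_e_ofReal (x : ℝ) : star (e x) = e (-x) := by
  rw [e, e, Complex.star_def, ← Complex.exp_conj]
  congr 1
  simp only [map_mul, Complex.conj_ofReal, Complex.conj_I, Complex.conj_ofNat]
  ring

theorem eCircle_coe (x : ℝ) : eCircle (x : UnitAddCircle) = e x := by
  rw [eCircle, AddCircle.toCircle_apply_mk, Circle.coe_exp, e]
  push_cast
  ring_nf

theorem eCircle_add (x y : UnitAddCircle) : eCircle (x + y) = eCircle x * eCircle y := by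
  simp [eCircle, AddCircle.toCircle_add]

theorem eCircle_zero : eCircle 0 = 1 := by simp [eCircle]

theorem eCircle_ne_zero (x : UnitAddCircle) : eCircle x ≠ 0 := by simp [eCircle]

theorem eCircle_neg (x : UnitAddCircle) : eCircle (-x) = (eCircle x)⁻¹ :=
  eq_inv_of_mul_eq_one_left (by rw [← eCircle_add, neg_add_cancel, eCircle_zero])

theorem eCircle_neg_eq_star (x : UnitAddCircle) : eCircle (-x) = star (eCircle x) := by
  rw [eCircle, eCircle, AddCircle.toCircle_neg, Circle.coe_inv_eq_conj, Complex.star_def]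

theorem eCircle_eq_one_iff (x : UnitAddCircle) : eCircle x = 1 ↔ x = 0 := by
  rw [eCircle, Circle.coe_eq_one, ← AddCircle.toCircle_zero (T := (1 : ℝ))]
  exact (AddCircle.injective_toCircle one_ne_zero).eq_iff

theorem e_ratCast_eq_one_iff (r : ℚ) : e ((r : ℝ) : ℂ) = 1 ↔ ∃ m : ℤ, (m : ℚ) = r := by
  rw [← eCircle_coe, eCircle_eq_one_iff, AddCircle.coe_eq_zero_iff]
  refine exists_congr fun m => ?_
  rw [zsmul_one]
  exact_mod_cast Iff.rfl

/-! ### Milgram's formula -/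

section Milgram

theorem sum_comp_of_surjective {A B R : Type*} [AddGroup A] [AddGroup B] [Fintype A] [Fintype B]
    [NonAssocSemiring R] {f : A →+ B} (hf : Function.Surjective f) [Fintype f.ker] (D : B → R) :
    ∑ a, D (f a) = Fintype.card f.ker * ∑ b, D b := by
  classical
  rw [Finset.mul_sum, ← Finset.sum_fiberwise_of_maps_to (g := f) (t := Finset.univ)
    fun _ _ => Finset.mem_univ _]
  refine Finset.sum_congr rfl fun b _ => ?_
  have hfiber : (Finset.univ.filter fun a => f a = b).card = Fintype.card f.ker := by
    rw [AddMonoidHom.card_fiber_eq_of_mem_range f (hf b) ⟨0, map_zero f⟩, ← Fintype.card_subtype]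
    exact Fintype.card_congr (Equiv.refl _)
  rw [Finset.sum_congr rfl fun a ha => by rw [(Finset.mem_filter.mp ha).2], Finset.sum_const,
    nsmul_eq_mul, hfiber]

theorem sum_eq_sum_orthogonal {G R : Type*} [AddCommGroup G] [Fintype G] [CommRing R] [IsDomain R]
    [CharZero R] (E : G → R) (b : G → AddChar G R) (H : AddSubgroup G)
    (hE : ∀ g, ∀ h ∈ H, E (g + h) = E g * b g h) (K : Finset G)
    (hK : ∀ g, g ∈ K ↔ ∀ h ∈ H, b g h = 1) :
    ∑ g, E g = ∑ g ∈ K, E g := by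
  classical
  have hH : (Fintype.card H : R) ≠ 0 := Nat.cast_ne_zero.mpr Fintype.card_ne_zero
  let χ (g : G) : AddChar H R := (b g).compAddMonoidHom H.subtype
  have hχ (g : G) : χ g = 0 ↔ g ∈ K := by
    rw [hK, DFunLike.ext_iff]
    exact Subtype.forall
  refine mul_left_cancel₀ hH ?_
  calc (Fintype.card H : R) * ∑ g, E g
      = ∑ h : H, ∑ g, E (g + h) := by
        rw [← nsmul_eq_mul, ← Finset.card_univ, ← Finset.sum_const]
        exact Finset.sum_congr rfl fun h _ => (Equiv.sum_comp (Equiv.addRight (h : G)) E).symm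
    _ = ∑ g, E g * ∑ h : H, χ g h := by
        rw [Finset.sum_comm]
        refine Finset.sum_congr rfl fun g _ => ?_
        rw [Finset.mul_sum]
        exact Finset.sum_congr rfl fun h _ => hE g h h.2
    _ = ∑ g, if g ∈ K then Fintype.card H * E g else 0 := by
        simp only [AddChar.sum_eq_ite, hχ, mul_ite, mul_zero, mul_comm]
    _ = Fintype.card H * ∑ g ∈ K, E g := by
        rw [Finset.mul_sum, Finset.sum_ite_mem, Finset.univ_inter]

variable {V : Type*} [AddCommGroup V] [Module ℚ V]

namespace EvenLattice

/-- The Gauss sum `∑ e(Q(γ))` over the discriminant group. -/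
def gauss (L : EvenLattice V) : ℂ := ∑ γ : L.Disc, eCircle (L.discQ γ)

theorem mem_dual {L : EvenLattice V} {x : V} :
    x ∈ L.dual ↔ ∀ y ∈ L.carrier, ∃ m : ℤ, (m : ℚ) = QuadraticMap.polar L.Q x y := by
  rw [dual, LinearMap.BilinForm.mem_dualSubmodule]
  simp only [Submodule.mem_one]
  exact Iff.rfl

theorem carrier_le_dual (L : EvenLattice V) : L.carrier ≤ L.dual := by
  refine fun x hx => mem_dual.mpr fun y hy => ?_
  obtain ⟨a, ha⟩ := L.even _ (add_mem hx hy)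
  obtain ⟨b, hb⟩ := L.even _ hx
  obtain ⟨c, hc⟩ := L.even _ hy
  exact ⟨a - b - c, by rw [QuadraticMap.polar, ha, hb, hc]; push_cast; ring⟩

theorem discQ_mk (L : EvenLattice V) (x : L.dual) :
    L.discQ (Submodule.Quotient.mk x) = (((L.Q x : ℚ) : ℝ) : UnitAddCircle) := rfl

theorem eCircle_discQ_mk (L : EvenLattice V) (x : L.dual) :
    eCircle (L.discQ (Submodule.Quotient.mk x)) = e (((L.Q x : ℚ) : ℝ) : ℂ) := by
  rw [discQ_mk, eCircle_coe]

theorem polar_discQ_mk (L : EvenLattice V) (x y : L.dual) :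
    QuadraticMap.polar L.discQ (Submodule.Quotient.mk x) (Submodule.Quotient.mk y)
      = (((QuadraticMap.polar L.Q x y : ℚ) : ℝ) : UnitAddCircle) := by
  rw [QuadraticMap.polar, ← Submodule.Quotient.mk_add, discQ_mk, discQ_mk, discQ_mk,
    QuadraticMap.polar]
  push_cast
  rfl

theorem polar_discQ_add_right (L : EvenLattice V) (γ δ δ' : L.Disc) :
    QuadraticMap.polar L.discQ γ (δ + δ')
      = QuadraticMap.polar L.discQ γ δ + QuadraticMap.polar L.discQ γ δ' := by
  obtain ⟨x, rfl⟩ := Submodule.Quotient.mk_surjective _ γ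
  obtain ⟨y, rfl⟩ := Submodule.Quotient.mk_surjective _ δ
  obtain ⟨y', rfl⟩ := Submodule.Quotient.mk_surjective _ δ'
  rw [← Submodule.Quotient.mk_add, polar_discQ_mk, polar_discQ_mk, polar_discQ_mk,
    Submodule.coe_add, QuadraticMap.polar_add_right, Rat.cast_add, AddCircle.coe_add]

/-- The character `δ ↦ e((γ, δ))` of the discriminant group. -/
def discPairing (L : EvenLattice V) (γ : L.Disc) : AddChar L.Disc ℂ where
  toFun δ := eCircle (QuadraticMap.polar L.discQ γ δ)
  map_zero_eq_one' := by
    rw [eCircle_eq_one_iff, ← add_eq_left (a := QuadraticMap.polar L.discQ γ 0),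
      ← polar_discQ_add_right, add_zero]
  map_add_eq_mul' δ δ' := by rw [polar_discQ_add_right, eCircle_add]

theorem eCircle_discQ_add (L : EvenLattice V) (γ δ : L.Disc) :
    eCircle (L.discQ (γ + δ))
      = eCircle (L.discQ γ) * eCircle (L.discQ δ) * L.discPairing γ δ := by
  change _ = _ * eCircle (QuadraticMap.polar L.discQ γ δ)
  rw [← eCircle_add, ← eCircle_add, QuadraticMap.polar]
  congr 1
  abel

theorem discPairing_mk_eq_one_iff (L : EvenLattice V) (x y : L.dual) :
    L.discPairing (Submodule.Quotient.mk x) (Submodule.Quotient.mk y) = 1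
      ↔ ∃ m : ℤ, (m : ℚ) = QuadraticMap.polar L.Q x y := by
  change eCircle (QuadraticMap.polar L.discQ _ _) = 1 ↔ _
  rw [polar_discQ_mk, eCircle_coe, e_ratCast_eq_one_iff]

section Sublattice

variable {M L : EvenLattice V}

theorem dual_le_dual (hQ : M.Q = L.Q) (hle : M.carrier ≤ L.carrier) : L.dual ≤ M.dual :=
  fun _ hx => mem_dual.mpr fun y hy => by
    rw [hQ]
    exact mem_dual.mp hx y (hle hy)

/-- For `M ≤ L`, the inclusion of `L' / M` into `M' / M`. -/
def discInclusion (hdual : L.dual ≤ M.dual) :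
    (L.dual ⧸ M.carrier.submoduleOf L.dual) →ₗ[ℤ] M.Disc :=
  Submodule.mapQ _ _ (Submodule.inclusion hdual) fun _ hx => hx

/-- For `M ≤ L`, the projection of `L' / M` onto `L' / L`. -/
def discProj (hle : M.carrier ≤ L.carrier) :
    (L.dual ⧸ M.carrier.submoduleOf L.dual) →ₗ[ℤ] L.Disc :=
  Submodule.mapQ _ _ LinearMap.id fun _ hx => hle hx

/-- For `M ≤ L`, the subgroup `L / M` of `M' / M`. -/
def discSubgroup (M L : EvenLattice V) : AddSubgroup M.Disc :=
  ((L.carrier.submoduleOf M.dual).map (M.carrier.submoduleOf M.dual).mkQ).toAddSubgroup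

theorem discInclusion_injective (hdual : L.dual ≤ M.dual) :
    Function.Injective (discInclusion hdual) := by
  rw [injective_iff_map_eq_zero]
  intro γ hγ
  obtain ⟨x, rfl⟩ := Submodule.Quotient.mk_surjective _ γ
  exact (Submodule.Quotient.mk_eq_zero _).mpr ((Submodule.Quotient.mk_eq_zero
    (M.carrier.submoduleOf M.dual) (x := Submodule.inclusion hdual x)).mp hγ)

theorem discProj_surjective (hle : M.carrier ≤ L.carrier) :
    Function.Surjective (discProj hle) := by
  intro γ
  obtain ⟨x, rfl⟩ := Submodule.Quotient.mk_surjective _ γ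
  exact ⟨Submodule.Quotient.mk x, rfl⟩

theorem discQ_discInclusion (hQ : M.Q = L.Q) (hdual : L.dual ≤ M.dual)
    (hle : M.carrier ≤ L.carrier) (γ : L.dual ⧸ M.carrier.submoduleOf L.dual) :
    M.discQ (discInclusion hdual γ) = L.discQ (discProj hle γ) := by
  obtain ⟨x, rfl⟩ := Submodule.Quotient.mk_surjective _ γ
  have hmk := M.discQ_mk (Submodule.inclusion hdual x)
  rw [hQ] at hmk
  exact hmk.trans (L.discQ_mk x).symm

theorem eCircle_discQ_of_mem_discSubgroup (hQ : M.Q = L.Q) {δ : M.Disc}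
    (hδ : δ ∈ discSubgroup M L) : eCircle (M.discQ δ) = 1 := by
  obtain ⟨y, hy, rfl⟩ := hδ
  obtain ⟨m, hm⟩ := L.even y hy
  exact (M.eCircle_discQ_mk y).trans ((e_ratCast_eq_one_iff _).mpr ⟨m, by rw [hQ, hm]⟩)

theorem mem_range_discInclusion_iff (hQ : M.Q = L.Q) (hdual : L.dual ≤ M.dual) (γ : M.Disc) :
    γ ∈ Set.range (discInclusion hdual) ↔ ∀ δ ∈ discSubgroup M L, M.discPairing γ δ = 1 := by
  constructor
  · rintro ⟨ξ, rfl⟩ _ ⟨y, hy, rfl⟩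
    obtain ⟨x, rfl⟩ := Submodule.Quotient.mk_surjective _ ξ
    refine (M.discPairing_mk_eq_one_iff (Submodule.inclusion hdual x) y).mpr ?_
    rw [hQ]
    exact mem_dual.mp x.2 y hy
  · intro hγ
    obtain ⟨x, rfl⟩ := Submodule.Quotient.mk_surjective _ γ
    refine ⟨Submodule.Quotient.mk ⟨x, mem_dual.mpr fun y hy => ?_⟩, rfl⟩
    rw [← hQ]
    exact (M.discPairing_mk_eq_one_iff x ⟨y, hdual (L.carrier_le_dual hy)⟩).mp
      (hγ _ ⟨⟨y, hdual (L.carrier_le_dual hy)⟩, hy, rfl⟩)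

theorem gauss_eq_mul_of_le (hQ : M.Q = L.Q) (hle : M.carrier ≤ L.carrier) :
    ∃ c : ℕ, 0 < c ∧ M.gauss = c * L.gauss := by
  classical
  have hdual := dual_le_dual hQ hle
  have hinj := discInclusion_injective hdual
  have : Fintype (L.dual ⧸ M.carrier.submoduleOf L.dual) := Fintype.ofInjective _ hinj
  refine ⟨Fintype.card (discProj hle).toAddMonoidHom.ker, Fintype.card_pos, ?_⟩
  calc M.gauss
      = ∑ γ ∈ Finset.univ.map ⟨discInclusion hdual, hinj⟩, eCircle (M.discQ γ) := by
        refine sum_eq_sum_orthogonal _ M.discPairing (discSubgroup M L) (fun γ δ hδ => ?_) _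
          fun γ => ?_
        · rw [eCircle_discQ_add, eCircle_discQ_of_mem_discSubgroup hQ hδ, mul_one]
        · rw [← mem_range_discInclusion_iff hQ hdual, Finset.mem_map, Set.mem_range]
          simp
    _ = ∑ γ, eCircle (L.discQ ((discProj hle).toAddMonoidHom γ)) := by
        rw [Finset.sum_map]
        exact Finset.sum_congr rfl fun γ _ =>
          congrArg eCircle (discQ_discInclusion hQ hdual hle γ)
    _ = _ := sum_comp_of_surjective (f := (discProj hle).toAddMonoidHom)
        (discProj_surjective hle) fun γ => eCircle (L.discQ γ)

end Sublattice

theorem sum_e_sq_div_natCast (n : ℕ) [NeZero n] :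
    ∑ t : Fin (2 * n), e (((t : ℕ) ^ 2 / (4 * n) : ℝ) : ℂ)
      = Real.sqrt (2 * n : ℕ) * e ((1 / 8 : ℝ) : ℂ) := by
  have hn : (n : ℂ) ≠ 0 := Nat.cast_ne_zero.mpr (NeZero.ne n)
  have hsum := sum_exp_sq_div (2 * n) (even_two_mul n)
  rw [← Fin.sum_univ_eq_sum_range fun t : ℕ => Complex.exp
    (Real.pi * Complex.I * (t : ℂ) ^ 2 / ((2 * n : ℕ) : ℂ))] at hsum
  push_cast at hsum ⊢
  rw [← hsum]
  refine Finset.sum_congr rfl fun t _ => ?_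
  rw [e]
  congr 1
  field_simp
  ring

theorem sum_e_sq_div {a : ℤ} (ha : a ≠ 0) :
    ∑ t : Fin (2 * a.natAbs), e ((((t : ℕ) ^ 2 / (4 * a) : ℚ) : ℝ) : ℂ)
      = Real.sqrt (2 * a.natAbs : ℕ) * e ((a.sign / 8 : ℝ) : ℂ) := by
  obtain ⟨n, rfl | rfl⟩ := a.eq_nat_or_neg
  · have : NeZero n := ⟨by simpa using ha⟩
    simpa [Int.sign_natCast_of_ne_zero (NeZero.ne n)] using sum_e_sq_div_natCast n
  · have : NeZero n := ⟨by simpa using ha⟩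
    have hconj := congrArg star (sum_e_sq_div_natCast n)
    simp only [star_sum, star_mul', star_e_ofReal, Complex.star_def, Complex.conj_ofReal] at hconj
    have habs : (-(n : ℤ)).natAbs = n := by rw [Int.natAbs_neg, Int.natAbs_natCast]
    rw [habs]
    simpa [Int.sign_natCast_of_ne_zero (NeZero.ne n), div_neg, neg_div] using hconj

/-- `v` is a `ℤ`-basis of `M` in which the quadratic form is diagonal, with integers `a i` on the
diagonal. -/
structure IsDiagonal {ι : Type*} [Fintype ι] (M : EvenLattice V) (v : Module.Basis ι ℚ V)
    (a : ι → ℤ) : Prop where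
  carrier_eq : M.carrier = Submodule.span ℤ (Set.range v)
  Q_sum_smul : ∀ t : ι → ℚ, M.Q (∑ i, t i • v i) = ∑ i, a i * t i ^ 2

namespace IsDiagonal

variable {ι : Type*} [Fintype ι] {M : EvenLattice V} {v : Module.Basis ι ℚ V} {a : ι → ℤ}

theorem polar_sum_smul (h : M.IsDiagonal v a) (t s : ι → ℚ) :
    QuadraticMap.polar M.Q (∑ i, t i • v i) (∑ i, s i • v i) = ∑ i, 2 * a i * t i * s i := by
  rw [QuadraticMap.polar, ← Finset.sum_add_distrib]
  simp only [← add_smul]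
  rw [h.Q_sum_smul fun i => t i + s i, h.Q_sum_smul, h.Q_sum_smul, ← Finset.sum_sub_distrib,
    ← Finset.sum_sub_distrib]
  exact Finset.sum_congr rfl fun i _ => by ring

theorem polar_basis_left (h : M.IsDiagonal v a) (i : ι) (s : ι → ℚ) :
    QuadraticMap.polar M.Q (v i) (∑ j, s j • v j) = 2 * a i * s i := by
  classical
  simpa [Pi.single_apply] using h.polar_sum_smul (Pi.single i 1) s

theorem ne_zero (h : M.IsDiagonal v a) (i : ι) : a i ≠ 0 := by
  intro hi
  refine v.ne_zero i (M.nondegenerate.1 _ fun y => ?_)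
  rw [← v.sum_repr y, QuadraticMap.polarBilin_apply_apply, h.polar_basis_left, hi, Int.cast_zero,
    mul_zero, zero_mul]

theorem sum_smul_mem_carrier_iff (h : M.IsDiagonal v a) (t : ι → ℚ) :
    ∑ i, t i • v i ∈ M.carrier ↔ ∀ i, ∃ m : ℤ, (m : ℚ) = t i := by
  rw [h.carrier_eq, v.mem_span_iff_repr_mem ℤ]
  refine forall_congr' fun i => ?_
  rw [v.repr_sum_self]
  exact Iff.rfl

theorem basis_mem_carrier (h : M.IsDiagonal v a) (i : ι) : v i ∈ M.carrier := by
  rw [h.carrier_eq]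
  exact Submodule.subset_span ⟨i, rfl⟩

theorem sum_smul_mem_dual_iff (h : M.IsDiagonal v a) (t : ι → ℚ) :
    ∑ i, t i • v i ∈ M.dual ↔ ∀ i, ∃ m : ℤ, (m : ℚ) = 2 * a i * t i := by
  rw [mem_dual]
  constructor
  · intro ht i
    have hpair := ht _ (h.basis_mem_carrier i)
    rwa [QuadraticMap.polar_comm, h.polar_basis_left] at hpair
  · intro ht y hy
    rw [← v.sum_repr y] at hy ⊢
    rw [h.polar_sum_smul]
    choose m hm using ht
    choose m' hm' using (h.sum_smul_mem_carrier_iff _).mp hy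
    exact ⟨∑ i, m i * m' i, by push_cast; simp [hm, hm']⟩

/-- The vector `∑ i, t i / (2 a i) • v i` of the dual lattice. -/
def dualVec (h : M.IsDiagonal v a) (t : ι → ℤ) : M.dual :=
  ⟨∑ i, ((t i : ℚ) / (2 * a i)) • v i, (h.sum_smul_mem_dual_iff _).mpr fun i =>
    ⟨t i, by have := Int.cast_ne_zero (α := ℚ).mpr (h.ne_zero i); field_simp⟩⟩

theorem mk_dualVec_eq_iff (h : M.IsDiagonal v a) (t s : ι → ℤ) :
    (Submodule.Quotient.mk (h.dualVec t) : M.Disc) = Submodule.Quotient.mk (h.dualVec s)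
      ↔ ∀ i, 2 * a i ∣ t i - s i := by
  rw [Submodule.Quotient.eq]
  change (∑ i, ((t i : ℚ) / (2 * a i)) • v i) - (∑ i, ((s i : ℚ) / (2 * a i)) • v i)
    ∈ M.carrier ↔ _
  rw [← Finset.sum_sub_distrib]
  simp only [← sub_smul]
  rw [h.sum_smul_mem_carrier_iff]
  refine forall_congr' fun i => exists_congr fun m => ?_
  have ha : (2 * a i : ℚ) ≠ 0 := mul_ne_zero two_ne_zero (Int.cast_ne_zero.mpr (h.ne_zero i))
  rw [← sub_div, eq_div_iff ha, eq_comm, mul_comm (m : ℚ)]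
  exact_mod_cast Iff.rfl

theorem dualVec_surjective (h : M.IsDiagonal v a) : Function.Surjective h.dualVec := by
  intro y
  have hy := (h.sum_smul_mem_dual_iff (v.repr (y : V))).mp (by rw [v.sum_repr]; exact y.2)
  choose m hm using hy
  refine ⟨m, Subtype.ext (Eq.trans ?_ (v.sum_repr (y : V)))⟩
  refine Finset.sum_congr rfl fun i _ => ?_
  have ha : (2 * a i : ℚ) ≠ 0 := mul_ne_zero two_ne_zero (Int.cast_ne_zero.mpr (h.ne_zero i))
  rw [hm, mul_div_cancel_left₀ _ ha]

theorem eCircle_discQ_dualVec (h : M.IsDiagonal v a) (t : ι → ℤ) :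
    eCircle (M.discQ (Submodule.Quotient.mk (h.dualVec t)))
      = ∏ i, e ((((t i : ℚ) ^ 2 / (4 * a i) : ℚ) : ℝ) : ℂ) := by
  rw [eCircle_discQ_mk, ← e_sum]
  change e (((M.Q (∑ i, ((t i : ℚ) / (2 * a i)) • v i) : ℚ) : ℝ) : ℂ) = _
  rw [h.Q_sum_smul]
  congr 1
  push_cast
  refine Finset.sum_congr rfl fun i _ => ?_
  have ha : (a i : ℂ) ≠ 0 := Int.cast_ne_zero.mpr (h.ne_zero i)
  field_simp
  ring

theorem bijective_mk_dualVec (h : M.IsDiagonal v a) :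
    Function.Bijective fun t : ∀ i, Fin (2 * (a i).natAbs) =>
      (Submodule.Quotient.mk (h.dualVec fun i => (t i : ℕ)) : M.Disc) := by
  have hdvd (i : ι) (m : ℤ) : ((2 * (a i).natAbs : ℕ) : ℤ) ∣ m ↔ 2 * a i ∣ m := by
    rw [← Int.natAbs_dvd (a := 2 * a i), Int.natAbs_mul]
    rfl
  constructor
  · intro t s hts
    funext i
    have hi := (hdvd i _).mpr ((h.mk_dualVec_eq_iff _ _).mp hts i)
    exact Fin.ext ((Nat.modEq_iff_dvd.mpr hi).symm.eq_of_lt_of_lt (t i).2 (s i).2)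
  · intro γ
    obtain ⟨y, rfl⟩ := Submodule.Quotient.mk_surjective _ γ
    obtain ⟨m, rfl⟩ := h.dualVec_surjective y
    have (i : ι) : NeZero (2 * (a i).natAbs) :=
      ⟨mul_ne_zero two_ne_zero (Int.natAbs_ne_zero.mpr (h.ne_zero i))⟩
    refine ⟨fun i => ⟨(m i : ZMod (2 * (a i).natAbs)).val, ZMod.val_lt _⟩,
      (h.mk_dualVec_eq_iff _ _).mpr fun i => (hdvd i _).mp ?_⟩
    rw [← ZMod.intCast_eq_intCast_iff_dvd_sub]
    simp

theorem gauss_eq (h : M.IsDiagonal v a) :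
    ∃ r : ℝ, 0 < r ∧ M.gauss = r * e (((∑ i, (a i).sign : ℤ) : ℂ) / 8) := by
  classical
  refine ⟨∏ i, Real.sqrt (2 * (a i).natAbs : ℕ),
    Finset.prod_pos fun i _ => Real.sqrt_pos.mpr ?_, ?_⟩
  · exact_mod_cast Nat.mul_pos two_pos (Int.natAbs_pos.mpr (h.ne_zero i))
  calc M.gauss
      = ∑ t : ∀ i, Fin (2 * (a i).natAbs),
          ∏ i, e ((((t i : ℕ) ^ 2 / (4 * a i) : ℚ) : ℝ) : ℂ) := by
        rw [gauss, ← h.bijective_mk_dualVec.sum_comp]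
        exact Finset.sum_congr rfl fun t _ => h.eCircle_discQ_dualVec _
    _ = ∏ i, ∑ t : Fin (2 * (a i).natAbs), e ((((t : ℕ) ^ 2 / (4 * a i) : ℚ) : ℝ) : ℂ) := by
        rw [Finset.prod_univ_sum, Fintype.piFinset_univ]
    _ = _ := by
        rw [Finset.prod_congr rfl fun i _ => sum_e_sq_div (h.ne_zero i), Finset.prod_mul_distrib,
          Complex.ofReal_prod, ← e_sum]
        push_cast
        rw [Finset.sum_div]

theorem sum_sign_eq (h : M.IsDiagonal v a) :
    ∑ i, (a i).sign = (M.bPlus : ℤ) - M.bMinus := by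
  have hequiv : QuadraticMap.Equivalent M.Q
      (QuadraticMap.weightedSumSquares ℚ fun i => (a i : ℚ)) := by
    refine ⟨{ v.equivFun with map_app' := fun x => ?_ }⟩
    change QuadraticMap.weightedSumSquares ℚ (fun i => (a i : ℚ)) (v.equivFun x) = M.Q x
    conv_rhs => rw [← v.sum_equivFun x, h.Q_sum_smul]
    simp [QuadraticMap.weightedSumSquares_apply, sq]
  rw [bPlus, bMinus, QuadraticForm.sigPos_of_equiv_weightedSumSquares hequiv,
    QuadraticForm.sigNeg_of_equiv_weightedSumSquares hequiv, Set.ncard_eq_toFinset_card',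
    Set.ncard_eq_toFinset_card', Set.toFinset_ofPred, Set.toFinset_ofPred, Finset.card_filter,
    Finset.card_filter]
  push_cast
  rw [← Finset.sum_sub_distrib]
  refine Finset.sum_congr rfl fun i _ => ?_
  rcases lt_or_gt_of_ne (h.ne_zero i) with hi | hi
  · simp [Int.sign_eq_neg_one_of_neg hi, hi, hi.not_gt]
  · simp [Int.sign_eq_one_of_pos hi, hi, hi.not_gt]

end IsDiagonal

theorem exists_intCast_smul_mem_carrier (L : EvenLattice V) {ι : Type*} [Finite ι] (v : ι → V) :
    ∃ d : ℤ, d ≠ 0 ∧ ∀ i, (d : ℚ) • v i ∈ L.carrier := by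
  obtain ⟨n, b, hb⟩ := L.isLattice
  obtain ⟨d, hd⟩ := IsLocalization.exist_integer_multiples_of_finite (nonZeroDivisors ℤ)
    fun ij : ι × Fin n => b.repr (v ij.1) ij.2
  refine ⟨d, nonZeroDivisors.ne_zero d.2, fun i => ?_⟩
  rw [hb, b.mem_span_iff_repr_mem ℤ]
  intro j
  obtain ⟨m, hm⟩ := hd (i, j)
  exact ⟨m, by rw [hm, map_smul, Finsupp.smul_apply, zsmul_eq_mul, smul_eq_mul]⟩

theorem exists_orthogonal_basis_mem_carrier (L : EvenLattice V) :
    ∃ (n : ℕ) (v : Module.Basis (Fin n) ℚ V), (∀ i, v i ∈ L.carrier) ∧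
      (QuadraticMap.associated (R := ℚ) L.Q).IsOrthoᵢ v := by
  obtain ⟨n, b, -⟩ := L.isLattice
  have : FiniteDimensional ℚ V := b.finiteDimensional_of_finite
  obtain ⟨v, hv⟩ := LinearMap.BilinForm.exists_orthogonal_basis
    (QuadraticForm.associated_isSymm ℚ L.Q)
  obtain ⟨d, hd, hmem⟩ := L.exists_intCast_smul_mem_carrier v
  have hunit : IsUnit (d : ℚ) := (Int.cast_ne_zero.mpr hd).isUnit
  refine ⟨_, v.isUnitSMul fun _ => hunit, fun i => ?_, fun i j hij => ?_⟩
  · rw [Module.Basis.isUnitSMul_apply]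
    exact hmem i
  · have hij' : QuadraticMap.associated (R := ℚ) L.Q (v i) (v j) = 0 := hv hij
    simp only [Function.onFun, Module.Basis.isUnitSMul_apply, map_smul,
      LinearMap.smul_apply, hij', smul_zero]

theorem exists_diagonal_sublattice (L : EvenLattice V) :
    ∃ (M : EvenLattice V) (n : ℕ) (v : Module.Basis (Fin n) ℚ V) (a : Fin n → ℤ),
      M.Q = L.Q ∧ M.carrier ≤ L.carrier ∧ M.IsDiagonal v a := by
  obtain ⟨n, v, hmem, hortho⟩ := L.exists_orthogonal_basis_mem_carrier
  have hle : Submodule.span ℤ (Set.range v) ≤ L.carrier :=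
    Submodule.span_le.mpr (Set.range_subset_iff.mpr hmem)
  choose a ha using fun i => L.even _ (hmem i)
  refine ⟨⟨L.Q, L.nondegenerate, _, ⟨n, v, rfl⟩, fun x hx => L.even x (hle hx)⟩, n, v, a, rfl, hle,
    rfl, fun t => ?_⟩
  have hrepr := DFunLike.congr_fun (QuadraticMap.basisRepr_eq_of_iIsOrtho L.Q v hortho) t
  rw [QuadraticMap.basisRepr_apply, QuadraticMap.weightedSumSquares_apply] at hrepr
  simpa [ha, sq] using hrepr

theorem exists_gauss_eq (L : EvenLattice V) :
    ∃ r : ℝ, 0 < r ∧ L.gauss = r * e (((L.bPlus : ℤ) - L.bMinus : ℤ) / 8) := by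
  obtain ⟨M, n, v, a, hQ, hle, hdiag⟩ := L.exists_diagonal_sublattice
  obtain ⟨c, hc, hML⟩ := gauss_eq_mul_of_le hQ hle
  obtain ⟨r, hr, hM⟩ := hdiag.gauss_eq
  have hsig : ∑ i, (a i).sign = (L.bPlus : ℤ) - L.bMinus := by
    rw [hdiag.sum_sign_eq, bPlus, bMinus, hQ, bPlus, bMinus]
  have hc_ne : (c : ℂ) ≠ 0 := Nat.cast_ne_zero.mpr hc.ne'
  refine ⟨r / c, div_pos hr (Nat.cast_pos.mpr hc), mul_left_cancel₀ hc_ne ?_⟩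
  rw [← hML, hM, hsig]
  push_cast
  field_simp

end EvenLattice

end Milgram

/-! ### The Weil representation of a discriminant form on `ℤ / p` -/

section WeilPrime

variable {p : ℕ} [Fact p.Prime]

local notation "ψ" => ZMod.stdAddChar
local notation "χ" => legendreChar p

theorem stdAddChar_intCast (n : ℤ) : ψ (n : ZMod p) = e ((n / p : ℝ) : ℂ) := by
  rw [ZMod.stdAddChar_coe, e]
  congr 1
  push_cast
  ring

theorem EvenLattice.dualSubmodule_dual {V : Type*} [AddCommGroup V] [Module ℚ V]
    (L : EvenLattice V) : L.bilin.dualSubmodule L.dual = L.carrier := by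
  obtain ⟨n, b, hb⟩ := L.isLattice
  rw [EvenLattice.dual, hb]
  exact LinearMap.BilinForm.dualSubmodule_dualSubmodule_of_basis _ L.nondegenerate
    ⟨fun x y => QuadraticMap.polar_comm L.Q x y⟩ b

theorem EvenLattice.dual_le_carrier {V : Type*} [AddCommGroup V] [Module ℚ V] (L : EvenLattice V)
    (hint : ∀ x ∈ L.dual, ∃ m : ℤ, (m : ℚ) = L.Q x) : L.dual ≤ L.carrier := by
  intro x hx
  rw [← L.dualSubmodule_dual, LinearMap.BilinForm.mem_dualSubmodule]
  intro y hy
  obtain ⟨m, hm⟩ := hint _ (add_mem hx hy)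
  obtain ⟨m₁, hm₁⟩ := hint x hx
  obtain ⟨m₂, hm₂⟩ := hint y hy
  refine Submodule.mem_one.mpr ⟨m - m₁ - m₂, ?_⟩
  rw [QuadraticMap.polarBilin_apply_apply, QuadraticMap.polar, ← hm, ← hm₁, ← hm₂]
  simp

theorem EvenLattice.intCast_ne_zero_of_disc {V : Type*} [AddCommGroup V] [Module ℚ V]
    (L : EvenLattice V) (ι : L.Disc ≃+ ZMod p) (lam : ℤ)
    (hlam : ∀ γ : L.Disc,
      L.discQ γ = (((lam : ℝ) * ((ι γ).val : ℝ) ^ 2 / (p : ℝ) : ℝ) : UnitAddCircle)) :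
    (lam : ZMod p) ≠ 0 := by
  intro hlam_zero
  have hp0 : (p : ℝ) ≠ 0 := Nat.cast_ne_zero.mpr (Fact.out : p.Prime).ne_zero
  obtain ⟨m, rfl⟩ := (ZMod.intCast_zmod_eq_zero_iff_dvd lam p).mp hlam_zero
  have hint (x : V) (hx : x ∈ L.dual) : ∃ r : ℤ, (r : ℚ) = L.Q x := by
    have hval (t : ℝ) : ((p * m : ℤ) : ℝ) * t ^ 2 / p = m * t ^ 2 := by push_cast; field_simp
    rw [← e_ratCast_eq_one_iff, ← L.eCircle_discQ_mk ⟨x, hx⟩, hlam, eCircle_coe, hval]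
    exact_mod_cast e_intCast (m * ((ι (Submodule.Quotient.mk ⟨x, hx⟩)).val ^ 2 : ℕ))
  have hzero (γ : L.Disc) : γ = 0 := by
    obtain ⟨x, rfl⟩ := Submodule.Quotient.mk_surjective _ γ
    exact (Submodule.Quotient.mk_eq_zero _).mpr (L.dual_le_carrier hint x.2)
  exact one_ne_zero (ι.symm.injective ((hzero _).trans (hzero (ι.symm 0)).symm))

theorem eCircle_coe_mul_val_sq_div (lam : ℤ) (x : ZMod p) :
    eCircle ((lam * (x.val : ℝ) ^ 2 / p : ℝ) : UnitAddCircle) = ψ ((lam : ZMod p) * x ^ 2) := by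
  have hcast : (lam : ZMod p) * x ^ 2 = ((lam * (x.val : ℤ) ^ 2 : ℤ) : ZMod p) := by
    push_cast
    rw [ZMod.natCast_zmod_val]
  rw [eCircle_coe, hcast, stdAddChar_intCast]
  push_cast
  rfl

variable {A : Type*} [AddCommGroup A] [Fintype A] (ι : A ≃+ ZMod p) (Q : A → UnitAddCircle)
  (l : ZMod p) (sig : ℤ)

/-- The discriminant form `Q` is `x ↦ l x² / p` on `ℤ / p`, and its signature `sig` is the one
prescribed by Milgram's formula: the normalising constant of `ρ(S)` is the inverse of the Gauss sum
of `Q`. -/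
structure IsPrimeDisc : Prop where
  eCircle_eq : ∀ γ, eCircle (Q γ) = ψ (l * ι γ ^ 2)
  const_eq : e (-(sig : ℂ) / 8) / (Real.sqrt (Fintype.card A) : ℂ) = (quadGauss l)⁻¹

variable {ι Q l sig}

theorem sum_eCircle_eq (hQ : ∀ γ, eCircle (Q γ) = ψ (l * ι γ ^ 2)) :
    ∑ γ, eCircle (Q γ) = quadGauss l := by
  rw [quadGauss, ← Equiv.sum_comp ι.toEquiv]
  exact Finset.sum_congr rfl fun γ _ => hQ γ

theorem norm_quadGauss_sq (hp : p ≠ 2) (hl : l ≠ 0) : ‖quadGauss l‖ ^ 2 = p := by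
  have hneg_one : ‖χ (-1)‖ = 1 := by
    rw [← sq_eq_sq₀ (norm_nonneg _) zero_le_one, sq, ← norm_mul,
      legendreChar_mul_self (neg_ne_zero.mpr one_ne_zero), norm_one, one_pow]
  rw [sq, ← norm_mul, quadGauss_mul_self hp hl, norm_mul, hneg_one, one_mul, Complex.norm_natCast]

theorem norm_e_ofReal (x : ℝ) : ‖e x‖ = 1 := by
  rw [← eCircle_coe, eCircle, Circle.norm_coe]

theorem isPrimeDisc_of_sum (hp : p ≠ 2) (hl : l ≠ 0) (hQ : ∀ γ, eCircle (Q γ) = ψ (l * ι γ ^ 2))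
    {r : ℝ} (hr : 0 < r) (hsum : ∑ γ, eCircle (Q γ) = r * e ((sig : ℂ) / 8)) :
    IsPrimeDisc ι Q l sig := by
  refine ⟨hQ, ?_⟩
  rw [sum_eCircle_eq hQ] at hsum
  have hphase : ‖e ((sig : ℂ) / 8)‖ = 1 := by exact_mod_cast norm_e_ofReal (sig / 8)
  have hnorm := norm_quadGauss_sq hp hl
  rw [hsum, norm_mul, hphase, mul_one, Complex.norm_real, Real.norm_of_nonneg hr.le] at hnorm
  have hcard : Fintype.card A = p := by
    rw [Fintype.card_congr ι.toEquiv, ZMod.card]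
  rw [hcard, ← hnorm, Real.sqrt_sq hr.le, hsum, mul_inv, ← e_neg, neg_div, div_eq_mul_inv,
    mul_comm]

namespace IsPrimeDisc

variable (h : IsPrimeDisc ι Q l sig)
include h

theorem neg : IsPrimeDisc ι (fun γ => -Q γ) (-l) (-sig) := by
  have hQ (γ) : eCircle (-Q γ) = ψ (-l * ι γ ^ 2) := by
    rw [eCircle_neg, h.eCircle_eq, neg_mul, AddChar.map_neg_eq_inv]
  refine ⟨hQ, ?_⟩
  rw [← sum_eCircle_eq hQ]
  simp only [eCircle_neg_eq_star]
  rw [← star_sum, sum_eCircle_eq h.eCircle_eq, ← star_inv₀, ← h.const_eq, star_div₀,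
    show (-(sig : ℂ) / 8) = ((-sig / 8 : ℝ) : ℂ) by push_cast; ring, star_e_ofReal,
    Complex.star_def, Complex.conj_ofReal]
  congr 2
  push_cast
  ring

theorem weilT_mulVec (v : A → ℂ) (γ : A) :
    (weilT Q).mulVec v γ = ψ (l * ι γ ^ 2) * v γ := by
  classical
  rw [weilT, Matrix.mulVec_diagonal, h.eCircle_eq]

theorem weilS_apply (γ δ : A) : weilS Q sig γ δ = (quadGauss l)⁻¹ * ψ (-(2 * l * ι γ * ι δ)) := by
  rw [weilS, Matrix.of_apply, h.const_eq, eCircle_neg, sub_eq_add_neg, sub_eq_add_neg, eCircle_add,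
    eCircle_add, eCircle_neg, eCircle_neg, h.eCircle_eq, h.eCircle_eq, h.eCircle_eq, map_add,
    ← AddChar.map_neg_eq_inv, ← AddChar.map_neg_eq_inv, ← AddChar.map_add_eq_mul,
    ← AddChar.map_add_eq_mul, ← AddChar.map_neg_eq_inv]
  congr 2
  ring

theorem weilS_mulVec (v : A → ℂ) (γ : A) : (weilS Q sig).mulVec v γ
    = ∑ y : ZMod p, (quadGauss l)⁻¹ * ψ (-(2 * l * ι γ * y)) * v (ι.symm y) := by
  rw [Matrix.mulVec, dotProduct, ← Equiv.sum_comp ι.symm.toEquiv]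
  refine Finset.sum_congr rfl fun y _ => ?_
  rw [h.weilS_apply]
  simp

open Classical in
theorem weilS_mul_weilS_neg (hp : p ≠ 2) (hl : l ≠ 0) :
    weilS Q sig * weilS (fun γ => -Q γ) (-sig) = 1 := by
  ext γ δ
  have hp0 : (p : ℂ) ≠ 0 := natCast_prime_ne_zero
  have hneg : (-1 : ZMod p) ≠ 0 := neg_ne_zero.mpr one_ne_zero
  have hgauss : quadGauss l * quadGauss (-l) = p := by
    rw [← neg_one_mul l, quadGauss_mul hp hl hneg, mul_left_comm, quadGauss_mul_self hp hl,
      ← mul_assoc, legendreChar_mul_self hneg, one_mul]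
  have hterm (y : ZMod p) : weilS Q sig γ (ι.symm y) * weilS (fun γ => -Q γ) (-sig) (ι.symm y) δ
      = (p : ℂ)⁻¹ * ψ (2 * l * (ι δ - ι γ) * y) := by
    rw [h.weilS_apply, h.neg.weilS_apply, ← hgauss, mul_inv, mul_mul_mul_comm,
      ← AddChar.map_add_eq_mul]
    congr 2
    simp only [AddEquiv.apply_symm_apply]
    ring
  have hdiag : 2 * l * (ι δ - ι γ) = 0 ↔ γ = δ := by
    rw [mul_eq_zero, or_iff_right (mul_ne_zero (two_ne_zero_zmod hp) hl), sub_eq_zero,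
      ι.injective.eq_iff, eq_comm]
  rw [Matrix.mul_apply, ← Equiv.sum_comp ι.symm.toEquiv]
  refine (Finset.sum_congr rfl fun y _ => hterm y).trans ?_
  rw [← Finset.mul_sum, sum_stdAddChar_mul, Matrix.one_apply]
  simp only [hdiag]
  split_ifs
  · exact inv_mul_cancel₀ hp0
  · exact mul_zero _

end IsPrimeDisc

end WeilPrime

/-! ### Equivariance under the generators -/

section Equivariance

theorem Mp2Z.phi_zpow (g : Mp2Z) (k : ℤ) (τ : ℍ) : g.phi τ ^ (2 * k) = cocyc g.mat τ ^ k := by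
  rw [zpow_mul, zpow_ofNat, g.sq]

theorem Mp2Z.T_mat : Mp2Z.T.mat = ModularGroup.T := rfl

theorem Mp2Z.S_mat : Mp2Z.S.mat = ModularGroup.S := rfl

theorem Mp2Z.mul_mat (g h : Mp2Z) : (g * h).mat = g.mat * h.mat := rfl

theorem Mp2Z.inv_mat (g : Mp2Z) : (g⁻¹).mat = g.mat⁻¹ := rfl

theorem cocyc_T (τ : ℍ) : cocyc ModularGroup.T τ = 1 := by simp [cocyc, ModularGroup.T]

theorem cocyc_S (τ : ℍ) : cocyc ModularGroup.S τ = τ := by simp [cocyc, ModularGroup.S]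

theorem cocyc_inv_smul (M : SL(2, ℤ)) (τ : ℍ) : cocyc M⁻¹ (M • τ) = (cocyc M τ)⁻¹ := by
  refine eq_inv_of_mul_eq_one_left ?_
  rw [← cocyc_mul, inv_mul_cancel]
  simp [cocyc]

variable {A : Type*} {Q : A → UnitAddCircle}

theorem weilT_transpose : (weilT Q).transpose = weilT Q := by
  classical
  rw [weilT, Matrix.diagonal_transpose]

variable [Fintype A]

open Classical in
theorem weilT_mul_weilT_neg : weilT Q * weilT (fun γ => -Q γ) = 1 := by
  rw [weilT, weilT, Matrix.diagonal_mul_diagonal, ← Matrix.diagonal_one]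
  congr 1
  funext γ
  rw [eCircle_neg, mul_inv_cancel₀ (eCircle_ne_zero _)]

variable [AddCommGroup A] {sig : ℤ}

theorem weilS_transpose : (weilS Q sig).transpose = weilS Q sig := by
  ext γ δ
  rw [Matrix.transpose_apply, weilS, Matrix.of_apply, Matrix.of_apply, add_comm, sub_right_comm]

variable {k : ℤ} {F : ℍ → A → ℂ}

theorem isWeil_equivariant_iff :
    (∀ g R, IsWeil Q sig g R → ∀ τ : ℍ, F (g.mat • τ) = g.phi τ ^ (2 * k) • R.mulVec (F τ)) ↔
      (∀ τ : ℍ, F (ModularGroup.T • τ) = (weilT Q).mulVec (F τ)) ∧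
      ∀ τ : ℍ, F (ModularGroup.S • τ) = (τ : ℂ) ^ k • (weilS Q sig).mulVec (F τ) := by
  simp only [Mp2Z.phi_zpow]
  constructor
  · intro hF
    refine ⟨fun τ => ?_, fun τ => ?_⟩
    · simpa only [Mp2Z.T_mat, cocyc_T, one_zpow, one_smul] using hF _ _ IsWeil.T τ
    · simpa only [Mp2Z.S_mat, cocyc_S] using hF _ _ IsWeil.S τ
  · rintro ⟨hT, hS⟩ g R hR
    induction hR with
    | T => simpa only [Mp2Z.T_mat, cocyc_T, one_zpow, one_smul] using hT
    | S => simpa only [Mp2Z.S_mat, cocyc_S] using hS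
    | mul _ _ ihg ihh =>
      intro τ
      rw [Mp2Z.mul_mat, mul_smul, ihg, ihh, cocyc_mul, mul_zpow, Matrix.mulVec_smul, smul_smul,
        Matrix.mulVec_mulVec]

theorem isWeilDual_equivariant_iff_transpose :
    (∀ g R, IsWeilDual Q sig g R → ∀ τ : ℍ,
        F (g.mat • τ) = g.phi τ ^ (2 * k) • R.mulVec (F τ)) ↔
      ∀ g R, IsWeil Q sig g R → ∀ τ : ℍ,
        R.transpose.mulVec (F (g.mat • τ)) = cocyc g.mat τ ^ k • F τ := by
  simp only [Mp2Z.phi_zpow]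
  have hcancel (g : Mp2Z) (τ : ℍ) (v w : A → ℂ) :
      v = cocyc g⁻¹.mat (g.mat • τ) ^ k • w ↔ w = cocyc g.mat τ ^ k • v := by
    rw [Mp2Z.inv_mat, cocyc_inv_smul, inv_zpow,
      eq_inv_smul_iff₀ (zpow_ne_zero _ (cocyc_ne_zero _ _)), eq_comm]
  constructor
  · intro hF g R hR τ
    have hinv := hF g⁻¹ R.transpose ⟨R, by rwa [inv_inv], rfl⟩ (g.mat • τ)
    rwa [hcancel, Mp2Z.inv_mat, inv_smul_smul] at hinv
  · rintro hF g _ ⟨R, hR, rfl⟩ τ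
    have hinv := hF g⁻¹ R hR (g.mat • τ)
    rw [Mp2Z.inv_mat, inv_smul_smul] at hinv
    exact (hcancel g τ _ _).mp hinv

open Classical in
theorem isWeilDual_equivariant_iff
    (hinv : weilS Q sig * weilS (fun γ => -Q γ) (-sig) = 1) :
    (∀ g R, IsWeilDual Q sig g R → ∀ τ : ℍ,
        F (g.mat • τ) = g.phi τ ^ (2 * k) • R.mulVec (F τ)) ↔
      (∀ τ : ℍ, F (ModularGroup.T • τ) = (weilT fun γ => -Q γ).mulVec (F τ)) ∧
      ∀ τ : ℍ, F (ModularGroup.S • τ)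
        = (τ : ℂ) ^ k • (weilS (fun γ => -Q γ) (-sig)).mulVec (F τ) := by
  have hsolve {M N : Matrix A A ℂ} (hMN : M * N = 1) (v w : A → ℂ) :
      M.mulVec v = w ↔ v = N.mulVec w := by
    constructor
    · rintro rfl
      rw [Matrix.mulVec_mulVec, mul_eq_one_comm.mp hMN, Matrix.one_mulVec]
    · rintro rfl
      rw [Matrix.mulVec_mulVec, hMN, Matrix.one_mulVec]
  rw [isWeilDual_equivariant_iff_transpose]
  simp only [← Matrix.mulVec_smul,
    ← hsolve weilT_mul_weilT_neg, ← hsolve hinv]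
  constructor
  · intro hF
    refine ⟨fun τ => ?_, fun τ => ?_⟩
    · simpa only [Mp2Z.T_mat, cocyc_T, one_zpow, one_smul, weilT_transpose] using hF _ _ IsWeil.T τ
    · simpa only [Mp2Z.S_mat, cocyc_S, weilS_transpose] using hF _ _ IsWeil.S τ
  · rintro ⟨hT, hS⟩ g R hR
    induction hR with
    | T => simpa only [Mp2Z.T_mat, cocyc_T, one_zpow, one_smul, weilT_transpose] using hT
    | S => simpa only [Mp2Z.S_mat, cocyc_S, weilS_transpose] using hS
    | mul _ _ ihg ihh =>
      intro τ
      rw [Mp2Z.mul_mat, mul_smul, Matrix.transpose_mul, ← Matrix.mulVec_mulVec, ihg,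
        Matrix.mulVec_smul, ihh, cocyc_mul, mul_zpow, smul_smul]

end Equivariance

/-! ### Fourier modes of smooth periodic functions on the upper half plane -/

section FourierMode

open MeasureTheory intervalIntegral

/-- The `n`-th Fourier coefficient of `x ↦ G (x + i y)`, as a function of `y`; `G` is meant to have
period `1`. -/
def fourierMode (n : ℤ) (G : ℂ → ℂ) (y : ℝ) : ℂ :=
  ∫ x in (0 : ℝ)..1, e (-n * x) * G (x + y * Complex.I)

theorem continuous_e_mul (c : ℂ) : Continuous fun x : ℝ => e (c * x) := by
  unfold e; fun_prop

theorem hasDerivAt_e_mul (c : ℂ) (x : ℝ) :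
    HasDerivAt (fun x : ℝ => e (c * x)) (2 * Real.pi * Complex.I * c * e (c * x)) x := by
  have hlin := (Complex.ofRealCLM.hasDerivAt (x := x)).const_mul c
  have hexp := (hlin.const_mul (2 * Real.pi * Complex.I)).cexp
  refine hexp.congr_deriv ?_
  simp only [e, Complex.ofRealCLM_apply, Complex.ofReal_one]
  ring

theorem contDiffOn_partialX {G : ℂ → ℂ} (hG : ContDiffOn ℝ ∞ G {z : ℂ | 0 < z.im}) :
    ContDiffOn ℝ ∞ (partialX G) {z : ℂ | 0 < z.im} := contDiffOn_fderiv_apply hG 1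

theorem contDiffOn_partialY {G : ℂ → ℂ} (hG : ContDiffOn ℝ ∞ G {z : ℂ | 0 < z.im}) :
    ContDiffOn ℝ ∞ (partialY G) {z : ℂ | 0 < z.im} := contDiffOn_fderiv_apply hG Complex.I

variable {G : ℂ → ℂ}

theorem hasFDerivAt_of_contDiffOn (hG : ContDiffOn ℝ ∞ G {z : ℂ | 0 < z.im}) (x : ℝ) {y : ℝ}
    (hy : 0 < y) :
    HasFDerivAt G (fderiv ℝ G (x + y * Complex.I)) (x + y * Complex.I) := by
  have hmem : (x + y * Complex.I : ℂ) ∈ {z : ℂ | 0 < z.im} := by simpa using hy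
  exact ((hG.contDiffAt (isOpen_im_pos.mem_nhds hmem)).differentiableAt (by simp)).hasFDerivAt

theorem hasDerivAt_horizontal (hG : ContDiffOn ℝ ∞ G {z : ℂ | 0 < z.im}) (x : ℝ) {y : ℝ}
    (hy : 0 < y) :
    HasDerivAt (fun x : ℝ => G (x + y * Complex.I)) (partialX G (x + y * Complex.I)) x := by
  have hline : HasDerivAt (fun x : ℝ => (x : ℂ) + y * Complex.I) 1 x := by
    simpa using! (Complex.ofRealCLM.hasDerivAt (x := x)).add_const (y * Complex.I)
  exact (hasFDerivAt_of_contDiffOn hG x hy).comp_hasDerivAt x hline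

theorem hasDerivAt_vertical (hG : ContDiffOn ℝ ∞ G {z : ℂ | 0 < z.im}) (x : ℝ) {y : ℝ}
    (hy : 0 < y) :
    HasDerivAt (fun y : ℝ => G (x + y * Complex.I)) (partialY G (x + y * Complex.I)) y := by
  have hline : HasDerivAt (fun y : ℝ => (x : ℂ) + y * Complex.I) Complex.I y := by
    simpa using! ((Complex.ofRealCLM.hasDerivAt (x := y)).mul_const Complex.I).const_add (x : ℂ)
  exact (hasFDerivAt_of_contDiffOn hG x hy).comp_hasDerivAt y hline

theorem continuous_horizontal (hG : ContDiffOn ℝ ∞ G {z : ℂ | 0 < z.im}) {y : ℝ} (hy : 0 < y) :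
    Continuous fun x : ℝ => G (x + y * Complex.I) :=
  continuous_iff_continuousAt.mpr fun x => (hasDerivAt_horizontal hG x hy).continuousAt

theorem continuous_e_mul_horizontal (hG : ContDiffOn ℝ ∞ G {z : ℂ | 0 < z.im}) (c : ℂ) {y : ℝ}
    (hy : 0 < y) : Continuous fun x : ℝ => e (c * x) * G (x + y * Complex.I) :=
  (continuous_e_mul c).mul (continuous_horizontal hG hy)

theorem exists_bound_e_mul (hG : ContDiffOn ℝ ∞ G {z : ℂ | 0 < z.im}) (c : ℂ) {a b : ℝ}
    (ha : 0 < a) : ∃ C : ℝ, ∀ x ∈ Set.Icc (0 : ℝ) 1, ∀ y ∈ Set.Icc a b,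
      ‖e (c * x) * G (x + y * Complex.I)‖ ≤ C := by
  have hcont : ContinuousOn (fun q : ℝ × ℝ => e (c * q.1) * G (q.1 + q.2 * Complex.I))
      (Set.Icc 0 1 ×ˢ Set.Icc a b) := by
    refine ((continuous_e_mul c).comp continuous_fst).continuousOn.mul
      (hG.continuousOn.comp (by fun_prop) fun q hq => ?_)
    simpa using ha.trans_le hq.2.1
  obtain ⟨C, hC⟩ := (isCompact_Icc.prod isCompact_Icc).exists_bound_of_continuousOn hcont
  exact ⟨C, fun x hx y hy => hC (x, y) ⟨hx, hy⟩⟩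

theorem hasDerivAt_fourierMode (hG : ContDiffOn ℝ ∞ G {z : ℂ | 0 < z.im}) (n : ℤ) {y : ℝ}
    (hy : 0 < y) : HasDerivAt (fourierMode n G) (fourierMode n (partialY G) y) y := by
  obtain ⟨C, hC⟩ := exists_bound_e_mul (contDiffOn_partialY hG) (-n) (b := 2 * y) (half_pos hy)
  refine (intervalIntegral.hasDerivAt_integral_of_dominated_loc_of_deriv_le
    (s := Set.Icc (y / 2) (2 * y)) (bound := fun _ => C)
    (F := fun (t : ℝ) (x : ℝ) => e (-n * x) * G (x + t * Complex.I))
    (F' := fun (t : ℝ) (x : ℝ) => e (-n * x) * partialY G (x + t * Complex.I))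
    (Icc_mem_nhds (half_lt_self hy) (lt_two_mul_self hy)) ?_ ?_ ?_ ?_ ?_ ?_).2
  · filter_upwards [lt_mem_nhds hy] with t ht
    exact (continuous_e_mul_horizontal hG _ ht).aestronglyMeasurable
  · exact (continuous_e_mul_horizontal hG _ hy).intervalIntegrable _ _
  · exact (continuous_e_mul_horizontal (contDiffOn_partialY hG) _ hy).aestronglyMeasurable
  · refine Filter.Eventually.of_forall fun x hx t ht => hC x ?_ t ht
    rw [Set.uIoc_of_le zero_le_one] at hx
    exact Set.Ioc_subset_Icc_self hx
  · exact _root_.intervalIntegrable_const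
  · refine Filter.Eventually.of_forall fun x _ t ht => ?_
    exact (hasDerivAt_vertical hG x ((half_pos hy).trans_le ht.1)).const_mul _

theorem fourierMode_partialX (hG : ContDiffOn ℝ ∞ G {z : ℂ | 0 < z.im})
    (hper : ∀ z : ℂ, 0 < z.im → G (z + 1) = G z) (n : ℤ) {y : ℝ} (hy : 0 < y) :
    fourierMode n (partialX G) y = 2 * Real.pi * Complex.I * n * fourierMode n G y := by
  have hend : e (-n * (1 : ℝ)) * G ((1 : ℝ) + y * Complex.I)
      - e (-n * (0 : ℝ)) * G ((0 : ℝ) + y * Complex.I) = 0 := by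
    rw [Complex.ofReal_one, Complex.ofReal_zero, mul_one, mul_zero, e_zero, e_neg, e_intCast,
      inv_one, zero_add, add_comm, hper _ (by simpa using hy), sub_self]
  have hparts := integral_mul_deriv_eq_deriv_mul (a := 0) (b := 1)
    (fun x _ => hasDerivAt_e_mul (-n) x) (fun x _ => hasDerivAt_horizontal hG x hy)
    ((continuous_const.mul (continuous_e_mul _)).intervalIntegrable _ _)
    ((continuous_horizontal (contDiffOn_partialX hG) hy).intervalIntegrable _ _)
  rw [fourierMode, hparts, hend, zero_sub, ← intervalIntegral.integral_neg, fourierMode,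
    ← intervalIntegral.integral_const_mul]
  congr 1
  funext x
  ring

theorem partialX_add_one (hper : ∀ z : ℂ, 0 < z.im → G (z + 1) = G z) (z : ℂ) (hz : 0 < z.im) :
    partialX G (z + 1) = partialX G z := by
  have hgerm : (fun w => G (w + 1)) =ᶠ[nhds z] G :=
    Filter.eventuallyEq_of_mem (isOpen_im_pos.mem_nhds hz) hper
  rw [partialX, partialX, ← fderiv_comp_add_right, hgerm.fderiv_eq]

theorem norm_fourierMode_le {y C : ℝ}
    (hC : ∀ x ∈ Set.Ioc (0 : ℝ) 1, ‖G (x + y * Complex.I)‖ ≤ C) (n : ℤ) :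
    ‖fourierMode n G y‖ ≤ C := by
  have hint := intervalIntegral.norm_integral_le_of_norm_le_const (a := 0) (b := 1) (C := C)
    (f := fun x : ℝ => e (-n * x) * G (x + y * Complex.I)) (fun x hx => by
      rw [Set.uIoc_of_le zero_le_one] at hx
      have hunit : ‖e (-n * x)‖ = 1 := by exact_mod_cast norm_e_ofReal (-n * x)
      rw [norm_mul, hunit, one_mul]
      exact hC x hx)
  rwa [sub_zero, abs_one, mul_one] at hint

theorem exists_bound_fourierMode (hG : ContDiffOn ℝ ∞ G {z : ℂ | 0 < z.im}) {y : ℝ} (hy : 0 < y) :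
    ∃ C : ℝ, ∀ n : ℤ, ‖fourierMode n G y‖ ≤ C := by
  obtain ⟨C, hC⟩ := (isCompact_Icc : IsCompact (Set.Icc (0 : ℝ) 1)).exists_bound_of_continuousOn
    (continuous_horizontal hG hy).continuousOn
  exact ⟨C, norm_fourierMode_le fun x hx => hC x (Set.Ioc_subset_Icc_self hx)⟩

theorem exists_sq_mul_norm_fourierMode_le (hG : ContDiffOn ℝ ∞ G {z : ℂ | 0 < z.im})
    (hper : ∀ z : ℂ, 0 < z.im → G (z + 1) = G z) {y : ℝ} (hy : 0 < y) :
    ∃ C : ℝ, ∀ n : ℤ, (n : ℝ) ^ 2 * ‖fourierMode n G y‖ ≤ C := by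
  obtain ⟨C, hC⟩ := exists_bound_fourierMode (contDiffOn_partialX (contDiffOn_partialX hG)) hy
  refine ⟨C, fun n => le_trans ?_ (hC n)⟩
  have hnorm : ‖(2 * Real.pi * Complex.I * n : ℂ)‖ = 2 * Real.pi * |(n : ℝ)| := by
    simp [abs_of_pos Real.pi_pos]
  rw [fourierMode_partialX (contDiffOn_partialX hG) (partialX_add_one hper) n hy,
    fourierMode_partialX hG hper n hy, norm_mul _ (_ * _), norm_mul _ (fourierMode n G y), hnorm,
    ← mul_assoc, ← sq_abs (n : ℝ), sq]
  have hpi : |(n : ℝ)| ≤ 2 * Real.pi * |(n : ℝ)| :=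
    le_mul_of_one_le_left (abs_nonneg _) (by linarith [Real.pi_gt_three])
  gcongr

theorem summable_fourierMode (hG : ContDiffOn ℝ ∞ G {z : ℂ | 0 < z.im})
    (hper : ∀ z : ℂ, 0 < z.im → G (z + 1) = G z) {y : ℝ} (hy : 0 < y) :
    Summable fun n : ℤ => fourierMode n G y := by
  obtain ⟨C, hC⟩ := exists_sq_mul_norm_fourierMode_le hG hper hy
  have hsummable := ((Real.summable_one_div_int_pow (p := 2)).mpr one_lt_two).mul_left C
  refine Summable.of_norm_bounded_eventually hsummable ?_
  filter_upwards [(Set.finite_singleton (0 : ℤ)).compl_mem_cofinite] with n hn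
  have hn_sq : 0 < (n : ℝ) ^ 2 := by
    have : (n : ℝ) ≠ 0 := Int.cast_ne_zero.mpr hn
    positivity
  rw [mul_one_div, le_div_iff₀ hn_sq, mul_comm]
  exact hC n

theorem fourierMode_eq_fourierCoeff {y : ℝ} {f : UnitAddCircle → ℂ}
    (hf : ∀ x : ℝ, f x = G (x + y * Complex.I)) (n : ℤ) :
    fourierMode n G y = fourierCoeff f n := by
  rw [fourierCoeff_eq_intervalIntegral _ n 0, fourierMode]
  simp only [zero_add, div_one, one_smul]
  refine intervalIntegral.integral_congr fun t _ => ?_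
  simp only [hf, fourier_coe_apply, smul_eq_mul, e]
  congr 2
  push_cast
  ring

theorem hasSum_fourierMode (hG : ContDiffOn ℝ ∞ G {z : ℂ | 0 < z.im})
    (hper : ∀ z : ℂ, 0 < z.im → G (z + 1) = G z) (x : ℝ) {y : ℝ} (hy : 0 < y) :
    HasSum (fun n : ℤ => fourierMode n G y * e (n * x)) (G (x + y * Complex.I)) := by
  have : Fact ((0 : ℝ) < 1) := ⟨one_pos⟩
  have hline : Function.Periodic (fun x : ℝ => G (x + y * Complex.I)) 1 := fun x => by
    beta_reduce
    rw [Complex.ofReal_add, Complex.ofReal_one, add_right_comm]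
    exact hper _ (by simpa using hy)
  let f : C(UnitAddCircle, ℂ) := ⟨hline.lift, (continuous_horizontal hG hy).quotient_lift _⟩
  have hcoeff (n : ℤ) : fourierMode n G y = fourierCoeff f n :=
    fourierMode_eq_fourierCoeff (fun _ => rfl) n
  have hsum : HasSum (fun n : ℤ => fourierCoeff f n • fourier n (x : UnitAddCircle))
      (G (x + y * Complex.I)) := has_pointwise_sum_fourier_series_of_summable
    ((summable_fourierMode hG hper hy).congr hcoeff) (x : UnitAddCircle)
  convert hsum using 2 with n
  rw [hcoeff, fourier_coe_apply, smul_eq_mul, e]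
  congr 2
  push_cast
  ring

end FourierMode

/-! ### The incomplete Gamma function -/

section IncGamma

open MeasureTheory Filter Topology

theorem continuousOn_incGamma_integrand (s : ℝ) :
    ContinuousOn (fun t : ℝ => Real.exp (-t) * t ^ (s - 1)) (Set.Ioi 0) :=
  (Real.continuous_exp.comp continuous_neg).continuousOn.mul
    (continuousOn_id.rpow_const fun _ hx => Or.inl (ne_of_gt hx))

theorem integrableOn_incGamma_integrand (s : ℝ) {y : ℝ} (hy : 0 < y) :
    IntegrableOn (fun t : ℝ => Real.exp (-t) * t ^ (s - 1)) (Set.Ioi y) :=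
  integrable_of_isBigO_exp_neg one_half_pos
    ((continuousOn_incGamma_integrand s).mono fun _ hx => lt_of_lt_of_le hy hx)
    (Real.Gamma_integrand_isLittleO (s - 1)).isBigO

theorem incGamma_eq_sub (s : ℝ) {y u : ℝ} (hy : 0 < y) (hu : 0 < u) :
    incGamma s u = incGamma s y - ∫ t in y..u, Real.exp (-t) * t ^ (s - 1) := by
  rw [incGamma, incGamma, eq_sub_iff_add_eq, add_comm]
  exact intervalIntegral.integral_interval_add_Ioi (integrableOn_incGamma_integrand s hy)
    (integrableOn_incGamma_integrand s hu)

theorem hasDerivAt_incGamma (s : ℝ) {y : ℝ} (hy : 0 < y) :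
    HasDerivAt (incGamma s) (-(Real.exp (-y) * y ^ (s - 1))) y := by
  have hint := intervalIntegral.integral_hasDerivAt_right (a := y) (b := y)
    (f := fun t : ℝ => Real.exp (-t) * t ^ (s - 1)) (by simp)
    ((continuousOn_incGamma_integrand s).stronglyMeasurableAtFilter isOpen_Ioi _ hy)
    ((continuousOn_incGamma_integrand s).continuousAt (Ioi_mem_nhds hy))
  refine (hint.const_sub (incGamma s y)).congr_of_eventuallyEq ?_
  filter_upwards [lt_mem_nhds hy] with u hu using incGamma_eq_sub s hy hu

theorem tendsto_incGamma_atTop (s : ℝ) : Tendsto (incGamma s) atTop (𝓝 0) := by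
  have hint := intervalIntegral_tendsto_integral_Ioi 1 (integrableOn_incGamma_integrand s one_pos)
    tendsto_id
  have hlim : Tendsto (fun u => incGamma s 1 - ∫ t in (1 : ℝ)..u, Real.exp (-t) * t ^ (s - 1))
      atTop (𝓝 0) := sub_self (incGamma s 1) ▸ hint.const_sub (incGamma s 1)
  refine hlim.congr' ?_
  filter_upwards [eventually_gt_atTop 0] with u hu using (incGamma_eq_sub s one_pos hu).symm

end IncGamma

/-! ### The differential equation of the Fourier modes -/

section ModeODE

open Filter Topology

theorem exists_eq_const_of_hasDerivAt_zero {f : ℝ → ℂ} (hf : ∀ y, 0 < y → HasDerivAt f 0 y) :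
    ∃ b : ℂ, ∀ y, 0 < y → f y = b :=
  isOpen_Ioi.exists_is_const_of_deriv_eq_zero isPreconnected_Ioi
    (fun y hy => (hf y hy).differentiableAt.differentiableWithinAt) fun y hy => (hf y hy).deriv

theorem hasDerivAt_cexp_ofReal_mul (c y : ℝ) :
    HasDerivAt (fun y : ℝ => Complex.exp ((c * y : ℝ))) (c * Complex.exp ((c * y : ℝ))) y := by
  refine ((hasDerivAt_id y).const_mul c).ofReal_comp.cexp.congr_deriv ?_
  rw [mul_one, mul_comm]
  rfl

/-- The ordinary differential equation on `0 < y` which `Δ_k f = 0` becomes for the `n`-th Fourier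
mode `a` of `f`, on which `∂_x` acts as `2 π i n`; `a'` and `a''` are the derivatives of `a`. -/
structure IsHarmonicMode (n k : ℤ) (a a' a'' : ℝ → ℂ) : Prop where
  hasDerivAt : ∀ y, 0 < y → HasDerivAt a (a' y) y
  hasDerivAt_deriv : ∀ y, 0 < y → HasDerivAt a' (a'' y) y
  ode : ∀ y : ℝ, 0 < y → -(y : ℂ) ^ 2 * ((2 * Real.pi * Complex.I * n) ^ 2 * a y + a'' y)
    + Complex.I * k * y * (2 * Real.pi * Complex.I * n * a y + Complex.I * a' y) = 0

namespace IsHarmonicMode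

variable {n k : ℤ} {a a' a'' : ℝ → ℂ}

-- Up to the factor `y`, the operator factors as `(y ∂_y + k - 2 π n y) (∂_y + 2 π n)`.
theorem ode_factored (h : IsHarmonicMode n k a a' a'') {y : ℝ} (hy : 0 < y) :
    y * (a'' y + 2 * Real.pi * n * a' y)
      + (k - 2 * Real.pi * n * y) * (a' y + 2 * Real.pi * n * a y) = 0 := by
  refine (mul_eq_zero.mp ?_).resolve_left (Complex.ofReal_ne_zero.mpr hy.ne')
  linear_combination -h.ode y hy - (4 * Real.pi ^ 2 * n ^ 2 * y ^ 2 * a y - k * y * a' y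
    - 2 * Real.pi * n * k * y * a y) * Complex.I_sq

theorem hasDerivAt_cexp_neg_mul_zpow_mul (h : IsHarmonicMode n k a a' a'') {y : ℝ} (hy : 0 < y) :
    HasDerivAt (fun y : ℝ => Complex.exp ((-(2 * Real.pi * n) * y : ℝ)) * (y : ℂ) ^ k
      * (a' y + 2 * Real.pi * n * a y)) 0 y := by
  have hy₀ : (y : ℂ) ≠ 0 := Complex.ofReal_ne_zero.mpr hy.ne'
  have hzpow : HasDerivAt (fun y : ℝ => (y : ℂ) ^ k) (k * (y : ℂ) ^ (k - 1)) y :=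
    (hasDerivAt_zpow k (y : ℂ) (Or.inl hy₀)).comp_ofReal
  refine (((hasDerivAt_cexp_ofReal_mul (-(2 * Real.pi * n)) y).mul hzpow).mul
    ((h.hasDerivAt_deriv y hy).add
      ((h.hasDerivAt y hy).const_mul (2 * Real.pi * n : ℂ)))).congr_deriv ?_
  have hpow : (y : ℂ) ^ k = (y : ℂ) ^ (k - 1) * y := by rw [← zpow_add_one₀ hy₀, sub_add_cancel]
  simp only [Pi.add_apply, Pi.mul_apply, hpow]
  push_cast
  linear_combination
    (Complex.exp (-(2 * Real.pi * n) * y) * (y : ℂ) ^ (k - 1)) * h.ode_factored hy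

theorem exists_hasDerivAt_cexp_mul (h : IsHarmonicMode n k a a' a'') :
    ∃ C : ℂ, ∀ y : ℝ, 0 < y →
      HasDerivAt (fun y : ℝ => Complex.exp ((2 * Real.pi * n * y : ℝ)) * a y)
        (C * ((Real.exp (2 * (2 * Real.pi * n) * y) * y ^ (-k) : ℝ) : ℂ)) y := by
  obtain ⟨C, hC⟩ := exists_eq_const_of_hasDerivAt_zero
    fun y hy => h.hasDerivAt_cexp_neg_mul_zpow_mul hy
  refine ⟨C, fun y hy => ?_⟩
  refine ((hasDerivAt_cexp_ofReal_mul (2 * Real.pi * n) y).mul (h.hasDerivAt y hy)).congr_deriv ?_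
  have hexp : (Real.exp (2 * (2 * Real.pi * n) * y) : ℂ)
      = Complex.exp ((2 * Real.pi * n * y : ℝ)) ^ 2 := by
    rw [← Complex.exp_nat_mul, Complex.ofReal_exp]
    congr 1
    push_cast
    ring
  have hexp_neg : Complex.exp ((-(2 * Real.pi * n) * y : ℝ))
      = (Complex.exp ((2 * Real.pi * n * y : ℝ)))⁻¹ := by
    rw [← Complex.exp_neg, ← Complex.ofReal_neg, neg_mul]
  have hexp_ne := Complex.exp_ne_zero ((2 * Real.pi * n * y : ℝ) : ℂ)
  have hzpow_ne : (y : ℂ) ^ k ≠ 0 := zpow_ne_zero _ (Complex.ofReal_ne_zero.mpr hy.ne')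
  rw [← hC y hy, Complex.ofReal_mul (Real.exp _), Complex.ofReal_zpow, zpow_neg, hexp, hexp_neg]
  field_simp
  push_cast
  ring

end IsHarmonicMode

theorem mul_le_norm_sub_of_hasDerivAt {A : ℝ → ℂ} {C : ℂ} {g : ℝ → ℝ} {m a b : ℝ} (hab : a ≤ b)
    (hA : ∀ t ∈ Set.Icc a b, HasDerivAt A (C * (g t : ℂ)) t) (hm : ∀ t ∈ Set.Icc a b, m ≤ g t) :
    ‖C‖ * (m * (b - a)) ≤ ‖A b - A a‖ := by
  rcases eq_or_ne C 0 with rfl | hC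
  · simp
  have hderiv (t : ℝ) (ht : t ∈ Set.Icc a b) : HasDerivAt (fun t => (A t / C).re) (g t) t := by
    have hdiv := (hA t ht).div_const C
    rw [mul_div_cancel_left₀ _ hC] at hdiv
    exact (Complex.reCLM.hasFDerivAt.comp_hasDerivAt t hdiv).congr_deriv (Complex.ofReal_re _)
  have hinterior {t : ℝ} (ht : t ∈ interior (Set.Icc a b)) : t ∈ Set.Icc a b := interior_subset ht
  have hmean : m * (b - a) ≤ (A b / C).re - (A a / C).re :=
    (convex_Icc a b).mul_sub_le_image_sub_of_le_deriv
      (fun t ht => (hderiv t ht).continuousAt.continuousWithinAt)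
      (fun t ht => (hderiv t (hinterior ht)).differentiableAt.differentiableWithinAt)
      (fun t ht => (hderiv t (hinterior ht)).deriv ▸ hm t (hinterior ht))
      a (Set.left_mem_Icc.mpr hab) b (Set.right_mem_Icc.mpr hab) hab
  rw [← Complex.sub_re, ← sub_div] at hmean
  rw [mul_comm, ← le_div_iff₀ (norm_pos_iff.mpr hC), ← norm_div]
  exact hmean.trans (Complex.re_le_norm _)

theorem exp_mul_inv_pow_le {d y t : ℝ} (hd : 0 ≤ d) (hy : 1 ≤ y) (ht : t ∈ Set.Icc y (y + 1))
    (k : ℤ) :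
    Real.exp (d * y) * ((y + 1) ^ k.natAbs)⁻¹ ≤ Real.exp (2 * d * t) * t ^ (-k) := by
  have ht₁ : 1 ≤ t := hy.trans ht.1
  have hzpow : t ^ k ≤ (y + 1) ^ k.natAbs :=
    calc t ^ k ≤ t ^ (k.natAbs : ℤ) := zpow_le_zpow_right₀ ht₁ Int.le_natAbs
      _ = t ^ k.natAbs := zpow_natCast _ _
      _ ≤ (y + 1) ^ k.natAbs := pow_le_pow_left₀ (by positivity) ht.2 _
  rw [zpow_neg]
  refine mul_le_mul (Real.exp_le_exp.mpr ?_) (inv_anti₀ (by positivity) hzpow) (by positivity)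
    (Real.exp_pos _).le
  nlinarith [mul_le_mul_of_nonneg_left ht.1 hd, mul_nonneg hd (zero_le_one.trans ht₁)]

theorem tendsto_exp_neg_mul_mul_add_one_pow {ε : ℝ} (hε : 0 < ε) (m : ℕ) :
    Tendsto (fun y : ℝ => Real.exp (-ε * y) * (y + 1) ^ m) atTop (𝓝 0) := by
  have hlim := ((Real.tendsto_pow_mul_exp_neg_atTop_nhds_zero m).comp
    ((tendsto_atTop_add_const_right atTop 1 tendsto_id).const_mul_atTop hε)).const_mul
      ((ε ^ m)⁻¹ * Real.exp ε)
  rw [mul_zero] at hlim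
  refine hlim.congr fun y => ?_
  simp only [Function.comp_apply, id_eq]
  rw [mul_pow, show -(ε * (y + 1)) = -ε * y + -ε by ring, Real.exp_add, Real.exp_neg ε]
  have := Real.exp_pos ε
  field_simp

theorem norm_sub_le_of_norm_sub_const_le {A : ℝ → ℂ} {c : ℂ} {K Y d ε : ℝ} (hε : 0 ≤ ε)
    (hA : ∀ y, Y ≤ y → ‖A y - c‖ ≤ K * Real.exp ((d - ε) * y)) {y : ℝ} (hy : Y ≤ y) :
    ‖A (y + 1) - A y‖ ≤ K * (1 + Real.exp d) * Real.exp ((d - ε) * y) := by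
  have hK : 0 ≤ K := nonneg_of_mul_nonneg_left ((norm_nonneg _).trans (hA y hy)) (Real.exp_pos _)
  have hexp : Real.exp ((d - ε) * (y + 1)) ≤ Real.exp d * Real.exp ((d - ε) * y) := by
    rw [← Real.exp_add, Real.exp_le_exp]
    linarith
  calc ‖A (y + 1) - A y‖ = ‖(A (y + 1) - c) - (A y - c)‖ := by rw [sub_sub_sub_cancel_right]
    _ ≤ ‖A (y + 1) - c‖ + ‖A y - c‖ := norm_sub_le _ _
    _ ≤ K * (Real.exp d * Real.exp ((d - ε) * y)) + K * Real.exp ((d - ε) * y) :=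
      add_le_add ((hA _ (by linarith)).trans (mul_le_mul_of_nonneg_left hexp hK)) (hA y hy)
    _ = K * (1 + Real.exp d) * Real.exp ((d - ε) * y) := by ring

-- The increment of `A` over `[y, y + 1]` is at least of order `e ^ (d y)` up to powers of `y`.
theorem eq_zero_of_hasDerivAt_of_norm_sub_le {d ε : ℝ} (hd : 0 ≤ d) (hε : 0 < ε) {k : ℤ}
    {A : ℝ → ℂ} {C c : ℂ} {K Y : ℝ}
    (hA : ∀ y, 0 < y → HasDerivAt A (C * ((Real.exp (2 * d * y) * y ^ (-k) : ℝ) : ℂ)) y)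
    (hbound : ∀ y, Y ≤ y → ‖A y - c‖ ≤ K * Real.exp ((d - ε) * y)) : C = 0 := by
  have hC_le (y : ℝ) (hy : max 1 Y ≤ y) :
      ‖C‖ ≤ K * (1 + Real.exp d) * (Real.exp (-ε * y) * (y + 1) ^ k.natAbs) := by
    obtain ⟨hy₁, hyY⟩ := max_le_iff.mp hy
    have hincrement := mul_le_norm_sub_of_hasDerivAt (le_add_of_nonneg_right zero_le_one)
      (fun t ht => hA t (one_pos.trans_le (hy₁.trans ht.1)))
      (fun t ht => exp_mul_inv_pow_le hd hy₁ ht k)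
    rw [add_sub_cancel_left, mul_one] at hincrement
    have hle := hincrement.trans (norm_sub_le_of_norm_sub_const_le hε.le hbound hyY)
    have hexp : Real.exp ((d - ε) * y) = Real.exp (d * y) * Real.exp (-ε * y) := by
      rw [← Real.exp_add, ← add_mul, sub_eq_add_neg]
    rw [← le_div_iff₀ (by positivity), hexp] at hle
    refine hle.trans_eq ?_
    field_simp
  have hlim := (tendsto_exp_neg_mul_mul_add_one_pow hε k.natAbs).const_mul (K * (1 + Real.exp d))
  rw [mul_zero] at hlim
  exact norm_le_zero_iff.mp (ge_of_tendsto hlim ((eventually_ge_atTop (max 1 Y)).mono hC_le))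

theorem hasDerivAt_incGamma_const_mul {d y : ℝ} (hd : 0 < d) (hy : 0 < y) (k : ℤ) :
    HasDerivAt (fun y : ℝ => incGamma (1 - k) (d * y))
      (-(d ^ (1 - k) * (Real.exp (-d * y) * y ^ (-k)))) y := by
  refine ((hasDerivAt_incGamma (1 - k) (mul_pos hd hy)).comp y
    ((hasDerivAt_id y).const_mul d)).congr_deriv ?_
  have hexponent : (1 - (k : ℝ) - 1) = ((-k : ℤ) : ℝ) := by push_cast; ring
  rw [hexponent, Real.rpow_intCast, mul_zpow, ← neg_mul d, show (1 - k) = -k + 1 by ring,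
    zpow_add_one₀ hd.ne']
  ring

theorem exists_eq_add_mul_incGamma {d : ℝ} (hd : 0 < d) {k : ℤ} {A : ℝ → ℂ} {C c : ℂ}
    (hA : ∀ y, 0 < y → HasDerivAt A (C * ((Real.exp (-d * y) * y ^ (-k) : ℝ) : ℂ)) y)
    (hlim : Tendsto A atTop (𝓝 c)) :
    ∃ cm : ℂ, ∀ y, 0 < y → A y = c + cm * (incGamma (1 - k) (d * y) : ℂ) := by
  have hcancel : ((d ^ (k - 1) : ℝ) : ℂ) * ((d ^ (1 - k) : ℝ) : ℂ) = 1 := by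
    rw [← Complex.ofReal_mul, ← zpow_add₀ hd.ne']
    simp
  obtain ⟨b, hb⟩ := exists_eq_const_of_hasDerivAt_zero
    (f := fun y => A y - -C * ((d ^ (k - 1) : ℝ) : ℂ) * (incGamma (1 - k) (d * y) : ℂ))
    fun y hy => by
      refine ((hA y hy).sub
        ((hasDerivAt_incGamma_const_mul hd hy k).ofReal_comp.const_mul _)).congr_deriv ?_
      rw [Complex.ofReal_neg, Complex.ofReal_mul (d ^ (1 - k))]
      linear_combination (-C * ((Real.exp (-d * y) * y ^ (-k) : ℝ) : ℂ)) * hcancel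
  have hincGamma : Tendsto (fun y : ℝ => (incGamma (1 - k) (d * y) : ℂ)) atTop (𝓝 0) := by
    have hreal := (tendsto_incGamma_atTop (1 - k)).comp (tendsto_id.const_mul_atTop hd)
    exact_mod_cast (Complex.continuous_ofReal.tendsto 0).comp hreal
  have hbc : b = c := by
    have hdiff := hlim.sub (hincGamma.const_mul (-C * ((d ^ (k - 1) : ℝ) : ℂ)))
    rw [mul_zero, sub_zero] at hdiff
    refine tendsto_nhds_unique (tendsto_const_nhds.congr' ?_) hdiff
    filter_upwards [eventually_gt_atTop 0] with y hy using (hb y hy).symm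
  exact ⟨_, fun y hy => sub_eq_iff_eq_add.mp ((hb y hy).trans hbc)⟩

theorem norm_cexp_mul_sub_le {a c : ℂ} {d y ε K : ℝ}
    (h : ‖a - c * Complex.exp ((-(d * y) : ℝ))‖ ≤ K * Real.exp (-ε * y)) :
    ‖Complex.exp ((d * y : ℝ)) * a - c‖ ≤ K * Real.exp ((d - ε) * y) := by
  have hcancel : Complex.exp ((d * y : ℝ)) * Complex.exp ((-(d * y) : ℝ)) = 1 := by
    rw [← Complex.exp_add, ← Complex.ofReal_add, add_neg_cancel, Complex.ofReal_zero,
      Complex.exp_zero]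
  have hfactor : Complex.exp ((d * y : ℝ)) * a - c
      = Complex.exp ((d * y : ℝ)) * (a - c * Complex.exp ((-(d * y) : ℝ))) := by
    linear_combination c * hcancel
  rw [hfactor, norm_mul, ← Complex.ofReal_exp, Complex.norm_real,
    Real.norm_of_nonneg (Real.exp_pos _).le,
    show (d - ε) * y = d * y + -ε * y by ring, Real.exp_add, mul_left_comm]
  exact mul_le_mul_of_nonneg_left h (Real.exp_pos _).le

theorem tendsto_of_norm_sub_le_exp {A : ℝ → ℂ} {c : ℂ} {K Y d : ℝ} (hd : d < 0)
    (hbound : ∀ y, Y ≤ y → ‖A y - c‖ ≤ K * Real.exp (d * y)) : Tendsto A atTop (𝓝 c) := by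
  have hexp := (Real.tendsto_exp_atBot.comp (tendsto_id.const_mul_atTop_of_neg hd)).const_mul K
  rw [mul_zero] at hexp
  exact tendsto_iff_norm_sub_tendsto_zero.mpr (squeeze_zero'
    (Eventually.of_forall fun _ => norm_nonneg _) ((eventually_ge_atTop Y).mono hbound) hexp)

namespace IsHarmonicMode

variable {n k : ℤ} {a a' a'' : ℝ → ℂ} {c : ℂ} {K Y ε : ℝ}

theorem exists_eq_const_mul_cexp (h : IsHarmonicMode n k a a' a'') (hn : 0 ≤ n) (hε : 0 < ε)
    (hbound : ∀ y, Y ≤ y →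
      ‖a y - c * Complex.exp ((-(2 * Real.pi * n * y) : ℝ))‖ ≤ K * Real.exp (-ε * y)) :
    ∃ b : ℂ, ∀ y : ℝ, 0 < y → Complex.exp ((2 * Real.pi * n * y : ℝ)) * a y = b := by
  obtain ⟨C, hC⟩ := h.exists_hasDerivAt_cexp_mul
  have hd : (0 : ℝ) ≤ 2 * Real.pi * n := by positivity
  have hC₀ : C = 0 := eq_zero_of_hasDerivAt_of_norm_sub_le hd hε hC
    fun y hy => norm_cexp_mul_sub_le (hbound y hy)
  exact exists_eq_const_of_hasDerivAt_zero fun y hy => (hC y hy).congr_deriv (by rw [hC₀, zero_mul])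

theorem exists_eq_add_mul_incGamma (h : IsHarmonicMode n k a a' a'') (hn : n < 0) (hε : 0 < ε)
    (hbound : ∀ y, Y ≤ y →
      ‖a y - c * Complex.exp ((-(2 * Real.pi * n * y) : ℝ))‖ ≤ K * Real.exp (-ε * y)) :
    ∃ cm : ℂ, ∀ y : ℝ, 0 < y → Complex.exp ((2 * Real.pi * n * y : ℝ)) * a y
      = c + cm * (incGamma (1 - k) (4 * Real.pi * |(n : ℝ)| * y) : ℂ) := by
  have hn' : (n : ℝ) < 0 := by exact_mod_cast hn
  have hd : 0 < 4 * Real.pi * |(n : ℝ)| := mul_pos (by positivity) (abs_pos.mpr hn'.ne)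
  have hd_neg : 2 * (2 * Real.pi * n) = -(4 * Real.pi * |(n : ℝ)|) := by
    rw [abs_of_neg hn']
    ring
  obtain ⟨C, hC⟩ := h.exists_hasDerivAt_cexp_mul
  rw [hd_neg] at hC
  exact MaassLift.exists_eq_add_mul_incGamma hd hC (tendsto_of_norm_sub_le_exp (by nlinarith)
    fun y hy => norm_cexp_mul_sub_le (hbound y hy))

theorem exists_coeffs (h : IsHarmonicMode n k a a' a'') (hε : 0 < ε)
    (hbound : ∀ y, Y ≤ y →
      ‖a y - c * Complex.exp ((-(2 * Real.pi * n * y) : ℝ))‖ ≤ K * Real.exp (-ε * y)) :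
    ∃ cp cm : ℂ, (0 ≤ n → cm = 0) ∧ (n < 0 → c = 0 → cp = 0) ∧
      ((∀ y, 0 < y → a y = 0) → cp = 0 ∧ cm = 0) ∧
      ∀ y : ℝ, 0 < y → a y = (cp + cm * (incGamma (1 - k) (4 * Real.pi * |(n : ℝ)| * y) : ℂ))
        * Complex.exp ((-(2 * Real.pi * n * y) : ℝ)) := by
  by_cases hzero : ∀ y, 0 < y → a y = 0
  · exact ⟨0, 0, fun _ => rfl, fun _ _ => rfl, fun _ => ⟨rfl, rfl⟩,
      fun y hy => by simp [hzero y hy]⟩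
  have hdiv {y : ℝ} {w : ℂ} (hw : Complex.exp ((2 * Real.pi * n * y : ℝ)) * a y = w) :
      a y = w * Complex.exp ((-(2 * Real.pi * n * y) : ℝ)) := by
    rw [← hw, mul_right_comm, ← Complex.exp_add, ← Complex.ofReal_add, add_neg_cancel,
      Complex.ofReal_zero, Complex.exp_zero, one_mul]
  rcases le_or_gt 0 n with hn | hn
  · obtain ⟨b, hb⟩ := h.exists_eq_const_mul_cexp hn hε hbound
    exact ⟨b, 0, fun _ => rfl, fun hneg => absurd hn hneg.not_ge, fun h => absurd h hzero,
      fun y hy => by rw [hdiv (hb y hy), zero_mul, add_zero]⟩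
  · obtain ⟨cm, hcm⟩ := h.exists_eq_add_mul_incGamma hn hε hbound
    exact ⟨c, cm, fun hnonneg => absurd hn hnonneg.not_gt, fun _ hc => hc,
      fun h => absurd h hzero, fun y hy => hdiv (hcm y hy)⟩

end IsHarmonicMode

end ModeODE

/-! ### Fourier expansions of harmonic weak Maass forms -/

section FourierExpansion

open Filter Topology MeasureTheory

section Linearity

variable {F G : ℂ → ℂ} {y : ℝ}

theorem fourierMode_congr (h : ∀ x : ℝ, F (x + y * Complex.I) = G (x + y * Complex.I)) (n : ℤ) :
    fourierMode n F y = fourierMode n G y := by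
  simp only [fourierMode, h]

theorem fourierMode_const_mul (c : ℂ) (G : ℂ → ℂ) (n : ℤ) (y : ℝ) :
    fourierMode n (fun z => c * G z) y = c * fourierMode n G y := by
  simp only [fourierMode, mul_left_comm _ c, intervalIntegral.integral_const_mul]

theorem intervalIntegrable_e_mul (hG : Continuous fun x : ℝ => G (x + y * Complex.I)) (n : ℤ) :
    IntervalIntegrable (fun x : ℝ => e (-n * x) * G (x + y * Complex.I)) volume 0 1 :=
  ((continuous_e_mul _).mul hG).intervalIntegrable _ _

theorem fourierMode_add (hF : Continuous fun x : ℝ => F (x + y * Complex.I))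
    (hG : Continuous fun x : ℝ => G (x + y * Complex.I)) (n : ℤ) :
    fourierMode n (fun z => F z + G z) y = fourierMode n F y + fourierMode n G y := by
  simp only [fourierMode, mul_add]
  exact intervalIntegral.integral_add (intervalIntegrable_e_mul hF n)
    (intervalIntegrable_e_mul hG n)

theorem fourierMode_sub (hF : Continuous fun x : ℝ => F (x + y * Complex.I))
    (hG : Continuous fun x : ℝ => G (x + y * Complex.I)) (n : ℤ) :
    fourierMode n (fun z => F z - G z) y = fourierMode n F y - fourierMode n G y := by
  simp only [fourierMode, mul_sub]
  exact intervalIntegral.integral_sub (intervalIntegrable_e_mul hF n)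
    (intervalIntegrable_e_mul hG n)

theorem fourierMode_finsetSum {ι : Type*} (s : Finset ι) {G : ι → ℂ → ℂ}
    (hG : ∀ i ∈ s, Continuous fun x : ℝ => G i (x + y * Complex.I)) (n : ℤ) :
    fourierMode n (fun z => ∑ i ∈ s, G i z) y = ∑ i ∈ s, fourierMode n (G i) y := by
  simp only [fourierMode, Finset.mul_sum]
  exact intervalIntegral.integral_finsetSum fun i hi => intervalIntegrable_e_mul (hG i hi) n

end Linearity

theorem contDiff_e_mul (c : ℂ) : ContDiff ℝ ∞ fun z : ℂ => e (c * z) := by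
  unfold e
  fun_prop

theorem partialX_e_mul (c z : ℂ) :
    partialX (fun z : ℂ => e (c * z)) z = 2 * Real.pi * Complex.I * c * e (c * z) := by
  have hderiv :
      HasDerivAt (fun z : ℂ => e (c * z)) (2 * Real.pi * Complex.I * c * e (c * z)) z := by
    refine ((((hasDerivAt_id z).const_mul c).const_mul
      (2 * Real.pi * Complex.I)).cexp).congr_deriv ?_
    simp only [e, id_eq]
    ring
  rw [partialX, (hderiv.hasFDerivAt.restrictScalars ℝ).fderiv]
  simp

theorem fourierMode_e_self (n : ℤ) (y : ℝ) :
    fourierMode n (fun z => e (n * z)) y = Complex.exp ((-(2 * Real.pi * n * y) : ℝ)) := by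
  have hconst (x : ℝ) : e (-n * x) * e (n * (x + y * Complex.I))
      = Complex.exp ((-(2 * Real.pi * n * y) : ℝ)) := by
    rw [← e_add, e]
    congr 1
    push_cast
    linear_combination (2 * Real.pi * n * y : ℂ) * Complex.I_sq
  simp only [fourierMode, hconst, intervalIntegral.integral_const, sub_zero, one_smul]

theorem fourierMode_e_of_ne {n m : ℤ} (hmn : m ≠ n) {y : ℝ} (hy : 0 < y) :
    fourierMode n (fun z => e (m * z)) y = 0 := by
  have hper (z : ℂ) (_ : 0 < z.im) : e ((m : ℂ) * (z + 1)) = e (m * z) := by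
    rw [mul_add, mul_one, e_add, e_intCast, mul_one]
  have heigen := fourierMode_partialX (contDiff_e_mul m).contDiffOn hper n hy
  rw [funext (partialX_e_mul m), fourierMode_const_mul] at heigen
  have hprod :
      (2 * Real.pi * Complex.I : ℂ) * (m - n) * fourierMode n (fun z => e (m * z)) y = 0 := by
    linear_combination heigen
  exact (mul_eq_zero.mp hprod).resolve_left
    (mul_ne_zero Complex.two_pi_I_ne_zero (sub_ne_zero.mpr (Int.cast_injective.ne hmn)))

theorem fourierMode_principalPart {c : ℝ →₀ ℂ}
    (hc : ∀ m ∈ c.support, m ∈ Set.range fun n : ℤ => (n : ℝ)) (n : ℤ) {y : ℝ} (hy : 0 < y) :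
    fourierMode n (fun z => c.sum fun m a => a * e (m * z)) y
      = c n * Complex.exp ((-(2 * Real.pi * n * y) : ℝ)) := by
  simp only [Finsupp.sum]
  rw [fourierMode_finsetSum _ fun m _ => by unfold e; fun_prop]
  simp only [fourierMode_const_mul]
  rw [Finset.sum_eq_single (n : ℝ), Complex.ofReal_intCast, fourierMode_e_self]
  · intro m hm hmn
    obtain ⟨j, rfl⟩ := hc m hm
    rw [Complex.ofReal_intCast, fourierMode_e_of_ne (fun hj => hmn (congrArg _ hj)) hy, mul_zero]
  · intro hn
    rw [Finsupp.notMem_support_iff.mp hn, zero_mul]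

theorem coe_eq_re_add_im (τ : ℍ) : (τ : ℂ) = (τ.re : ℂ) + τ.im * Complex.I :=
  (Complex.re_add_im (τ : ℂ)).symm

theorem comp_ofComplex_add_one {f : ℍ → ℂ} (hper : ∀ τ : ℍ, f ((1 : ℝ) +ᵥ τ) = f τ) (z : ℂ)
    (hz : 0 < z.im) : (f ∘ ofComplex) (z + 1) = (f ∘ ofComplex) z := by
  have htranslate : ofComplex (z + 1) = (1 : ℝ) +ᵥ ofComplex z := by
    rw [ofComplex_apply_of_im_pos hz, ofComplex_apply_of_im_pos (by simpa using hz)]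
    ext1
    rw [coe_vadd]
    simp [add_comm]
  rw [Function.comp_apply, Function.comp_apply, htranslate, hper]

section Harmonic

variable {k : ℤ} {f : ℍ → ℂ}

theorem laplace_horizontal (hΔ : ∀ τ, laplace k f τ = 0) (x : ℝ) {y : ℝ} (hy : 0 < y) :
    -(y : ℂ) ^ 2 * (partialX (partialX (f ∘ ofComplex)) (x + y * Complex.I)
        + partialY (partialY (f ∘ ofComplex)) (x + y * Complex.I))
      + Complex.I * k * y * (partialX (f ∘ ofComplex) (x + y * Complex.I)
        + Complex.I * partialY (f ∘ ofComplex) (x + y * Complex.I)) = 0 := by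
  have him : ((x : ℂ) + y * Complex.I).im = y := by simp
  have hpos : 0 < ((x : ℂ) + y * Complex.I).im := him.symm ▸ hy
  have hlaplace := hΔ ⟨x + y * Complex.I, hpos⟩
  have hτ : UpperHalfPlane.im ⟨x + y * Complex.I, hpos⟩ = y := him
  rwa [laplace, hτ] at hlaplace

theorem isHarmonicMode_fourierMode (hs : IsSmooth f) (hper : ∀ τ : ℍ, f ((1 : ℝ) +ᵥ τ) = f τ)
    (hΔ : ∀ τ, laplace k f τ = 0) (n : ℤ) :
    IsHarmonicMode n k (fourierMode n (f ∘ ofComplex)) (fourierMode n (partialY (f ∘ ofComplex)))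
      (fourierMode n (partialY (partialY (f ∘ ofComplex)))) := by
  set F : ℂ → ℂ := f ∘ ofComplex
  have hs : ContDiffOn ℝ ∞ F {z : ℂ | 0 < z.im} := hs
  have hX := contDiffOn_partialX hs
  have hY := contDiffOn_partialY hs
  refine ⟨fun y => hasDerivAt_fourierMode hs n, fun y => hasDerivAt_fourierMode hY n,
    fun y hy => ?_⟩
  have hcont {G : ℂ → ℂ} (hG : ContDiffOn ℝ ∞ G {z : ℂ | 0 < z.im}) (d : ℂ) :
      Continuous fun x : ℝ => d * G (x + y * Complex.I) :=
    continuous_const.mul (continuous_horizontal hG hy)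
  have hmode : fourierMode n (fun z =>
      (-(y : ℂ) ^ 2 * partialX (partialX F) z + -(y : ℂ) ^ 2 * partialY (partialY F) z)
      + (Complex.I * k * y * partialX F z + Complex.I * k * y * Complex.I * partialY F z)) y
      = fourierMode n (fun _ => 0) y :=
    fourierMode_congr (fun x => by linear_combination laplace_horizontal hΔ x hy) n
  rw [fourierMode_add ((hcont (contDiffOn_partialX hX) _).add (hcont (contDiffOn_partialY hY) _))
      ((hcont hX _).add (hcont hY _)),
    fourierMode_add (hcont (contDiffOn_partialX hX) _) (hcont (contDiffOn_partialY hY) _),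
    fourierMode_add (hcont hX _) (hcont hY _)] at hmode
  have hperF := comp_ofComplex_add_one hper
  simp only [fourierMode_const_mul, fourierMode_partialX hX (partialX_add_one hperF) n hy,
    fourierMode_partialX hs hperF n hy] at hmode
  have hzero : fourierMode n (fun _ => 0) y = 0 := by simp [fourierMode]
  linear_combination hmode + hzero

theorem exists_norm_fourierMode_sub_le (hs : IsSmooth f)
    (hpp : HasPrincipalPart (Set.range fun n : ℤ => (n : ℝ)) f) :
    ∃ (c : ℝ →₀ ℂ) (ε K Y : ℝ), 0 < ε ∧ ∀ (n : ℤ) (y : ℝ), Y ≤ y →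
      ‖fourierMode n (f ∘ ofComplex) y - c n * Complex.exp ((-(2 * Real.pi * n * y) : ℝ))‖
        ≤ K * Real.exp (-ε * y) := by
  obtain ⟨c, hc, ε, hε, hO⟩ := hpp
  obtain ⟨K, hK⟩ := hO.bound
  obtain ⟨Y, hY⟩ := (atImInfty_mem _).mp hK
  refine ⟨c, ε, K, max Y 1, hε, fun n y hy => ?_⟩
  have hy₀ : 0 < y := one_pos.trans_le ((le_max_right _ _).trans hy)
  rw [← fourierMode_principalPart (fun m hm => (hc m hm).1) n hy₀,
    ← fourierMode_sub (continuous_horizontal hs hy₀)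
      (by unfold e; simp only [Finsupp.sum]; fun_prop)]
  refine norm_fourierMode_le (fun x _ => ?_) n
  have him : ((x : ℂ) + y * Complex.I).im = y := by simp
  have hpos : 0 < ((x : ℂ) + y * Complex.I).im := him.symm ▸ hy₀
  have hτ : UpperHalfPlane.im ⟨x + y * Complex.I, hpos⟩ = y := him
  have hnorm := hY ⟨x + y * Complex.I, hpos⟩ (((le_max_left _ _).trans hy).trans_eq hτ.symm)
  simp only [Set.mem_ofPred_eq, hτ, Real.norm_eq_abs, Real.abs_exp] at hnorm
  rwa [Function.comp_apply, ofComplex_apply_of_im_pos hpos]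

end Harmonic

theorem exists_forall_lt_apply_intCast_eq_zero (c : ℝ →₀ ℂ) : ∃ n₀ : ℤ, ∀ n < n₀, c n = 0 := by
  obtain ⟨B, hB⟩ := c.support.finite_toSet.bddBelow
  refine ⟨⌊B⌋, fun n hn => Finsupp.notMem_support_iff.mp fun hsupp => ?_⟩
  exact hn.not_ge (Int.floor_le_iff.mpr ((hB hsupp).trans_lt (lt_add_one _)))

theorem e_intCast_mul_coe (n : ℤ) (τ : ℍ) :
    e (n * τ) = Complex.exp ((-(2 * Real.pi * n * τ.im) : ℝ)) * e (n * τ.re) := by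
  rw [e, e, ← Complex.exp_add, coe_eq_re_add_im τ]
  congr 1
  push_cast
  linear_combination (2 * Real.pi * n * τ.im : ℂ) * Complex.I_sq

section Expansion

variable {k : ℤ} {f : ℍ → ℂ} {cp cm : ℤ → ℂ}

-- Since `cm` vanishes on `0 ≤ n` and `cp` for `n ≪ 0`, the holomorphic part of the series is, up to
-- finitely many terms, its restriction to `0 ≤ n`, hence summable.
theorem summable_holomorphicPart {n₀ : ℤ} (hcp : ∀ n < n₀, cp n = 0) (hcm : ∀ n, 0 ≤ n → cm n = 0)
    {τ : ℍ} (hsum : Summable fun n : ℤ => coeff k cp cm n τ.im * e (n * τ)) :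
    Summable fun n : ℤ => cp n * e (n * τ) := by
  refine (hsum.indicator (Set.Ici 0)).congr_cofinite ?_
  rw [EventuallyEq, eventually_cofinite]
  refine (Set.finite_Ico n₀ 0).subset fun n hn => ?_
  contrapose! hn
  rw [Set.mem_Ico, not_and_or, not_le, not_lt] at hn
  rw [Set.notMem_ofPred_iff, not_not]
  rcases le_or_gt 0 n with hn_nonneg | hn_neg
  · rw [Set.indicator_of_mem (Set.mem_Ici.mpr hn_nonneg), coeff, hcm n hn_nonneg, zero_mul,
      add_zero]
  · rw [hcp n (hn.resolve_right hn_neg.not_ge),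
      Set.indicator_of_notMem (Set.notMem_Ici.mpr hn_neg), zero_mul]

theorem isFourierExpansion_of_hasSum {n₀ : ℤ} (hcp : ∀ n < n₀, cp n = 0)
    (hcm : ∀ n, 0 ≤ n → cm n = 0)
    (hsum : ∀ τ : ℍ, HasSum (fun n : ℤ => coeff k cp cm n τ.im * e (n * τ)) (f τ)) :
    IsFourierExpansion k f cp cm := by
  have hplus (τ : ℍ) := (summable_holomorphicPart hcp hcm (hsum τ).summable).hasSum
  refine ⟨⟨n₀, hcp⟩, hcm, fun τ => ∑' n : ℤ, cp n * e (n * τ),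
    fun τ => f τ - ∑' n : ℤ, cp n * e (n * τ), hplus, fun τ => ?_,
    fun τ => (add_sub_cancel _ _).symm⟩
  convert! (hsum τ).sub (hplus τ) using 1
  funext n
  rw [coeff]
  ring

theorem exists_isFourierExpansion (hs : IsSmooth f) (hper : ∀ τ : ℍ, f ((1 : ℝ) +ᵥ τ) = f τ)
    (hΔ : ∀ τ, laplace k f τ = 0) (hpp : HasPrincipalPart (Set.range fun n : ℤ => (n : ℝ)) f) :
    ∃ cp cm : ℤ → ℂ, IsFourierExpansion k f cp cm ∧
      ∀ n, (∀ y, 0 < y → fourierMode n (f ∘ ofComplex) y = 0) → cp n = 0 ∧ cm n = 0 := by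
  obtain ⟨c, ε, K, Y, hε, hbound⟩ := exists_norm_fourierMode_sub_le hs hpp
  choose cp cm hcm hcp hvanish hmode using fun n : ℤ =>
    (isHarmonicMode_fourierMode hs hper hΔ n).exists_coeffs hε (hbound n)
  obtain ⟨n₀, hn₀⟩ := exists_forall_lt_apply_intCast_eq_zero c
  have hcp_zero (n : ℤ) (hn : n < min n₀ 0) : cp n = 0 :=
    hcp n (lt_min_iff.mp hn).2 (hn₀ n (lt_min_iff.mp hn).1)
  refine ⟨cp, cm, isFourierExpansion_of_hasSum hcp_zero hcm fun τ => ?_, hvanish⟩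
  have hsum := hasSum_fourierMode hs (comp_ofComplex_add_one hper) τ.re τ.im_pos
  rw [← coe_eq_re_add_im, Function.comp_apply, ofComplex_apply] at hsum
  convert! hsum using 1
  funext n
  rw [hmode n _ τ.im_pos, e_intCast_mul_coe, coeff]
  ring

end Expansion

end FourierExpansion

/-! ### Affine substitutions -/

section Affine

open Filter Topology

theorem im_affine_pos {a : ℝ} (ha : 0 < a) (b : ℝ) {z : ℂ} (hz : 0 < z.im) :
    0 < ((a : ℂ) * z + b).im := by
  simpa using mul_pos ha hz

theorem fderiv_comp_affine {a : ℝ} (ha : 0 < a) {b : ℝ} {F G : ℂ → ℂ}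
    (hF : ContDiffOn ℝ ∞ F {z : ℂ | 0 < z.im}) {c : ℂ}
    (hG : Set.EqOn G (fun z => c * F (a * z + b)) {z : ℂ | 0 < z.im}) (v : ℂ) :
    Set.EqOn (fun z => fderiv ℝ G z v) (fun z => c * a * fderiv ℝ F (a * z + b) v)
      {z : ℂ | 0 < z.im} := by
  intro z hz
  have hF' : HasFDerivAt F (fderiv ℝ F (a * z + b)) (a * z + b) :=
    ((hF.contDiffAt (isOpen_im_pos.mem_nhds (im_affine_pos ha b hz))).differentiableAt
      (by simp)).hasFDerivAt
  have haff : HasFDerivAt (fun z : ℂ => (a : ℂ) * z + b) (a • ContinuousLinearMap.id ℝ ℂ) z := by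
    simpa using! ((hasFDerivAt_id (𝕜 := ℝ) z).const_smul a).add_const (b : ℂ)
  have hG' := ((hF'.comp z haff).const_mul c).congr_of_eventuallyEq
    (hG.eventuallyEq_of_mem (isOpen_im_pos.mem_nhds hz))
  simp only [hG'.fderiv]
  simp [mul_assoc]

/-- `τ ↦ a τ + b` on the upper half plane, for `a > 0`. -/
def aff (a : ℝ) (ha : 0 < a) (b : ℝ) (τ : ℍ) : ℍ :=
  ⟨a * τ + b, im_affine_pos ha b τ.im_pos⟩

variable {a : ℝ} {ha : 0 < a} {b : ℝ}

theorem coe_aff (τ : ℍ) : (aff a ha b τ : ℂ) = a * τ + b := rfl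

theorem aff_im (τ : ℍ) : (aff a ha b τ).im = a * τ.im := by
  change ((a : ℂ) * τ + b).im = _
  simp

theorem comp_aff_comp_ofComplex (f : ℍ → ℂ) :
    Set.EqOn ((f ∘ aff a ha b) ∘ ofComplex) (fun z => (f ∘ ofComplex) (a * z + b))
      {z : ℂ | 0 < z.im} := by
  intro z (hz : 0 < z.im)
  simp only [Function.comp_apply, ofComplex_apply_of_im_pos hz,
    ofComplex_apply_of_im_pos (im_affine_pos ha b hz)]
  rfl

theorem IsSmooth.comp_aff {f : ℍ → ℂ} (hf : IsSmooth f) : IsSmooth (f ∘ aff a ha b) := by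
  have hf' : ContDiffOn ℝ ∞ (f ∘ ofComplex) {z : ℂ | 0 < z.im} := hf
  exact (ContDiffOn.comp (g := f ∘ ofComplex) hf' (ContDiff.contDiffOn (by fun_prop))
    fun z hz => im_affine_pos ha b hz).congr (comp_aff_comp_ofComplex f)

theorem laplace_comp_aff (k : ℤ) {f : ℍ → ℂ} (hf : IsSmooth f) (τ : ℍ) :
    laplace k (f ∘ aff a ha b) τ = laplace k f (aff a ha b τ) := by
  have hcomp : Set.EqOn ((f ∘ aff a ha b) ∘ ofComplex)
      (fun z => 1 * (f ∘ ofComplex) (a * z + b)) {z : ℂ | 0 < z.im} := by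
    simpa using comp_aff_comp_ofComplex f
  have hX := fderiv_comp_affine ha hf hcomp 1
  have hY := fderiv_comp_affine ha hf hcomp Complex.I
  have hXX := fderiv_comp_affine ha (contDiffOn_fderiv_apply hf 1) hX 1 τ.im_pos
  have hYY := fderiv_comp_affine ha (contDiffOn_fderiv_apply hf Complex.I) hY Complex.I τ.im_pos
  replace hX := hX τ.im_pos
  replace hY := hY τ.im_pos
  simp only at hX hY hXX hYY
  simp only [laplace, coe_aff, aff_im]
  unfold partialX partialY
  rw [hX, hY, hXX, hYY]
  push_cast
  ring

theorem IsSmooth.sum {ι : Type*} (s : Finset ι) {f : ι → ℍ → ℂ} (h : ∀ i ∈ s, IsSmooth (f i)) :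
    IsSmooth (∑ i ∈ s, f i) := by
  classical
  induction s using Finset.induction_on with
  | empty => exact isSmooth_zero
  | insert i s hi ih =>
    rw [Finset.sum_insert hi]
    exact (h i (s.mem_insert_self i)).add (ih fun j hj => h j (Finset.mem_insert_of_mem hj))

theorem laplace_sum (k : ℤ) {ι : Type*} (s : Finset ι) {f : ι → ℍ → ℂ}
    (h : ∀ i ∈ s, IsSmooth (f i)) (τ : ℍ) :
    laplace k (∑ i ∈ s, f i) τ = ∑ i ∈ s, laplace k (f i) τ := by
  classical
  induction s using Finset.induction_on with
  | empty => exact laplace_zero k τ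
  | insert i s hi ih =>
    have hs : ∀ j ∈ s, IsSmooth (f j) := fun j hj => h j (Finset.mem_insert_of_mem hj)
    rw [Finset.sum_insert hi, Finset.sum_insert hi,
      laplace_add k (h i (s.mem_insert_self i)) (.sum s hs), ih hs]

/-! ### Principal parts -/

theorem HasPrincipalPart.sum {ι : Type*} (s : Finset ι) {E : Set ℝ} {f : ι → ℍ → ℂ}
    (h : ∀ i ∈ s, HasPrincipalPart E (f i)) : HasPrincipalPart E (∑ i ∈ s, f i) := by
  classical
  induction s using Finset.induction_on with
  | empty => exact hasPrincipalPart_zero E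
  | insert i s hi ih =>
    rw [Finset.sum_insert hi]
    exact (h i (s.mem_insert_self i)).add (ih fun j hj => h j (Finset.mem_insert_of_mem hj))

theorem hasPrincipalPart_e {E : Set ℝ} {n : ℝ} (hn : n ∈ E) (hn₀ : n ≤ 0) :
    HasPrincipalPart E fun τ => e (n * τ) := by
  refine ⟨Finsupp.single n 1, fun m hm => ?_, 1, one_pos, ?_⟩
  · rw [Finset.mem_singleton.mp (Finsupp.support_single_subset hm)]
    exact ⟨hn, hn₀⟩
  · simpa using! Asymptotics.isBigO_zero _ _

theorem hasPrincipalPart_of_isBigO {E : Set ℝ} {f : ℍ → ℂ} {ε : ℝ} (hε : 0 < ε)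
    (h : f =O[atImInfty] fun τ : ℍ => Real.exp (-ε * τ.im)) : HasPrincipalPart E f :=
  ⟨0, by simp, ε, hε, by simpa using h⟩

theorem HasPrincipalPart.mono {E E' : Set ℝ} (hE : E ⊆ E') {f : ℍ → ℂ}
    (h : HasPrincipalPart E f) : HasPrincipalPart E' f := by
  obtain ⟨c, hc, h⟩ := h
  exact ⟨c, fun n hn => ⟨hE (hc n hn).1, (hc n hn).2⟩, h⟩

theorem HasPrincipalPart.exists_eq {E : Set ℝ} {f : ℍ → ℂ} (h : HasPrincipalPart E f) :
    ∃ (s : Finset ℝ) (c : ℝ → ℂ) (r : ℍ → ℂ) (ε : ℝ), (∀ n ∈ s, n ∈ E ∧ n ≤ 0) ∧ 0 < ε ∧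
      r =O[atImInfty] (fun τ : ℍ => Real.exp (-ε * τ.im)) ∧
      ∀ τ, f τ = ∑ n ∈ s, c n * e (n * τ) + r τ := by
  obtain ⟨c, hc, ε, hε, h⟩ := h
  exact ⟨c.support, c, _, ε, hc, hε, h, fun τ => by simp [Finsupp.sum]⟩

theorem tendsto_aff : Tendsto (aff a ha b) atImInfty atImInfty := by
  rw [atImInfty, tendsto_comap_iff, show im ∘ aff a ha b = fun τ => a * τ.im from funext aff_im]
  exact tendsto_comap.const_mul_atTop ha

theorem isBigO_comp_aff {r : ℍ → ℂ} {ε : ℝ}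
    (h : r =O[atImInfty] fun τ : ℍ => Real.exp (-ε * τ.im)) :
    (r ∘ aff a ha b) =O[atImInfty] fun τ : ℍ => Real.exp (-(ε * a) * τ.im) := by
  refine (h.comp_tendsto (tendsto_aff (ha := ha) (b := b))).congr_right fun τ => ?_
  rw [Function.comp_apply, aff_im]
  congr 1
  ring

theorem e_mul_aff (n : ℝ) (τ : ℍ) :
    e (n * aff a ha b τ) = e (n * b) * e ((a * n : ℝ) * τ) := by
  rw [← e_add, coe_aff]
  congr 1
  push_cast
  ring

theorem HasPrincipalPart.comp_aff {E E' : Set ℝ} (hE : ∀ n ∈ E, a * n ∈ E') {f : ℍ → ℂ}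
    (h : HasPrincipalPart E f) : HasPrincipalPart E' (f ∘ aff a ha b) := by
  obtain ⟨s, c, r, ε, hs, hε, hr, hf⟩ := h.exists_eq
  have hcomp : f ∘ aff a ha b
      = ∑ n ∈ s, (c n * e (n * b)) • (fun τ : ℍ => e ((a * n : ℝ) * τ)) + r ∘ aff a ha b := by
    funext τ
    simp [hf, e_mul_aff, mul_assoc]
  rw [hcomp]
  refine (HasPrincipalPart.sum s fun n hn =>
    (hasPrincipalPart_e (hE n (hs n hn).1) ?_).smul _).add
      (hasPrincipalPart_of_isBigO (mul_pos hε ha) (isBigO_comp_aff hr))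
  exact mul_nonpos_of_nonneg_of_nonpos ha.le (hs n hn).2

end Affine

/-! ### The functions `f((τ + j) / p)` -/

section Translates

variable {p : ℕ} [Fact p.Prime]

local notation "ψ" => ZMod.stdAddChar

variable (p) in
theorem natCast_prime_pos : 0 < (p : ℝ) := Nat.cast_pos.mpr (Fact.out : p.Prime).pos

variable (p) in
/-- `τ ↦ (τ + j) / p` on the upper half plane. -/
def divShift (j : ℤ) : ℍ → ℍ := aff (p : ℝ)⁻¹ (inv_pos.mpr (natCast_prime_pos p)) (j / p)

theorem coe_divShift (j : ℤ) (τ : ℍ) : (divShift p j τ : ℂ) = (τ + j) / p := by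
  rw [divShift, coe_aff]
  push_cast
  ring

theorem divShift_im (j : ℤ) (τ : ℍ) : (divShift p j τ).im = τ.im / p := by
  rw [divShift, aff_im, inv_mul_eq_div]

variable (p) in
/-- `τ ↦ p τ` on the upper half plane. -/
def scale : ℍ → ℍ := aff (p : ℝ) (natCast_prime_pos p) 0

theorem coe_scale (τ : ℍ) : (scale p τ : ℂ) = p * τ := by
  rw [scale, coe_aff]
  simp

theorem scale_divShift (j : ℤ) (τ : ℍ) : scale p (divShift p j τ) = (j : ℝ) +ᵥ τ := by
  have hp₀ : (p : ℂ) ≠ 0 := natCast_prime_ne_zero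
  ext1
  rw [coe_scale, coe_divShift, coe_vadd, mul_div_cancel₀ _ hp₀, add_comm]
  simp

theorem divShift_scale (j : ℤ) (τ : ℍ) : divShift p j (scale p τ) = (j / p : ℝ) +ᵥ τ := by
  have hp₀ : (p : ℂ) ≠ 0 := natCast_prime_ne_zero
  ext1
  rw [coe_divShift, coe_scale, coe_vadd]
  push_cast
  field_simp
  ring

theorem e_mul_divShift (n j : ℤ) (τ : ℍ) :
    e (n * divShift p j τ) = ψ ((j : ZMod p) * (n : ZMod p)) * e ((n : ℂ) / p * τ) := by
  rw [← Int.cast_mul, stdAddChar_intCast, ← e_add, coe_divShift]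
  congr 1
  push_cast
  ring

/-- `f ↦ f((τ + j) / p)`, for the representative `0 ≤ j < p` of a residue class mod `p`. If
`f(τ + 1) = f(τ)`, the choice of the representative does not matter. -/
def translate (j : ZMod p) : (ℍ → ℂ) →ₗ[ℂ] (ℍ → ℂ) := LinearMap.funLeft ℂ ℂ (divShift p j.val)

theorem translate_apply (j : ZMod p) (f : ℍ → ℂ) (τ : ℍ) :
    translate j f τ = f (divShift p j.val τ) := rfl

/-- `f ↦ ∑ ψ(-j r) f((τ + j) / p)`, which extracts from `p f(τ / p)` the Fourier terms with
exponents `n / p`, `n ≡ r mod p`. -/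
def translateSum (r : ZMod p) : (ℍ → ℂ) →ₗ[ℂ] (ℍ → ℂ) := ∑ j : ZMod p, ψ (-(j * r)) • translate j

theorem translateSum_eq_sum (r : ZMod p) (f : ℍ → ℂ) :
    translateSum r f = ∑ j : ZMod p, ψ (-(j * r)) • translate j f := by
  simp only [translateSum, LinearMap.sum_apply, LinearMap.smul_apply]

theorem translateSum_apply (r : ZMod p) (f : ℍ → ℂ) (τ : ℍ) :
    translateSum r f τ = ∑ j : ZMod p, ψ (-(j * r)) * translate j f τ := by
  simp only [translateSum_eq_sum, Finset.sum_apply, Pi.smul_apply, smul_eq_mul]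

theorem translateSum_e (n : ℤ) (r : ZMod p) :
    translateSum r (fun τ => e (n * τ))
      = if (n : ZMod p) = r then (p : ℂ) • fun τ : ℍ => e ((n : ℂ) / p * τ) else 0 := by
  funext τ
  have hterm (j : ZMod p) : ψ (-(j * r)) * translate j (fun τ => e (n * τ)) τ
      = ψ (((n : ZMod p) - r) * j) * e ((n : ℂ) / p * τ) := by
    rw [translate_apply, e_mul_divShift, ← mul_assoc, ← AddChar.map_add_eq_mul, Int.cast_natCast,
      ZMod.natCast_zmod_val]
    congr 2
    ring
  rw [translateSum_apply, Finset.sum_congr rfl fun j _ => hterm j, ← Finset.sum_mul,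
    sum_stdAddChar_mul]
  simp only [sub_eq_zero]
  split_ifs <;> simp

theorem IsSmooth.translate {f : ℍ → ℂ} (hf : IsSmooth f) (j : ZMod p) :
    IsSmooth (translate j f) := hf.comp_aff

theorem IsSmooth.translateSum {f : ℍ → ℂ} (hf : IsSmooth f) (r : ZMod p) :
    IsSmooth (translateSum r f) := by
  rw [translateSum_eq_sum]
  exact .sum _ fun j _ => (hf.translate j).smul _

theorem laplace_translateSum {k : ℤ} {f : ℍ → ℂ} (hf : IsSmooth f) (h : ∀ τ, laplace k f τ = 0)
    (r : ZMod p) (τ : ℍ) : laplace k (translateSum r f) τ = 0 := by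
  rw [translateSum_eq_sum, laplace_sum k _ fun j _ => (hf.translate j).smul _]
  refine Finset.sum_eq_zero fun j _ => ?_
  have hj : laplace k (translate j f) τ = 0 := (laplace_comp_aff k hf τ).trans (h _)
  rw [laplace_smul, hj, mul_zero]

/-- The exponents `n / p` with `n ≡ r mod p`. -/
def exponents (r : ZMod p) : Set ℝ := {x : ℝ | ∃ n : ℤ, (n : ZMod p) = r ∧ x = n / p}

theorem hasPrincipalPart_translateSum_e {n : ℤ} (hn : n ≤ 0) (r : ZMod p) :
    HasPrincipalPart (exponents r) (translateSum r fun τ => e (n * τ)) := by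
  rw [translateSum_e]
  split_ifs with hr
  · have hle : (n : ℝ) / p ≤ 0 :=
      div_nonpos_of_nonpos_of_nonneg (Int.cast_nonpos.mpr hn) p.cast_nonneg
    simpa using (hasPrincipalPart_e (E := exponents r) ⟨n, hr, rfl⟩ hle).smul (p : ℂ)
  · exact hasPrincipalPart_zero _

theorem hasPrincipalPart_translateSum_of_isBigO {f : ℍ → ℂ} {ε : ℝ} (hε : 0 < ε)
    (hf : f =O[atImInfty] fun τ : ℍ => Real.exp (-ε * τ.im)) (E : Set ℝ) (r : ZMod p) :
    HasPrincipalPart E (translateSum r f) := by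
  rw [translateSum_eq_sum]
  exact .sum _ fun j _ => (hasPrincipalPart_of_isBigO
    (mul_pos hε (inv_pos.mpr (natCast_prime_pos p))) (isBigO_comp_aff hf)).smul _

theorem HasPrincipalPart.translateSum {f : ℍ → ℂ}
    (h : HasPrincipalPart (Set.range fun n : ℤ => (n : ℝ)) f) (r : ZMod p) :
    HasPrincipalPart (exponents r) (translateSum r f) := by
  obtain ⟨s, c, g, ε, hs, hε, hg, hf⟩ := h.exists_eq
  have hsum : f = ∑ n ∈ s, c n • (fun τ : ℍ => e (n * τ)) + g := by
    funext τ
    simp [hf]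
  rw [hsum, map_add, map_sum]
  refine (HasPrincipalPart.sum s fun n hn => ?_).add
    (hasPrincipalPart_translateSum_of_isBigO hε hg _ r)
  obtain ⟨⟨m, rfl⟩, hm⟩ := hs n hn
  simpa only [map_smul, Complex.ofReal_intCast] using
    (hasPrincipalPart_translateSum_e (Int.cast_nonpos.mp hm) r).smul (c m)

theorem IsFourierExpansion.hasSum {k : ℤ} {f : ℍ → ℂ} {cp cm : ℤ → ℂ}
    (h : IsFourierExpansion k f cp cm) (τ : ℍ) :
    HasSum (fun n : ℤ => coeff k cp cm n τ.im * e (n * τ)) (f τ) := by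
  obtain ⟨-, -, fp, fm, hfp, hfm, hf⟩ := h
  rw [hf]
  simpa only [coeff, add_mul] using (hfp τ).add (hfm τ)

theorem IsFourierExpansion.hasSum_translateSum {k : ℤ} {f : ℍ → ℂ} {cp cm : ℤ → ℂ}
    (h : IsFourierExpansion k f cp cm) (r : ZMod p) (τ : ℍ) :
    HasSum (fun n : ℤ => if (n : ZMod p) = r then
      p * (coeff k cp cm n (τ.im / p) * e ((n : ℂ) / p * τ)) else 0) (translateSum r f τ) := by
  have hsum := hasSum_sum (s := Finset.univ) fun (j : ZMod p) _ =>
    (h.hasSum (divShift p j.val τ)).mul_left (ψ (-(j * r)))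
  simp only [divShift_im] at hsum
  rw [translateSum_apply]
  refine hsum.congr_fun fun n => ?_
  calc (if (n : ZMod p) = r then p * (coeff k cp cm n (τ.im / p) * e ((n : ℂ) / p * τ)) else 0)
      = coeff k cp cm n (τ.im / p) * translateSum r (fun τ => e (n * τ)) τ := by
        rw [translateSum_e]
        split_ifs <;> simp [mul_left_comm]
    _ = _ := by
        rw [translateSum_apply, Finset.mul_sum]
        exact Finset.sum_congr rfl fun j _ => mul_left_comm _ _ _

theorem translateSum_eq_zero {k : ℤ} {f : ℍ → ℂ} {cp cm : ℤ → ℂ}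
    (h : IsFourierExpansion k f cp cm) {r : ZMod p}
    (hr : ∀ n : ℤ, (n : ZMod p) = r → cp n = 0 ∧ cm n = 0) (τ : ℍ) : translateSum r f τ = 0 := by
  refine (h.hasSum_translateSum r τ).unique (hasSum_zero.congr_fun fun n => ?_)
  split_ifs with hn
  · simp [coeff, hr n hn]
  · rfl

theorem fourierMode_comp_add {F : ℂ → ℂ} {y : ℝ}
    (hF : ∀ x : ℝ, F (x + y * Complex.I + 1) = F (x + y * Complex.I)) (n : ℤ) (d : ℝ) :
    fourierMode n (fun z => F (z + d)) y = e (n * d) * fourierMode n F y := by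
  have hper : Function.Periodic (fun x : ℝ => e (-n * x) * F (x + y * Complex.I)) 1 := by
    intro x
    have he : e (-(n : ℂ) * (x + 1 : ℝ)) = e (-n * x) := by
      have hint := e_intCast (-n)
      push_cast at hint ⊢
      rw [mul_add, mul_one, e_add, hint, mul_one]
    have hx : ((x + 1 : ℝ) : ℂ) + y * Complex.I = x + y * Complex.I + 1 := by
      push_cast
      ring
    simp only [he, hx, hF]
  have hshift (x : ℝ) : e (-n * x) * F (x + y * Complex.I + d)
      = e (n * d) * (e (-n * (x + d : ℝ)) * F ((x + d : ℝ) + y * Complex.I)) := by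
    rw [← mul_assoc, ← e_add]
    congr 2
    · push_cast
      ring
    · push_cast
      ring
  simp only [fourierMode, hshift, intervalIntegral.integral_const_mul]
  rw [intervalIntegral.integral_comp_add_right
      (f := fun x : ℝ => e (-n * x) * F (x + y * Complex.I)), zero_add, add_comm 1 d,
    hper.intervalIntegral_add_eq d 0, zero_add]

theorem comp_ofComplex_add (f : ℍ → ℂ) (τ : ℍ) (d : ℝ) :
    (f ∘ ofComplex) (τ + d) = f (d +ᵥ τ) := by
  rw [Function.comp_apply, add_comm, ← coe_vadd, ofComplex_apply]

theorem sum_stdAddChar_mul_comp_ofComplex_add (f : ℍ → ℂ) (r : ZMod p) (τ : ℍ) :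
    ∑ j : ZMod p, ψ (-(j * r)) * (f ∘ ofComplex) (τ + ((j.val : ℤ) / p : ℝ))
      = translateSum r f (scale p τ) := by
  simp only [translateSum_apply, translate_apply, divShift_scale, comp_ofComplex_add]

theorem fourierMode_eq_zero_of_translateSum_eq_zero {f : ℍ → ℂ} (hs : IsSmooth f)
    (hper : ∀ τ, f ((1 : ℝ) +ᵥ τ) = f τ) {n : ℤ}
    (h : ∀ τ, translateSum (n : ZMod p) f τ = 0) {y : ℝ} (hy : 0 < y) :
    fourierMode n (f ∘ ofComplex) y = 0 := by
  have hp₀ : (p : ℂ) ≠ 0 := natCast_prime_ne_zero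
  let line (x : ℝ) : ℍ := ⟨x + y * Complex.I, by simpa using hy⟩
  have hper' (x : ℝ) :
      (f ∘ ofComplex) (x + y * Complex.I + 1) = (f ∘ ofComplex) (x + y * Complex.I) := by
    have hadd := comp_ofComplex_add f (line x) 1
    rw [hper, Complex.ofReal_one] at hadd
    exact hadd.trans (congrArg f (ofComplex_apply (line x)).symm)
  have hmode (j : ZMod p) : fourierMode n (fun z => ψ (-(j * (n : ZMod p))) *
      (f ∘ ofComplex) (z + ((j.val : ℤ) / p : ℝ))) y = fourierMode n (f ∘ ofComplex) y := by
    have he : e (n * ((j.val : ℤ) / p : ℝ)) = ψ (j * (n : ZMod p)) := by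
      have hj := stdAddChar_intCast (p := p) (j.val * n)
      rw [Int.cast_mul, Int.cast_natCast, ZMod.natCast_zmod_val] at hj
      rw [hj]
      congr 1
      push_cast
      ring
    rw [fourierMode_const_mul, fourierMode_comp_add hper', he, ← mul_assoc,
      ← AddChar.map_add_eq_mul, neg_add_cancel, AddChar.map_zero_eq_one, one_mul]
  have hcont (j : ZMod p) : Continuous fun x : ℝ => ψ (-(j * (n : ZMod p))) *
      (f ∘ ofComplex) (x + y * Complex.I + ((j.val : ℤ) / p : ℝ)) := by
    refine continuous_const.mul ?_
    refine ((continuous_horizontal hs hy).comp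
      (continuous_add_const ((j.val : ℤ) / p : ℝ))).congr fun x => ?_
    simp only [Function.comp_apply, Complex.ofReal_add, add_right_comm]
  have hsum : ∑ _j : ZMod p, fourierMode n (f ∘ ofComplex) y = 0 := by
    rw [← Finset.sum_congr rfl fun j _ => hmode j, ← fourierMode_finsetSum _ fun j _ => hcont j,
      fourierMode_congr (G := fun _ => 0) fun x =>
        (sum_stdAddChar_mul_comp_ofComplex_add f _ (line x)).trans (h _), fourierMode]
    simp
  simpa [hp₀] using hsum

end Translates

/-! ### The components of the lift -/

section Lift

variable {p : ℕ} [Fact p.Prime]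

local notation "ψ" => ZMod.stdAddChar
local notation "χ" => legendreChar p

/-- Covariance of weight `k` and Nebentypus `(· / p)` under `Γ₀(p)`: the transformation law in the
definition of `maassForms`. -/
def IsCovariant (p : ℕ) [Fact p.Prime] (k : ℤ) (f : ℍ → ℂ) : Prop :=
  ∀ M ∈ CongruenceSubgroup.Gamma0 p, ∀ τ : ℍ,
    f (M • τ) = legendreChar p ((M 1 1 : ℤ) : ZMod p) * cocyc M τ ^ k * f τ

theorem coe_S_smul (τ : ℍ) : ((ModularGroup.S • τ : ℍ) : ℂ) = -(τ : ℂ)⁻¹ := by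
  rw [modular_S_smul, ← inv_neg]

theorem S_smul_S_smul (τ : ℍ) : ModularGroup.S • ModularGroup.S • τ = τ := by
  ext1
  rw [coe_S_smul, coe_S_smul, inv_neg, neg_neg, inv_inv]

theorem coe_SL_smul (M : SL(2, ℤ)) (τ : ℍ) :
    ((M • τ : ℍ) : ℂ) = ((M 0 0 : ℂ) * τ + M 0 1) / cocyc M τ := by
  rw [cocyc, specialLinearGroup_apply]
  simp

section Covariant

variable {k : ℤ} {f : ℍ → ℂ} (hf : IsCovariant p k f)

include hf

theorem IsCovariant.int_vadd (n : ℤ) (τ : ℍ) : f ((n : ℝ) +ᵥ τ) = f τ := by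
  have hmem : ModularGroup.T ^ n ∈ CongruenceSubgroup.Gamma0 p := by
    rw [CongruenceSubgroup.Gamma0_mem, ModularGroup.coe_T_zpow]
    simp
  rw [← modular_T_zpow_smul, hf _ hmem, cocyc, ModularGroup.coe_T_zpow]
  simp

theorem translate_intCast (j : ℤ) (τ : ℍ) : translate (j : ZMod p) f τ = f (divShift p j τ) := by
  have hval : (((j : ZMod p).val : ℤ) : ZMod p) = (j : ZMod p) := by
    rw [Int.cast_natCast, ZMod.natCast_zmod_val]
  obtain ⟨m, hm⟩ := (ZMod.intCast_eq_intCast_iff_dvd_sub _ _ p).mp hval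
  have hm' : (j : ℂ) = (((j : ZMod p).val : ℤ) : ℂ) + p * m := by
    exact_mod_cast eq_add_of_sub_eq' hm
  have hp₀ : (p : ℂ) ≠ 0 := natCast_prime_ne_zero
  rw [translate_apply, ← hf.int_vadd m]
  congr 1
  ext1
  rw [coe_vadd, coe_divShift, coe_divShift, hm']
  push_cast
  field_simp
  ring

theorem translate_T (j : ZMod p) (τ : ℍ) :
    translate j f (ModularGroup.T • τ) = translate (j + 1) f τ := by
  obtain ⟨j, rfl⟩ := ZMod.intCast_surjective j
  rw [← Int.cast_one, ← Int.cast_add, translate_intCast hf, translate_intCast hf, modular_T_smul]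
  congr 1
  ext1
  rw [coe_divShift, coe_divShift, coe_vadd]
  push_cast
  ring

theorem translateSum_T (r : ZMod p) (τ : ℍ) :
    translateSum r f (ModularGroup.T • τ) = ψ r * translateSum r f τ := by
  rw [translateSum_apply, translateSum_apply, Finset.mul_sum,
    ← Equiv.sum_comp (Equiv.addRight (1 : ZMod p)) fun j => ψ r * (ψ (-(j * r)) * translate j f τ)]
  refine Finset.sum_congr rfl fun j _ => ?_
  rw [translate_T hf, ← mul_assoc, ← AddChar.map_add_eq_mul, Equiv.coe_addRight]
  congr 2
  ring

omit hf in
theorem exists_mem_Gamma0_divShift_S_smul {a b : ℤ} (h : (p : ℤ) ∣ a * b + 1) :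
    ∃ M ∈ CongruenceSubgroup.Gamma0 p, M 1 1 = -b ∧ ∀ τ : ℍ,
      cocyc M (divShift p b τ) = τ ∧ divShift p a (ModularGroup.S • τ) = M • divShift p b τ := by
  obtain ⟨m, hm⟩ := h
  let M : SL(2, ℤ) := ⟨!![a, -m; p, -b], by
    rw [Matrix.det_fin_two_of]
    linear_combination -hm⟩
  have hp₀ : (p : ℂ) ≠ 0 := natCast_prime_ne_zero
  have hcocyc (τ : ℍ) : cocyc M (divShift p b τ) = τ := by
    simp only [cocyc, coe_divShift, M, Matrix.of_apply,
      Matrix.cons_val', Matrix.cons_val_zero, Matrix.cons_val_one, Matrix.cons_val_fin_one]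
    push_cast
    field_simp
    ring
  refine ⟨M, CongruenceSubgroup.Gamma0_mem.mpr (by simp [M]), rfl, fun τ => ⟨hcocyc τ, ?_⟩⟩
  ext1
  rw [coe_SL_smul, hcocyc, coe_divShift, coe_divShift, coe_S_smul]
  have hτ := τ.ne_zero
  have hm' : (a : ℂ) * b + 1 = p * m := by exact_mod_cast hm
  simp only [M, Matrix.of_apply, Matrix.cons_val',
    Matrix.cons_val_zero, Matrix.cons_val_one, Matrix.cons_val_fin_one]
  push_cast
  field_simp
  linear_combination -hm'

theorem translate_S {j : ZMod p} (hj : j ≠ 0) (τ : ℍ) :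
    translate j f (ModularGroup.S • τ) = χ j * (τ : ℂ) ^ k * translate (-j⁻¹) f τ := by
  obtain ⟨a, rfl⟩ := ZMod.intCast_surjective j
  obtain ⟨b, hb⟩ := ZMod.intCast_surjective (-(a : ZMod p)⁻¹)
  have hdvd : (p : ℤ) ∣ a * b + 1 := by
    rw [← ZMod.intCast_zmod_eq_zero_iff_dvd]
    push_cast
    rw [hb, mul_neg, mul_inv_cancel₀ hj, neg_add_cancel]
  obtain ⟨M, hM, hM₁₁, hMτ⟩ := exists_mem_Gamma0_divShift_S_smul hdvd
  obtain ⟨hcocyc, hsmul⟩ := hMτ τ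
  rw [← hb, translate_intCast hf, translate_intCast hf, hsmul, hf M hM, hcocyc, hM₁₁, Int.cast_neg,
    hb, neg_neg, legendreChar_inv]

theorem sum_translate_S (u : ZMod p → ℂ) (τ : ℍ) :
    ∑ j : ZMod p, u j * translate j f (ModularGroup.S • τ)
      = u 0 * translate (0 : ZMod p) f (ModularGroup.S • τ)
        + χ (-1) * (τ : ℂ) ^ k * ∑ j : ZMod p, χ j * u (-j⁻¹) * translate j f τ := by
  have hinv (j : ZMod p) : -(-j⁻¹)⁻¹ = j := by rw [inv_neg, neg_neg, inv_inv]
  let σ : ZMod p ≃ ZMod p := ⟨fun j => -j⁻¹, fun j => -j⁻¹, hinv, hinv⟩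
  have hterm (j : ZMod p) : u j * translate j f (ModularGroup.S • τ)
      = (if j = 0 then u 0 * translate (0 : ZMod p) f (ModularGroup.S • τ) else 0)
        + χ (-1) * (τ : ℂ) ^ k * (χ (σ j) * u (-(σ j)⁻¹) * translate (σ j) f τ) := by
    have hσ : σ j = -j⁻¹ := rfl
    rw [hσ, hinv]
    split_ifs with hj
    · subst hj
      simp [legendreChar_zero]
    · have hκ := legendreChar_mul_self (p := p) (x := -1) (by simp)
      rw [translate_S hf hj, ← neg_one_mul j⁻¹, map_mul, legendreChar_inv]
      linear_combination -(u j * χ j * (τ : ℂ) ^ k * translate (-1 * j⁻¹) f τ) * hκ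
  rw [Finset.sum_congr rfl fun j _ => hterm j, Finset.sum_add_distrib, ← Finset.mul_sum,
    Equiv.sum_comp σ fun j => χ j * u (-j⁻¹) * translate j f τ]
  simp

theorem sum_legendreChar_mul_translate_S (τ : ℍ) :
    ∑ j : ZMod p, χ j * translate j f (ModularGroup.S • τ)
      = (τ : ℂ) ^ k * (translateSum (0 : ZMod p) f τ - translate (0 : ZMod p) f τ) := by
  have hκ := legendreChar_mul_self (p := p) (x := -1) (by simp)
  have hterm (j : ZMod p) : χ j * χ (-j⁻¹) * translate j f τ
      = χ (-1) * (translate j f τ - if j = 0 then translate (0 : ZMod p) f τ else 0) := by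
    split_ifs with hj
    · simp [hj, legendreChar_zero]
    · rw [← neg_one_mul j⁻¹, map_mul, legendreChar_inv]
      linear_combination (χ (-1) * translate j f τ) * legendreChar_mul_self hj
  have hsum : translateSum (0 : ZMod p) f τ = ∑ j : ZMod p, translate j f τ := by
    simp [translateSum_apply]
  rw [sum_translate_S hf, Finset.sum_congr rfl fun j _ => hterm j, ← Finset.mul_sum,
    Finset.sum_sub_distrib, Finset.sum_ite_eq' Finset.univ (0 : ZMod p), if_pos (Finset.mem_univ _),
    legendreChar_zero, hsum]
  linear_combination
    ((τ : ℂ) ^ k * (∑ j : ZMod p, translate j f τ - translate (0 : ZMod p) f τ)) * hκ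

end Covariant

/-- The condition that makes `f` an element of the `χ(l)`-subspace: `translateSum r f` carries the
Fourier terms with exponents `≡ r mod p`. -/
def IsPlus (l : ZMod p) (f : ℍ → ℂ) : Prop :=
  ∀ r : ZMod p, χ r = -χ l → ∀ τ, translateSum r f τ = 0

theorem sum_translateSum (f : ℍ → ℂ) (τ : ℍ) :
    ∑ r : ZMod p, translateSum r f τ = p * translate (0 : ZMod p) f τ := by
  simp only [translateSum_apply]
  rw [Finset.sum_comm]
  simp only [← Finset.sum_mul, ← neg_mul, sum_stdAddChar_mul, neg_eq_zero, ite_mul, zero_mul]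
  simp

theorem sum_stdAddChar_linear_mul_quadratic (hp : p ≠ 2) {l : ZMod p} (hl : l ≠ 0) (x j : ZMod p) :
    ∑ y : ZMod p, ψ (-(2 * l * x * y)) * ψ (-(j * (l * y ^ 2)))
      = (if j = 0 then (if x = 0 then (p : ℂ) else 0) else 0)
        + χ (-1) * quadGauss l * (χ j * ψ (l * x ^ 2 * j⁻¹)) := by
  by_cases hj : j = 0
  · have hlin (y : ZMod p) : ψ (-(2 * l * x * y)) * ψ (-(j * (l * y ^ 2)))
        = ψ (-(2 * l * x) * y) := by simp [hj]
    rw [Finset.sum_congr rfl fun y _ => hlin y, sum_stdAddChar_mul]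
    simp [hj, legendreChar_zero, two_ne_zero_zmod hp, hl]
  · have hquad (y : ZMod p) : ψ (-(2 * l * x * y)) * ψ (-(j * (l * y ^ 2)))
        = ψ (-j * l * y ^ 2 - 2 * l * x * y) := by
      rw [← AddChar.map_add_eq_mul]
      congr 1
      ring
    rw [Finset.sum_congr rfl fun y _ => hquad y,
      sum_stdAddChar_quadratic hp hl (neg_ne_zero.mpr hj), ← neg_one_mul j, map_mul, mul_inv,
      inv_neg, inv_one, neg_one_mul, mul_neg, neg_neg, if_neg hj]
    ring

theorem sum_translateSum_sq_mul (hp : p ≠ 2) {l : ZMod p} (hl : l ≠ 0) (f : ℍ → ℂ) (x : ZMod p)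
    (τ : ℍ) : ∑ y : ZMod p, ψ (-(2 * l * x * y)) * translateSum (l * y ^ 2) f τ
      = (if x = 0 then p * translate (0 : ZMod p) f τ else 0)
        + χ (-1) * quadGauss l * ∑ j : ZMod p, χ j * ψ (l * x ^ 2 * j⁻¹) * translate j f τ := by
  simp only [translateSum_apply, Finset.mul_sum]
  rw [Finset.sum_comm]
  simp only [← mul_assoc (ψ _), ← Finset.sum_mul, sum_stdAddChar_linear_mul_quadratic hp hl,
    add_mul, Finset.sum_add_distrib, ite_mul, zero_mul]
  simp only [Finset.sum_ite_eq', Finset.mem_univ, if_true, mul_assoc]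

section Plus

variable (hp : p ≠ 2) {l : ZMod p} (hl : l ≠ 0) {f : ℍ → ℂ} (hplus : IsPlus l f)

include hp hl hplus

theorem sum_translateSum_sq (τ : ℍ) : ∑ y : ZMod p, translateSum (l * y ^ 2) f τ
      = 2 * (p * translate (0 : ZMod p) f τ) - translateSum (0 : ZMod p) f τ := by
  rw [sum_mul_sq_of_eq_zero hp hl (fun r => translateSum r f τ) fun r hr => hplus r hr τ,
    sum_translateSum]

theorem translateSum_zero_eq (τ : ℍ) : translateSum (0 : ZMod p) f τ
      = p * translate (0 : ZMod p) f τ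
        - χ (-1) * quadGauss l * ∑ j : ZMod p, χ j * translate j f τ := by
  have hsum := sum_translateSum_sq_mul hp hl f 0 τ
  simp only [mul_zero, zero_mul, neg_zero, AddChar.map_zero_eq_one, one_mul, if_true, mul_one,
    ne_eq, OfNat.ofNat_ne_zero, not_false_eq_true, zero_pow,
    sum_translateSum_sq hp hl hplus τ] at hsum
  linear_combination -hsum

/- `translateSum_zero_eq` at `τ` and at `S τ`, with `sum_legendreChar_mul_translate_S` at both
points, are four linear equations; eliminating leaves the claim times `p - 1`. -/
theorem translate_zero_S {k : ℤ} (hk : (-1 : ℂ) ^ k = χ (-1)) (hf : IsCovariant p k f) (τ : ℍ) :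
    translate (0 : ZMod p) f (ModularGroup.S • τ)
      = (τ : ℂ) ^ k * (quadGauss l)⁻¹ * translateSum (0 : ZMod p) f τ := by
  have hg := quadGauss_ne_zero hp hl
  have hgg := quadGauss_mul_self hp hl
  have hτ : (τ : ℂ) ^ k ≠ 0 := zpow_ne_zero _ τ.ne_zero
  have hκ := legendreChar_mul_self (p := p) (x := -1) (by simp)
  have hp₁ : (p : ℂ) - 1 ≠ 0 := sub_ne_zero.mpr <|
    mod_cast (Fact.out : p.Prime).one_lt.ne'
  have heq := translateSum_zero_eq hp hl hplus τ
  have heqS := translateSum_zero_eq hp hl hplus (ModularGroup.S • τ)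
  have hsumS := sum_legendreChar_mul_translate_S hf τ
  have hsum := sum_legendreChar_mul_translate_S hf (ModularGroup.S • τ)
  rw [S_smul_S_smul, coe_S_smul, ← neg_one_mul, mul_zpow, inv_zpow, hk] at hsum
  rw [hsumS] at heqS
  rw [hsum, heqS] at heq
  generalize quadGauss l = g at *
  generalize translateSum (0 : ZMod p) f τ = s at *
  generalize translate (0 : ZMod p) f (ModularGroup.S • τ) = b at *
  generalize translate (0 : ZMod p) f τ = a at *
  generalize χ (-1) = κ at *
  generalize (τ : ℂ) ^ k = t at *
  have hs : s = p * a - κ * κ * (g * t⁻¹ * (p - 1) * b)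
      + κ * κ * κ * (g * g) * (t⁻¹ * t) * (s - a) := by linear_combination heq
  rw [hκ, hgg, inv_mul_cancel₀ hτ] at hs
  have hcancel : (p - 1) * s = (p - 1) * (g * t⁻¹ * b) := by
    linear_combination -hs - p * (s - a) * hκ
  rw [mul_left_cancel₀ hp₁ hcancel]
  field_simp

end Plus

/-- The component at `x` of the lift, as a function on `ℤ / p`. -/
def liftComp (l x : ZMod p) : (ℍ → ℂ) →ₗ[ℂ] (ℍ → ℂ) :=
  ((if x = 0 then 2 else 1) * (p : ℂ)⁻¹) • translateSum (l * x ^ 2)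

theorem liftComp_apply (l x : ZMod p) (f : ℍ → ℂ) (τ : ℍ) : liftComp l x f τ
      = (if x = 0 then 2 else 1) * (p : ℂ)⁻¹ * translateSum (l * x ^ 2) f τ := rfl

theorem liftComp_T {k : ℤ} {f : ℍ → ℂ} (hf : IsCovariant p k f) (l x : ZMod p) (τ : ℍ) :
    liftComp l x f (ModularGroup.T • τ) = ψ (l * x ^ 2) * liftComp l x f τ := by
  rw [liftComp_apply, liftComp_apply, translateSum_T hf]
  ring

theorem sum_mul_liftComp (l : ZMod p) (f : ℍ → ℂ) (u : ZMod p → ℂ) (τ : ℍ) :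
    ∑ y : ZMod p, u y * liftComp l y f τ = (p : ℂ)⁻¹ *
      (u 0 * translateSum (0 : ZMod p) f τ + ∑ y : ZMod p, u y * translateSum (l * y ^ 2) f τ) := by
  have hterm (y : ZMod p) : u y * liftComp l y f τ
      = (p : ℂ)⁻¹ * ((if y = 0 then u 0 * translateSum (0 : ZMod p) f τ else 0)
        + u y * translateSum (l * y ^ 2) f τ) := by
    rw [liftComp_apply]
    split_ifs with hy
    · rw [hy, zero_pow two_ne_zero, mul_zero]
      ring
    · ring
  rw [Finset.sum_congr rfl fun y _ => hterm y, ← Finset.mul_sum, Finset.sum_add_distrib]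
  simp

theorem liftComp_S (hp : p ≠ 2) {l : ZMod p} (hl : l ≠ 0) {k : ℤ}
    (hk : (-1 : ℂ) ^ k = χ (-1)) {f : ℍ → ℂ} (hf : IsCovariant p k f) (hplus : IsPlus l f)
    (x : ZMod p) (τ : ℍ) : liftComp l x f (ModularGroup.S • τ)
      = (τ : ℂ) ^ k * ∑ y : ZMod p, (quadGauss l)⁻¹ * ψ (-(2 * l * x * y)) * liftComp l y f τ := by
  have hg := quadGauss_ne_zero hp hl
  have hp₀ : (p : ℂ) ≠ 0 := natCast_prime_ne_zero
  have hinv (j : ZMod p) : -(-j⁻¹ * (l * x ^ 2)) = l * x ^ 2 * j⁻¹ := by ring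
  simp only [mul_assoc (quadGauss l)⁻¹, ← Finset.mul_sum]
  rw [sum_mul_liftComp, sum_translateSum_sq_mul hp hl, liftComp_apply, translateSum_apply,
    sum_translate_S hf, translate_zero_S hp hl hplus hk hf]
  simp only [hinv, mul_zero, zero_mul, neg_zero, AddChar.map_zero_eq_one, one_mul]
  split_ifs with hx
  · have heq := translateSum_zero_eq hp hl hplus τ
    simp only [hx, mul_zero, zero_mul, AddChar.map_zero_eq_one, mul_one, ne_eq,
      OfNat.ofNat_ne_zero, not_false_eq_true, zero_pow]
    field_simp
    linear_combination (τ : ℂ) ^ k * heq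
  · field_simp
    ring

end Lift

/-! ### From vector valued forms to scalar valued forms -/

section Descend

variable {p : ℕ} [Fact p.Prime]

local notation "ψ" => ZMod.stdAddChar
local notation "χ" => legendreChar p

/-- Equivariance of `G` under the generators `T` and `S`, for the Weil representation of the
discriminant form `x ↦ l x² / p`. -/
structure IsEquivariant (l : ZMod p) (k : ℤ) (G : ℍ → ZMod p → ℂ) : Prop where
  T_smul : ∀ τ x, G (ModularGroup.T • τ) x = ψ (l * x ^ 2) * G τ x
  S_smul : ∀ τ x, G (ModularGroup.S • τ) x
    = (τ : ℂ) ^ k * ∑ y : ZMod p, (quadGauss l)⁻¹ * ψ (-(2 * l * x * y)) * G τ y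

/-- The pairing of `G` with the row vector attached to the bottom row of `N`. -/
def rowSum (l : ZMod p) (G : ℍ → ZMod p → ℂ) (N : SL(2, ℤ)) (τ : ℍ) : ℂ :=
  ∑ x : ZMod p, weilRow l ((N 1 0 : ℤ) : ZMod p) ((N 1 1 : ℤ) : ZMod p) x * G τ x

/-- The function `τ ↦ (1 / 2) ∑ G_x(p τ)`, which is the inverse image of `G` under the lift. -/
def descend (G : ℍ → ZMod p → ℂ) : ℍ → ℂ :=
  (1 / 2 : ℂ) • ∑ x : ZMod p, (fun τ => G τ x) ∘ scale p

theorem descend_apply (G : ℍ → ZMod p → ℂ) (τ : ℍ) :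
    descend G τ = 1 / 2 * ∑ x : ZMod p, G (scale p τ) x := by
  simp [descend, Finset.sum_apply]

theorem scale_S_smul (τ : ℍ) :
    scale p (ModularGroup.S • τ) = ModularGroup.S • divShift p 0 τ := by
  ext1
  rw [coe_S_smul, coe_scale, coe_S_smul, coe_divShift, Int.cast_zero, add_zero, inv_div,
    mul_neg, ← div_eq_mul_inv]

theorem divShift_T_zpow_smul (n j : ℤ) (τ : ℍ) :
    divShift p n (ModularGroup.T ^ j • τ) = divShift p (n + j) τ := by
  ext1
  rw [coe_divShift, coe_divShift, modular_T_zpow_smul, coe_vadd]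
  push_cast
  ring

theorem SL_mul_apply (M N : SL(2, ℤ)) (i j : Fin 2) :
    (M * N) i j = M i 0 * N 0 j + M i 1 * N 1 j := by
  rw [Matrix.SpecialLinearGroup.coe_mul, Matrix.mul_apply, Fin.sum_univ_two]

theorem mul_T_bottom_row (N : SL(2, ℤ)) :
    (N * ModularGroup.T) 1 0 = N 1 0 ∧ (N * ModularGroup.T) 1 1 = N 1 0 + N 1 1 := by
  rw [SL_mul_apply, SL_mul_apply]
  simp [ModularGroup.T]

theorem mul_S_bottom_row (N : SL(2, ℤ)) :
    (N * ModularGroup.S) 1 0 = N 1 1 ∧ (N * ModularGroup.S) 1 1 = -N 1 0 := by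
  rw [SL_mul_apply, SL_mul_apply]
  simp [ModularGroup.S]

theorem S_mul_bottom_row (M : SL(2, ℤ)) :
    (ModularGroup.S * M) 1 0 = M 0 0 ∧ (ModularGroup.S * M) 1 1 = M 0 1 := by
  rw [SL_mul_apply, SL_mul_apply]
  simp [ModularGroup.S]

theorem bottom_row_ne_zero (N : SL(2, ℤ)) :
    ((N 1 0 : ℤ) : ZMod p) ≠ 0 ∨ ((N 1 1 : ℤ) : ZMod p) ≠ 0 := by
  by_contra! hzero
  have hdet := congrArg (Int.cast : ℤ → ZMod p) N.det_coe
  rw [Matrix.det_fin_two] at hdet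
  push_cast at hdet
  simp [hzero.1, hzero.2] at hdet

variable {l : ZMod p} {k : ℤ} {G : ℍ → ZMod p → ℂ}

theorem IsEquivariant.natCast_vadd (hG : IsEquivariant l k G) (m : ℕ) (τ : ℍ) (x : ZMod p) :
    G ((m : ℝ) +ᵥ τ) x = ψ ((m : ZMod p) * (l * x ^ 2)) * G τ x := by
  induction m with
  | zero => simp
  | succ m ih =>
    have hsucc : ((m + 1 : ℕ) : ℝ) +ᵥ τ = ModularGroup.T • ((m : ℝ) +ᵥ τ) := by
      rw [modular_T_smul, vadd_vadd, Nat.cast_succ, add_comm]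
    rw [hsucc, hG.T_smul, ih, ← mul_assoc, ← AddChar.map_add_eq_mul]
    congr 2
    push_cast
    ring

theorem IsEquivariant.rowSum_T (hG : IsEquivariant l k G) (N : SL(2, ℤ)) (τ : ℍ) :
    rowSum l G N (ModularGroup.T • τ) = rowSum l G (N * ModularGroup.T) τ := by
  obtain ⟨hc, hd⟩ := mul_T_bottom_row N
  refine Finset.sum_congr rfl fun x _ => ?_
  rw [hG.T_smul, ← mul_assoc, weilRow_mul_T, hc, hd, Int.cast_add]

theorem IsEquivariant.rowSum_S (hp : p ≠ 2) (hl : l ≠ 0) (hG : IsEquivariant l k G)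
    (N : SL(2, ℤ)) (τ : ℍ) : rowSum l G N (ModularGroup.S • τ)
      = (τ : ℂ) ^ k * rowSum l G (N * ModularGroup.S) τ := by
  obtain ⟨hc, hd⟩ := mul_S_bottom_row N
  have hterm (x : ZMod p) : weilRow l ((N 1 0 : ℤ) : ZMod p) ((N 1 1 : ℤ) : ZMod p) x
        * G (ModularGroup.S • τ) x
      = ∑ y : ZMod p, (τ : ℂ) ^ k * (weilRow l ((N 1 0 : ℤ) : ZMod p) ((N 1 1 : ℤ) : ZMod p) x
        * ((quadGauss l)⁻¹ * ψ (-(2 * l * y * x))) * G τ y) := by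
    rw [hG.S_smul, Finset.mul_sum, Finset.mul_sum]
    refine Finset.sum_congr rfl fun y _ => ?_
    rw [mul_right_comm (2 * l) y x]
    ring
  rw [rowSum, rowSum, Finset.sum_congr rfl fun x _ => hterm x, Finset.sum_comm, Finset.mul_sum]
  refine Finset.sum_congr rfl fun y _ => ?_
  rw [← Finset.mul_sum, ← Finset.sum_mul, weilRow_mul_S hp hl (bottom_row_ne_zero N), hc, hd,
    Int.cast_neg]

theorem IsEquivariant.rowSum_smul (hp : p ≠ 2) (hl : l ≠ 0) (hG : IsEquivariant l k G)
    (M N : SL(2, ℤ)) (τ : ℍ) :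
    rowSum l G N (M • τ) = cocyc M τ ^ k * rowSum l G (N * M) τ := by
  have hM : M ∈ Subgroup.closure {ModularGroup.S, ModularGroup.T} := by
    rw [SpecialLinearGroup.SL2Z_generators]
    trivial
  induction hM using Subgroup.closure_induction generalizing N τ with
  | mem M hM =>
    rcases hM with rfl | hM
    · rw [hG.rowSum_S hp hl, cocyc_S]
    · rw [Set.mem_singleton_iff.mp hM, hG.rowSum_T, cocyc_T, one_zpow, one_mul]
  | one => simp [cocyc]
  | mul M M' _ _ ihM ihM' =>
    rw [mul_smul, ihM, ihM', cocyc_mul, mul_zpow, mul_assoc, mul_assoc]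
  | inv M _ ih =>
    have hM := ih (N * M⁻¹) (M⁻¹ • τ)
    have hcocyc := cocyc_inv_smul M (M⁻¹ • τ)
    rw [smul_inv_smul] at hM hcocyc
    rw [hM, inv_mul_cancel_right, hcocyc, ← mul_assoc, ← mul_zpow,
      inv_mul_cancel₀ (cocyc_ne_zero M _), one_zpow, one_mul]

theorem rowSum_eq_of_zero (N : SL(2, ℤ)) (hc : ((N 1 0 : ℤ) : ZMod p) = 0) (τ : ℍ) :
    rowSum l G N τ = χ ((N 1 1 : ℤ) : ZMod p) * G τ 0 := by
  simp [rowSum, weilRow, hc]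

theorem rowSum_eq_of_ne_zero (N : SL(2, ℤ)) (hc : ((N 1 0 : ℤ) : ZMod p) ≠ 0)
    (hd : ((N 1 1 : ℤ) : ZMod p) = 0) (τ : ℍ) :
    rowSum l G N τ = (quadGauss l)⁻¹ * χ ((N 1 0 : ℤ) : ZMod p) * ∑ x : ZMod p, G τ x := by
  simp [rowSum, weilRow, hc, hd, Finset.mul_sum]

theorem sum_eq_rowSum_S (hp : p ≠ 2) (hl : l ≠ 0) (G : ℍ → ZMod p → ℂ) (τ : ℍ) :
    ∑ x : ZMod p, G τ x = quadGauss l * rowSum l G ModularGroup.S τ := by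
  rw [rowSum_eq_of_ne_zero _ (by simp [ModularGroup.S]) (by simp [ModularGroup.S])]
  simp [ModularGroup.S, quadGauss_ne_zero hp hl]

theorem exists_scale_smul {M : SL(2, ℤ)} (hM : M ∈ CongruenceSubgroup.Gamma0 p) :
    ∃ M' : SL(2, ℤ), M' 0 0 = M 0 0 ∧ M' 0 1 = p * M 0 1 ∧
      ∀ τ : ℍ, cocyc M' (scale p τ) = cocyc M τ ∧ scale p (M • τ) = M' • scale p τ := by
  obtain ⟨c, hc⟩ := (ZMod.intCast_zmod_eq_zero_iff_dvd _ p).mp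
    (CongruenceSubgroup.Gamma0_mem.mp hM)
  have hdet : M 0 0 * M 1 1 - M 0 1 * M 1 0 = 1 := by
    rw [← Matrix.det_fin_two, M.det_coe]
  let M' : SL(2, ℤ) := ⟨!![M 0 0, p * M 0 1; c, M 1 1], by
    rw [Matrix.det_fin_two_of]
    rw [hc] at hdet
    linear_combination hdet⟩
  have hcocyc (τ : ℍ) : cocyc M' (scale p τ) = cocyc M τ := by
    rw [cocyc, cocyc, coe_scale, hc]
    change (c : ℂ) * (p * τ) + M 1 1 = _
    push_cast
    ring
  refine ⟨M', rfl, rfl, fun τ => ⟨hcocyc τ, ?_⟩⟩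
  ext1
  rw [coe_SL_smul, coe_scale, coe_SL_smul, hcocyc, coe_scale]
  change _ = ((M 0 0 : ℂ) * (p * τ) + (p * M 0 1 : ℤ)) / _
  push_cast
  ring

theorem intCast_mul_eq_one_of_mem_Gamma0 {M : SL(2, ℤ)} (hM : M ∈ CongruenceSubgroup.Gamma0 p) :
    ((M 0 0 : ℤ) : ZMod p) * ((M 1 1 : ℤ) : ZMod p) = 1 := by
  have hdet := congrArg (Int.cast : ℤ → ZMod p) M.det_coe
  rw [Matrix.det_fin_two] at hdet
  push_cast at hdet
  rwa [CongruenceSubgroup.Gamma0_mem.mp hM, mul_zero, sub_zero] at hdet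

theorem IsEquivariant.isCovariant_descend (hp : p ≠ 2) (hl : l ≠ 0) (hG : IsEquivariant l k G) :
    IsCovariant p k (descend G) := by
  intro M hM τ
  obtain ⟨M', ha, hb, hM'⟩ := exists_scale_smul hM
  obtain ⟨hcocyc, hsmul⟩ := hM' τ
  have hdiag := intCast_mul_eq_one_of_mem_Gamma0 hM
  have ha₀ := left_ne_zero_of_mul_eq_one hdiag
  have hχ : χ ((M 0 0 : ℤ) : ZMod p) = χ ((M 1 1 : ℤ) : ZMod p) := by
    rw [← legendreChar_inv, inv_eq_of_mul_eq_one_right hdiag]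
  obtain ⟨hc, hd⟩ := S_mul_bottom_row M'
  rw [ha] at hc
  rw [hb] at hd
  have hg := quadGauss_ne_zero hp hl
  rw [descend_apply, descend_apply, hsmul, sum_eq_rowSum_S hp hl, hG.rowSum_smul hp hl, hcocyc,
    rowSum_eq_of_ne_zero _ (by rwa [hc]) (by simp [hd]), hc, hχ]
  field_simp

theorem IsEquivariant.descend_S (hp : p ≠ 2) (hl : l ≠ 0) (hG : IsEquivariant l k G) (τ : ℍ) :
    descend G (ModularGroup.S • τ) = (1 / 2 * quadGauss l * χ (-1) * (p : ℂ) ^ (-k)) *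
      (τ : ℂ) ^ k * G (divShift p 0 τ) 0 := by
  obtain ⟨hc, hd⟩ := S_mul_bottom_row ModularGroup.S
  rw [descend_apply, scale_S_smul, sum_eq_rowSum_S hp hl, hG.rowSum_S hp hl,
    rowSum_eq_of_zero _ (by rw [hc]; simp [ModularGroup.S]), hd, coe_divShift, Int.cast_zero,
    add_zero, div_zpow, zpow_neg]
  simp [ModularGroup.S]
  ring

theorem exists_mem_Gamma0_mul_S_mul_T {M : SL(2, ℤ)} (hM : M ∉ CongruenceSubgroup.Gamma0 p) :
    ∃ γ ∈ CongruenceSubgroup.Gamma0 p, ∃ j : ℤ,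
      M = γ * (ModularGroup.S * ModularGroup.T ^ j) := by
  rw [CongruenceSubgroup.Gamma0_mem] at hM
  obtain ⟨j, hj⟩ := ZMod.intCast_surjective (((M 1 1 : ℤ) : ZMod p) * ((M 1 0 : ℤ) : ZMod p)⁻¹)
  refine ⟨M * (ModularGroup.S * ModularGroup.T ^ j)⁻¹, ?_, j, by group⟩
  have hc : (M * (ModularGroup.S * ModularGroup.T ^ j)⁻¹) 1 0 = M 1 0 * j - M 1 1 := by
    rw [mul_inv_rev, ← zpow_neg]
    simp only [SL_mul_apply, ModularGroup.coe_T_zpow, Matrix.SpecialLinearGroup.coe_inv,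
      Matrix.adjugate_fin_two]
    simp [ModularGroup.S]
    ring
  rw [CongruenceSubgroup.Gamma0_mem, hc]
  push_cast
  rw [hj, mul_left_comm, mul_inv_cancel₀ hM, mul_one, sub_self]

theorem slashSL_one (k : ℤ) (f : ℍ → ℂ) : slashSL k 1 f = f := by
  funext τ
  simp [slashSL, cocyc]

theorem IsCovariant.slashSL_mul {f : ℍ → ℂ} (hf : IsCovariant p k f) {γ : SL(2, ℤ)}
    (hγ : γ ∈ CongruenceSubgroup.Gamma0 p) (N : SL(2, ℤ)) :
    slashSL k (γ * N) f = χ ((γ 1 1 : ℤ) : ZMod p) • slashSL k N f := by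
  funext τ
  have hγ₀ := zpow_ne_zero k (cocyc_ne_zero γ (N • τ))
  simp only [slashSL, Pi.smul_apply, smul_eq_mul]
  rw [mul_smul, hf γ hγ, cocyc_mul, mul_zpow, zpow_neg (cocyc γ _)]
  field_simp

theorem IsEquivariant.slashSL_S_mul_T (hp : p ≠ 2) (hl : l ≠ 0) (hG : IsEquivariant l k G)
    (j : ℤ) : slashSL k (ModularGroup.S * ModularGroup.T ^ j) (descend G)
      = (1 / 2 * quadGauss l * χ (-1) * (p : ℂ) ^ (-k)) • ((fun τ => G τ 0) ∘ divShift p j) := by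
  funext τ
  have hcocyc : cocyc (ModularGroup.T ^ j) τ = 1 := by
    rw [cocyc, ModularGroup.coe_T_zpow]
    simp
  have hτ := zpow_ne_zero k (ModularGroup.T ^ j • τ : ℍ).ne_zero
  simp only [slashSL, Pi.smul_apply, smul_eq_mul, Function.comp_apply]
  rw [mul_smul, hG.descend_S hp hl, divShift_T_zpow_smul, zero_add, cocyc_mul, hcocyc, mul_one,
    cocyc_S, zpow_neg (_ : ℂ) k]
  field_simp

theorem hasPrincipalPart_descend
    (hpp : ∀ x, HasPrincipalPart (exponents (l * x ^ 2)) fun τ => G τ x) :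
    HasPrincipalPart (Set.range fun n : ℤ => (n : ℝ)) (descend G) := by
  have hp₀ := (natCast_prime_pos p).ne'
  refine (HasPrincipalPart.sum _ fun x _ => (hpp x).comp_aff ?_).smul _
  rintro _ ⟨n, -, rfl⟩
  exact ⟨n, by field_simp⟩

theorem IsEquivariant.hasPrincipalPart_slashSL (hp : p ≠ 2) (hl : l ≠ 0) (hG : IsEquivariant l k G)
    (hpp : ∀ x, HasPrincipalPart (exponents (l * x ^ 2)) fun τ => G τ x) (M : SL(2, ℤ)) :
    HasPrincipalPart (Set.range fun n : ℤ => (n : ℝ) / p) (slashSL k M (descend G)) := by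
  have hp₀ := (natCast_prime_pos p).ne'
  have hcov := hG.isCovariant_descend hp hl
  by_cases hM : M ∈ CongruenceSubgroup.Gamma0 p
  · rw [← mul_one M, hcov.slashSL_mul hM, slashSL_one]
    refine ((hasPrincipalPart_descend hpp).mono ?_).smul _
    rintro _ ⟨n, rfl⟩
    exact ⟨n * p, by push_cast; field_simp⟩
  · obtain ⟨γ, hγ, j, rfl⟩ := exists_mem_Gamma0_mul_S_mul_T hM
    rw [hcov.slashSL_mul hγ, hG.slashSL_S_mul_T hp hl]
    refine (((hpp 0).comp_aff ?_).smul _).smul _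
    rintro _ ⟨n, hn, rfl⟩
    rw [zero_pow two_ne_zero, mul_zero] at hn
    obtain ⟨m, rfl⟩ := (ZMod.intCast_zmod_eq_zero_iff_dvd n p).mp hn
    exact ⟨m, by push_cast; field_simp⟩

theorem IsEquivariant.descend_mem_maassForms (hp : p ≠ 2) (hl : l ≠ 0) (hG : IsEquivariant l k G)
    (hs : ∀ x, IsSmooth fun τ => G τ x) (hΔ : ∀ x τ, laplace k (fun τ => G τ x) τ = 0)
    (hpp : ∀ x, HasPrincipalPart (exponents (l * x ^ 2)) fun τ => G τ x) :
    descend G ∈ maassForms p (legendreChar p) k := by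
  have hcomp (x : ZMod p) : IsSmooth ((fun τ => G τ x) ∘ scale p) := (hs x).comp_aff
  refine ⟨(IsSmooth.sum _ fun x _ => hcomp x).smul _, hG.isCovariant_descend hp hl,
    fun τ => ?_, hasPrincipalPart_descend hpp, hG.hasPrincipalPart_slashSL hp hl hpp⟩
  rw [descend, laplace_smul, laplace_sum k _ fun x _ => hcomp x, Finset.sum_eq_zero, mul_zero]
  exact fun x _ => (laplace_comp_aff k (hs x) τ).trans (hΔ x _)

theorem IsEquivariant.translateSum_descend (hG : IsEquivariant l k G) (r : ZMod p) (τ : ℍ) :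
    translateSum r (descend G) τ
      = 1 / 2 * p * ∑ x : ZMod p, if l * x ^ 2 = r then G τ x else 0 := by
  have hterm (j : ZMod p) : ψ (-(j * r)) * translate j (descend G) τ
      = ∑ x : ZMod p, 1 / 2 * (ψ ((l * x ^ 2 - r) * j) * G τ x) := by
    rw [translate_apply, descend_apply, scale_divShift, Int.cast_natCast, Finset.mul_sum,
      Finset.mul_sum]
    refine Finset.sum_congr rfl fun x _ => ?_
    have hsplit : (l * x ^ 2 - r) * j = -(j * r) + j * (l * x ^ 2) := by ring
    rw [hG.natCast_vadd, hsplit, AddChar.map_add_eq_mul, ZMod.natCast_zmod_val]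
    ring
  rw [translateSum_apply, Finset.sum_congr rfl fun j _ => hterm j, Finset.sum_comm, Finset.mul_sum]
  refine Finset.sum_congr rfl fun x _ => ?_
  rw [← Finset.mul_sum, ← Finset.sum_mul, sum_stdAddChar_mul]
  simp only [sub_eq_zero]
  split_ifs <;> ring

theorem IsEquivariant.isPlus_descend (hl : l ≠ 0) (hG : IsEquivariant l k G) :
    IsPlus l (descend G) := by
  intro r hr τ
  rw [hG.translateSum_descend, Finset.sum_eq_zero, mul_zero]
  refine fun x _ => if_neg ?_
  rintro rfl
  have hsq : χ x * χ x = -1 := by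
    refine mul_left_cancel₀ (legendreChar_ne_zero hl) ?_
    rw [← map_mul, ← map_mul, ← sq, hr, mul_neg_one]
  rcases eq_or_ne x 0 with rfl | hx
  · simp [legendreChar_zero] at hsq
  · norm_num [legendreChar_mul_self hx] at hsq

/-! ### The two constructions are mutually inverse -/

theorem descend_liftComp (hp : p ≠ 2) (hl : l ≠ 0) {f : ℍ → ℂ} (hf : IsPlus l f) :
    descend (fun τ x => liftComp l x f τ) = f := by
  have hp₀ : (p : ℂ) ≠ 0 := natCast_prime_ne_zero
  funext τ
  have hsum := sum_mul_liftComp l f (fun _ => 1) (scale p τ)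
  have htranslate : translate (0 : ZMod p) f (scale p τ) = f τ := by
    rw [translate_apply, divShift_scale]
    simp
  simp only [one_mul] at hsum
  rw [descend_apply, hsum, sum_translateSum_sq hp hl hf, htranslate]
  field_simp
  ring

theorem sum_stdAddChar_mul_S_smul (hp : p ≠ 2) (hl : l ≠ 0) (hG : IsEquivariant l k G)
    (τ : ℍ) (x : ZMod p) :
    ∑ y : ZMod p, ψ (-(2 * l * x * y)) * G (ModularGroup.S • τ) y
      = (τ : ℂ) ^ k * (quadGauss l)⁻¹ * p * G τ (-x) := by
  have hterm (y : ZMod p) : ψ (-(2 * l * x * y)) * G (ModularGroup.S • τ) y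
      = ∑ z : ZMod p, (τ : ℂ) ^ k * (quadGauss l)⁻¹ *
        (ψ (-(2 * l * (x + z)) * y) * G τ z) := by
    rw [hG.S_smul, Finset.mul_sum, Finset.mul_sum]
    refine Finset.sum_congr rfl fun z _ => ?_
    have hsplit : -(2 * l * (x + z)) * y = -(2 * l * x * y) + -(2 * l * y * z) := by ring
    rw [hsplit, AddChar.map_add_eq_mul]
    ring
  have hzero (z : ZMod p) : -(2 * l * (x + z)) = 0 ↔ z = -x := by
    rw [neg_eq_zero, mul_eq_zero, or_iff_right (mul_ne_zero (two_ne_zero_zmod hp) hl), add_comm,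
      add_eq_zero_iff_eq_neg]
  rw [Finset.sum_congr rfl fun y _ => hterm y, Finset.sum_comm]
  simp only [← Finset.mul_sum, ← Finset.sum_mul, sum_stdAddChar_mul, hzero, ite_mul, zero_mul,
    Finset.sum_ite_eq', Finset.mem_univ, if_true]
  ring

theorem IsEquivariant.neg_apply (hp : p ≠ 2) (hl : l ≠ 0) (hk : (-1 : ℂ) ^ k = χ (-1))
    (hG : IsEquivariant l k G) (τ : ℍ) (x : ZMod p) : G τ (-x) = G τ x := by
  have hg := quadGauss_ne_zero hp hl
  have hgg := quadGauss_mul_self hp hl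
  have hτ : (τ : ℂ) ^ k ≠ 0 := zpow_ne_zero _ τ.ne_zero
  have hSS := hG.S_smul (ModularGroup.S • τ) x
  simp only [mul_assoc (quadGauss l)⁻¹, ← Finset.mul_sum] at hSS
  rw [S_smul_S_smul, sum_stdAddChar_mul_S_smul hp hl hG, coe_S_smul, ← neg_one_mul, mul_zpow, hk,
    inv_zpow] at hSS
  rw [hSS]
  field_simp
  rw [sq, hgg]
  ring

theorem liftComp_descend (hp : p ≠ 2) (hl : l ≠ 0) (hk : (-1 : ℂ) ^ k = χ (-1))
    (hG : IsEquivariant l k G) (x : ZMod p) (τ : ℍ) : liftComp l x (descend G) τ = G τ x := by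
  have hp₀ : (p : ℂ) ≠ 0 := natCast_prime_ne_zero
  have hroots (y : ZMod p) : l * y ^ 2 = l * x ^ 2 ↔ y = x ∨ y = -x := by
    rw [mul_right_inj' hl, sq_eq_sq_iff_eq_or_eq_neg]
  rw [liftComp_apply, hG.translateSum_descend]
  simp only [hroots]
  rcases eq_or_ne x 0 with rfl | hx
  · simp only [neg_zero, or_self, Finset.sum_ite_eq', Finset.mem_univ, if_true]
    field_simp
  · have hne : x ≠ -x := fun h =>
      mul_ne_zero (two_ne_zero_zmod hp) hx (by linear_combination h)
    have hpair : (Finset.univ.filter fun y : ZMod p => y = x ∨ y = -x) = {x, -x} := by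
      ext y
      simp
    rw [if_neg hx, ← Finset.sum_filter, hpair, Finset.sum_pair hne, hG.neg_apply hp hl hk]
    field_simp
    ring

end Descend

/-! ### The isomorphism -/

section Isomorphism

variable {p : ℕ} [Fact p.Prime]

local notation "ψ" => ZMod.stdAddChar
local notation "χ" => legendreChar p

theorem eCircle_injective : Function.Injective eCircle := fun _ _ h =>
  AddCircle.injective_toCircle one_ne_zero (Subtype.ext h)

theorem e_neg_div_two (k : ℤ) : e (-(k : ℂ) / 2) = (-1) ^ k := by
  rw [← Complex.exp_neg_pi_mul_I, ← Complex.exp_int_mul, e]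
  congr 1
  ring

variable {A : Type*} [AddCommGroup A] [Fintype A] {ι : A ≃+ ZMod p} {Q : A → UnitAddCircle}
  {l : ZMod p} {sig k : ℤ}

theorem IsPrimeDisc.coe_div_eq_iff (h : IsPrimeDisc ι Q l sig) (n : ℤ) (γ : A) :
    (((n : ℝ) / p : ℝ) : UnitAddCircle) = Q γ ↔ (n : ZMod p) = l * ι γ ^ 2 := by
  rw [← eCircle_injective.eq_iff, h.eCircle_eq, eCircle_coe, ← stdAddChar_intCast,
    ZMod.injective_stdAddChar.eq_iff]

theorem IsPrimeDisc.setOf_eq_exponents (h : IsPrimeDisc ι Q l sig) (γ : A) :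
    {x : ℝ | (x : UnitAddCircle) = Q γ} = exponents (l * ι γ ^ 2) := by
  have hp₀ := (natCast_prime_pos p).ne'
  ext x
  constructor
  · intro (hx : (x : UnitAddCircle) = Q γ)
    obtain ⟨v, hv⟩ := ZMod.intCast_surjective (l * ι γ ^ 2)
    rw [← (h.coe_div_eq_iff v γ).mpr hv, ← sub_eq_zero, ← AddCircle.coe_sub,
      AddCircle.coe_eq_zero_iff] at hx
    obtain ⟨m, hm⟩ := hx
    refine ⟨v + p * m, by simp [hv], ?_⟩
    rw [zsmul_eq_mul, mul_one, eq_sub_iff_add_eq] at hm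
    rw [← hm]
    push_cast
    field_simp
    ring
  · rintro ⟨n, hn, rfl⟩
    exact (h.coe_div_eq_iff n γ).mpr hn

theorem IsPrimeDisc.neg_one_zpow (h : IsPrimeDisc ι Q l sig) (hp : p ≠ 2) (hl : l ≠ 0)
    (hk : 2 * k ≡ sig [ZMOD 4]) : (-1 : ℂ) ^ k = χ (-1) := by
  have hp₀ : (p : ℂ) ≠ 0 := natCast_prime_ne_zero
  have hκ := legendreChar_mul_self (p := p) (neg_ne_zero.mpr one_ne_zero)
  have hκ₀ := legendreChar_ne_zero (p := p) (neg_ne_zero.mpr one_ne_zero)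
  have hcard : Fintype.card A = p := by rw [Fintype.card_congr ι.toEquiv, ZMod.card]
  have hsqrt : ((Real.sqrt p : ℝ) : ℂ) * ((Real.sqrt p : ℝ) : ℂ) = p := by
    rw [← Complex.ofReal_mul, Real.mul_self_sqrt (Nat.cast_nonneg p), Complex.ofReal_natCast]
  obtain ⟨m, hm⟩ := hk.dvd
  have hphase : -(sig : ℂ) / 8 + -(sig : ℂ) / 8 = ((-m : ℤ) : ℂ) + -(k : ℂ) / 2 := by
    have hm' : (sig : ℂ) - 2 * k = 4 * m := by exact_mod_cast hm
    push_cast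
    linear_combination -hm' / 4
  have hsq := congrArg (fun z : ℂ => z * z) h.const_eq
  rw [hcard, div_mul_div_comm, hsqrt, ← mul_inv, quadGauss_mul_self hp hl, ← e_add, hphase, e_add,
    e_intCast, one_mul, e_neg_div_two] at hsq
  field_simp at hsq
  linear_combination χ (-1) * hsq - (-1 : ℂ) ^ k * hκ

/-- The lift as a linear map. -/
def liftMap (ι : A ≃+ ZMod p) (l : ZMod p) : (ℍ → ℂ) →ₗ[ℂ] (ℍ → A → ℂ) where
  toFun f τ γ := liftComp l (ι γ) f τ
  map_add' f g := by
    funext τ γ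
    rw [map_add]
    rfl
  map_smul' c f := by
    funext τ γ
    rw [map_smul]
    rfl

/-- The descent as a map on functions with values in `ℂ[A]`. -/
def descendMap (ι : A ≃+ ZMod p) (F : ℍ → A → ℂ) : ℍ → ℂ :=
  descend fun τ x => F τ (ι.symm x)

theorem isLift_liftMap (h : IsPrimeDisc ι Q l sig) (f : ℍ → ℂ) :
    IsLift p Q k f (liftMap ι l f) := by
  classical
  intro cp cm hexp τ γ
  have hp₀ : (p : ℂ) ≠ 0 := natCast_prime_ne_zero
  have hsum := (hexp.hasSum_translateSum (l * ι γ ^ 2) τ).mul_left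
    ((if ι γ = 0 then 2 else 1) * (p : ℂ)⁻¹)
  refine (hasSum_subtype_iff_indicator (f := fun n : ℤ => (if γ = 0 then (2 : ℂ) else 1) *
    (coeff k cp cm n (τ.im / p) * e ((n : ℂ) / p * τ)))
    (s := {n : ℤ | (((n : ℝ) / p : ℝ) : UnitAddCircle) = Q γ})).mpr (hsum.congr_fun fun n => ?_)
  rw [Set.indicator_apply]
  simp only [Set.mem_ofPred_eq, h.coe_div_eq_iff, EmbeddingLike.map_eq_zero_iff]
  split_ifs <;> field_simp <;> ring

/-- `W` is the space of vector valued forms for the Weil representation attached to `Q`, with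
equivariance required for the generators `T` and `S` only. -/
def IsFormSpace (Q : A → UnitAddCircle) (sig k : ℤ) (W : Submodule ℂ (ℍ → A → ℂ)) : Prop :=
  ∀ F : ℍ → A → ℂ, F ∈ W ↔ (∀ γ, IsSmooth fun τ => F τ γ) ∧
    ((∀ τ : ℍ, F (ModularGroup.T • τ) = (weilT Q).mulVec (F τ)) ∧
      ∀ τ : ℍ, F (ModularGroup.S • τ) = (τ : ℂ) ^ k • (weilS Q sig).mulVec (F τ)) ∧
    (∀ γ τ, laplace k (fun τ => F τ γ) τ = 0) ∧
    ∀ γ, HasPrincipalPart {n : ℝ | (n : UnitAddCircle) = Q γ} fun τ => F τ γ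

theorem IsPrimeDisc.isEquivariant (h : IsPrimeDisc ι Q l sig) {F : ℍ → A → ℂ}
    (hT : ∀ τ : ℍ, F (ModularGroup.T • τ) = (weilT Q).mulVec (F τ))
    (hS : ∀ τ : ℍ, F (ModularGroup.S • τ) = (τ : ℂ) ^ k • (weilS Q sig).mulVec (F τ)) :
    IsEquivariant l k fun τ x => F τ (ι.symm x) := by
  refine ⟨fun τ x => ?_, fun τ x => ?_⟩
  · rw [hT, h.weilT_mulVec, ι.apply_symm_apply]
  · rw [hS, Pi.smul_apply, smul_eq_mul, h.weilS_mulVec, ι.apply_symm_apply]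

theorem isPlus_of_mem_maassPlus {lam : ℤ} {f : ℍ → ℂ}
    (hf : f ∈ maassPlus p k (legendreSym p lam)) : IsPlus (lam : ZMod p) f := by
  obtain ⟨-, cp, cm, hexp, hvanish⟩ := hf
  refine fun r hr τ => translateSum_eq_zero hexp (fun n hn => hvanish n ?_) τ
  rw [← hn, legendreChar_intCast, legendreChar_intCast] at hr
  exact_mod_cast hr

theorem mem_maassPlus_of_isPlus {lam : ℤ} {f : ℍ → ℂ} (hf : f ∈ maassForms p (legendreChar p) k)
    (hplus : IsPlus (lam : ZMod p) f) : f ∈ maassPlus p k (legendreSym p lam) := by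
  obtain ⟨hs, hcov, hΔ, hpp, -⟩ := id hf
  have hper (τ : ℍ) : f ((1 : ℝ) +ᵥ τ) = f τ := by
    simpa using IsCovariant.int_vadd hcov 1 τ
  obtain ⟨cp, cm, hexp, hvanish⟩ := exists_isFourierExpansion hs hper hΔ hpp
  refine ⟨hf, cp, cm, hexp, fun n hn => hvanish n fun y hy =>
    fourierMode_eq_zero_of_translateSum_eq_zero hs hper (hplus n ?_) hy⟩
  rw [legendreChar_intCast, legendreChar_intCast, hn, Int.cast_neg]

section FormSpace

variable {W : Submodule ℂ (ℍ → A → ℂ)} {lam : ℤ} (hp : p ≠ 2) (hl : (lam : ZMod p) ≠ 0)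
  (h : IsPrimeDisc ι Q (lam : ZMod p) sig) (hW : IsFormSpace Q sig k W)

include hp hl h hW

theorem IsPrimeDisc.liftMap_mem (hk : (-1 : ℂ) ^ k = legendreChar p (-1)) {f : ℍ → ℂ}
    (hf : f ∈ maassPlus p k (legendreSym p lam)) : liftMap ι (lam : ZMod p) f ∈ W := by
  have hplus := isPlus_of_mem_maassPlus hf
  obtain ⟨⟨hs, hcov, hΔ, hpp, -⟩, -⟩ := hf
  refine (hW _).mpr ⟨fun γ => (hs.translateSum _).smul _, ⟨fun τ => ?_, fun τ => ?_⟩,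
    fun γ τ => ?_, fun γ => ?_⟩
  · funext γ
    rw [h.weilT_mulVec]
    exact liftComp_T hcov _ _ _
  · funext γ
    rw [Pi.smul_apply, smul_eq_mul, h.weilS_mulVec]
    refine (liftComp_S hp hl hk hcov hplus (ι γ) τ).trans ?_
    congr 1
    refine Finset.sum_congr rfl fun y _ => ?_
    change _ = _ * liftComp (lam : ZMod p) (ι (ι.symm y)) f τ
    rw [ι.apply_symm_apply]
  · refine (laplace_smul k _ _ τ).trans ?_
    rw [laplace_translateSum hs hΔ, mul_zero]
  · rw [h.setOf_eq_exponents]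
    exact (hpp.translateSum _).smul _

theorem IsPrimeDisc.descendMap_mem {F : ℍ → A → ℂ} (hF : F ∈ W) :
    descendMap ι F ∈ maassPlus p k (legendreSym p lam) := by
  obtain ⟨hs, ⟨hT, hS⟩, hΔ, hpp⟩ := (hW F).mp hF
  have hG := h.isEquivariant hT hS
  have hpp' (x : ZMod p) :
      HasPrincipalPart (exponents ((lam : ZMod p) * x ^ 2)) fun τ => F τ (ι.symm x) := by
    have hx := hpp (ι.symm x)
    rwa [h.setOf_eq_exponents, ι.apply_symm_apply] at hx
  exact mem_maassPlus_of_isPlus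
    (hG.descend_mem_maassForms hp hl (fun _ => hs _) (fun _ => hΔ _) hpp') (hG.isPlus_descend hl)

theorem IsPrimeDisc.exists_linearEquiv (hk : 2 * k ≡ sig [ZMOD 4]) :
    ∃ Φ : ↥(maassPlus p k (legendreSym p lam)) ≃ₗ[ℂ] ↥W,
      ∀ f : ↥(maassPlus p k (legendreSym p lam)),
        IsLift p Q k (f : ℍ → ℂ) (Φ f : ℍ → A → ℂ) := by
  have hk' := h.neg_one_zpow hp hl hk
  refine ⟨{ (liftMap ι (lam : ZMod p)).restrict fun f hf => h.liftMap_mem hp hl hW hk' hf with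
    invFun := fun F => ⟨descendMap ι F, h.descendMap_mem hp hl hW F.2⟩
    left_inv := fun f => Subtype.ext ?_
    right_inv := fun F => Subtype.ext ?_ }, fun f => isLift_liftMap h f⟩
  · refine Eq.trans ?_ (descend_liftComp hp hl (isPlus_of_mem_maassPlus f.2))
    change descend (fun τ x => liftComp (lam : ZMod p) (ι (ι.symm x)) (f : ℍ → ℂ) τ) = _
    simp only [ι.apply_symm_apply]
  · obtain ⟨-, ⟨hT, hS⟩, -⟩ := (hW F).mp F.2
    funext τ γ
    refine (liftComp_descend hp hl hk' (h.isEquivariant hT hS) (ι γ) τ).trans ?_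
    rw [ι.symm_apply_apply]

end FormSpace

end Isomorphism

end MaassLift

end

theorem mainTheorem3 (p : ℕ) [Fact p.Prime] (hp : p ≠ 2)
    {V : Type*} [AddCommGroup V] [Module ℚ V] (L : MaassLift.EvenLattice V)
    (ι : L.Disc ≃+ ZMod p) (lam : ℤ)
    (hlam : ∀ γ : L.Disc,
      L.discQ γ = (((lam : ℝ) * ((ι γ).val : ℝ) ^ 2 / (p : ℝ) : ℝ) : UnitAddCircle))
    (k : ℤ) (hk : 2 * k ≡ (L.bPlus : ℤ) - (L.bMinus : ℤ) [ZMOD 4])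
    (ε δ : ℤ) (hε : ε = legendreSym p lam) (hδ : δ = legendreSym p (-1) * ε) :
    (∃ Φ : ↥(MaassLift.maassPlus p k ε) ≃ₗ[ℂ] ↥(MaassLift.vectorMaass L k),
      ∀ f : ↥(MaassLift.maassPlus p k ε), MaassLift.IsLift p L.discQ k (f : UpperHalfPlane → ℂ)
        (Φ f : UpperHalfPlane → L.Disc → ℂ)) ∧
    (∃ Φ : ↥(MaassLift.maassPlus p k δ) ≃ₗ[ℂ] ↥(MaassLift.vectorMaassDual L k),
      ∀ f : ↥(MaassLift.maassPlus p k δ), MaassLift.IsLift p (fun γ => -L.discQ γ) k (f : UpperHalfPlane → ℂ)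
        (Φ f : UpperHalfPlane → L.Disc → ℂ)) := by
  have hl := L.intCast_ne_zero_of_disc ι lam hlam
  obtain ⟨r, hr, hgauss⟩ := L.exists_gauss_eq
  have h : MaassLift.IsPrimeDisc ι L.discQ (lam : ZMod p) ((L.bPlus : ℤ) - L.bMinus) :=
    MaassLift.isPrimeDisc_of_sum hp hl
      (fun γ => by rw [hlam, MaassLift.eCircle_coe_mul_val_sq_div]) hr hgauss
  have hδ' : δ = legendreSym p (-lam) := by
    rw [hδ, hε, ← legendreSym.mul, neg_one_mul]
  have hl' : ((-lam : ℤ) : ZMod p) ≠ 0 := by simpa using hl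
  have h' : MaassLift.IsPrimeDisc ι (fun γ => -L.discQ γ) ((-lam : ℤ) : ZMod p)
      (-((L.bPlus : ℤ) - L.bMinus)) := by
    rw [Int.cast_neg]
    exact h.neg
  have hk' : 2 * k ≡ -((L.bPlus : ℤ) - L.bMinus) [ZMOD 4] := by
    rw [Int.modEq_iff_dvd] at hk ⊢
    omega
  rw [hε, hδ']
  refine ⟨h.exists_linearEquiv hp hl (fun F => ?_) hk,
    h'.exists_linearEquiv hp hl' (fun F => ?_) hk'⟩
  · rw [← MaassLift.isWeil_equivariant_iff]
    rfl
  · rw [← MaassLift.isWeilDual_equivariant_iff (h.weilS_mul_weilS_neg hp hl)]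
    rfl
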